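/- A box is a nondegenerate cuboid in $\mathbb R^3$ with edges parallel to the coordinate axes. An orthogonal polyhedron is a connected 3-manifold with boundary in $\mathbb R^3$ that is a union of finitely many boxes. An edge of it is a maximal open segment along which the polyhedron is locally a wedge of interior dihedral angle $\pi/2$ (convex edge) or $3\pi/2$ (reflex edge). The polyhedron is 2-reflex if its reflex edges lie in at most two different directions, i.e. if none of them is parallel to some coordinate axis; fix such an axis and call it vertical. The polyhedron is then partitioned into bricks, i.e. maximal boxes whose section by every horizontal plane strictly between their bottom and top is a connected component of the section of the whole polyhedron; distinct bricks are disjoint or meet in a rectangle contained in a top face of one and a bottom face of the other, called a contact rectangle. A contact rectangle of a lower and an upper brick is a collar if the horizontal cross-section of one of the two bricks lies in the interior of that of the other. Lemma. Let $\mathcal P$ be a 2-reflex orthogonal polyhedron with $m$ edges, of which $r$ are reflex, with $b$ collars and genus $g$, where the genus is that of the boundary surface, i.e. the maximum number of pairwise disjoint simple closed curves along which it can be cut without being disconnected. Then $$m\geqslant 4r-12g-4b+12.$$ -/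

import Mathlib

open Set Topology

namespace OrthoPoly

/-- Points of three-dimensional space, given by their coordinates. -/
abbrev Point : Type := Fin 3 → ℝ

/-- `P` is a 3-manifold with boundary in `ℝ³`: around each of its points there is a local
homeomorphism of the ambient space that straightens `P` to the closed half-space `0 ≤ y 0`. -/
def IsManifoldWithBoundary (P : Set Point) : Prop :=
  ∀ p ∈ P, ∃ e : OpenPartialHomeomorph Point Point,
    p ∈ e.source ∧ ∀ q ∈ e.source, (q ∈ P ↔ 0 ≤ e q 0)

/-- `P` is the union of finitely many boxes, i.e. nondegenerate axis-parallel cuboids. -/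
def IsUnionOfBoxes (P : Set Point) : Prop :=
  ∃ B : Finset (Point × Point),
    (∀ c ∈ B, ∀ i, c.1 i < c.2 i) ∧ P = ⋃ c ∈ B, Icc c.1 c.2

/-- Orthogonal polyhedra: connected 3-manifolds with boundary in `ℝ³` that are unions of
finitely many boxes. -/
def IsOrthogonalPolyhedron (P : Set Point) : Prop :=
  IsConnected P ∧ IsManifoldWithBoundary P ∧ IsUnionOfBoxes P

/-! ### Edges -/

/-- Near `p` the set `P` is a wedge of dihedral angle `π / 2` whose ridge passes through `p`
and is parallel to the `i`-th axis. -/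
def IsConvexEdgePoint (P : Set Point) (i : Fin 3) (p : Point) : Prop :=
  ∃ s : Fin 3 → ℝ, (∀ j, s j ≠ 0) ∧
    ∀ᶠ q in 𝓝 p, (q ∈ P ↔ ∀ j, j ≠ i → 0 ≤ s j * (q j - p j))

/-- Near `p` the set `P` is a wedge of dihedral angle `3 π / 2` whose ridge passes through `p`
and is parallel to the `i`-th axis. -/
def IsReflexEdgePoint (P : Set Point) (i : Fin 3) (p : Point) : Prop :=
  ∃ s : Fin 3 → ℝ, (∀ j, s j ≠ 0) ∧
    ∀ᶠ q in 𝓝 p, (q ∈ P ↔ ∃ j, j ≠ i ∧ 0 ≤ s j * (q j - p j))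

/-- The points in the relative interior of an edge of `P`. -/
def edgePoints (P : Set Point) : Set Point :=
  {p | ∃ i, IsConvexEdgePoint P i p ∨ IsReflexEdgePoint P i p}

/-- The edges of `P` (without their endpoints). -/
def edges (P : Set Point) : Set (Set Point) :=
  {e | ∃ p ∈ edgePoints P, e = connectedComponentIn (edgePoints P) p}

/-- The reflex edges of `P`. -/
def reflexEdges (P : Set Point) : Set (Set Point) :=
  {e ∈ edges P | ∀ p ∈ e, ∃ i, IsReflexEdgePoint P i p}

/-- `P` is a 2-reflex orthogonal polyhedron for which the `k`-th axis may be taken as the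
vertical one: no reflex edge of `P` is parallel to the `k`-th axis. -/
def IsTwoReflex (P : Set Point) (k : Fin 3) : Prop :=
  IsOrthogonalPolyhedron P ∧ ∀ p, ¬ IsReflexEdgePoint P k p

/-! ### Bricks and collars, with respect to the vertical axis `k` -/

/-- The box with opposite corners `a` and `b` meets each horizontal plane strictly between its
bottom and its top in a whole connected component of the section of `P` by that plane. -/
def IsSectionBox (P : Set Point) (k : Fin 3) (a b : Point) : Prop :=
  (∀ i, a i < b i) ∧
    ∀ p ∈ Icc a b, a k < p k → p k < b k →
      connectedComponentIn {q ∈ P | q k = p k} p = {q ∈ Icc a b | q k = p k}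

/-- The box with opposite corners `a` and `b` is a brick of `P`. -/
def IsBrick (P : Set Point) (k : Fin 3) (a b : Point) : Prop :=
  IsSectionBox P k a b ∧
    ∀ a' b', IsSectionBox P k a' b' → Icc a b ⊆ Icc a' b' → a' = a ∧ b' = b

/-- The horizontal section of the box `(a, b)` lies strictly inside that of the box
`(a', b')`, on all four sides. -/
def IsNarrower (k : Fin 3) (a b a' b' : Point) : Prop :=
  ∀ i, i ≠ k → a' i < a i ∧ b i < b' i

/-- The collars of `P`: the contact rectangles of a brick `(a, b)` with a brick `(a', b')` on
top of it, one of the two being strictly narrower than the other on all four sides. -/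
def collars (P : Set Point) (k : Fin 3) : Set (Set Point) :=
  {R | ∃ a b a' b', IsBrick P k a b ∧ IsBrick P k a' b' ∧ b k = a' k ∧
    R = Icc a b ∩ Icc a' b' ∧ (IsNarrower k a' b' a b ∨ IsNarrower k a b a' b')}

/-! ### Genus -/

/-- `c` is a simple closed curve. -/
def IsSimpleClosedCurve (c : Set Point) : Prop :=
  ∃ γ : Circle → Point, Continuous γ ∧ Function.Injective γ ∧ c = range γ

/-- One can cut the surface `S` along `n` pairwise disjoint simple closed curves without
disconnecting any of its connected components. -/
def CanCut (S : Set Point) (n : ℕ) : Prop :=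
  ∃ c : Fin n → Set Point,
    (∀ i, IsSimpleClosedCurve (c i) ∧ c i ⊆ S) ∧
    (∀ i j, i ≠ j → Disjoint (c i) (c j)) ∧
    ∀ x ∈ S, IsPreconnected (connectedComponentIn S x \ ⋃ i, c i)

/-- The genus of `P`, i.e. of its boundary surface: the maximum number of cuts along disjoint
simple closed curves that leave the surface connected. -/
noncomputable def genus (P : Set Point) : ℕ∞ :=
  ⨆ (n : ℕ) (_ : CanCut (frontier P) n), (n : ℕ∞)

end OrthoPoly

/-! Let `C` and `R` be the numbers of convex and of reflex edges, each edge being counted at its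
upper end, i.e. the end with the larger coordinate along the edge. Then `m - 4r` is `C - 3R`, a sum
of local weights `1` and `-3` over points, and the weight at a point depends only on which of the
eight octants at that point are filled.

Since the polyhedron is a manifold without vertical reflex edges, cutting it along all horizontal
planes through corners of its boxes gives a finite set `D` of boxes that meet only top to bottom, in
rectangles of positive area (`exists_isDecomposition`). At a point at most one box of `D` ends from
below and at most one starts above, so the local weight is that of an isolated top, plus that of an
isolated bottom, plus a correction due to their contact. An isolated box contributes `8 + 4 = 12`,
the number of its edges. The correction of a contact is concentrated in the corners of the contact
rectangle, and a finite check of the possible relative positions (`sum_contactScore`) shows that it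
is at least `-12`, and at least `-16` for a collar, whose four reflex edges replace four convex
ones. Hence `C - 3R` is at least `12` times the number of boxes minus contacts, minus `4` for each
collar (`IsDecomposition.card_ends_ge`). The planes of the decomposition may cut a maximal brick
into several boxes; such artificial contacts contribute no collars, and collars of boxes of `D`
inject into collars of bricks (`IsDecomposition.card_collars`).

It remains to bound contacts minus boxes by `g - 1`. The boxes form the vertices of a connected
graph with an edge for each touching pair. Fix a spanning tree. The boundaries of the contact
rectangles outside the tree are disjoint simple closed curves on the surface, and cutting along all
of them leaves it connected: the surface of a single box outside its contacts is connected, and one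
can pass between boxes through the contacts of the tree. So the number of contacts outside the tree
is at most the genus (`IsDecomposition.card_contacts_le`). -/

namespace OrthoPoly

/-! ### Octant patterns of unions of boxes -/

/-- The interval `[a, b]` contains the points on the side `s` of `x` that are close to `x`. -/
def cOct (a b x : ℝ) (s : Bool) : Prop := (s = true → a ≤ x ∧ x < b) ∧ (s = false → a < x ∧ x ≤ b)

/-- The box `c` fills the octant `σ` at `p`. -/
def boxOct (c : Point × Point) (p : Point) (σ : Fin 3 → Bool) : Prop :=
  ∀ i, cOct (c.1 i) (c.2 i) (p i) (σ i)

/-- Some box of `B` fills the octant `σ` at `p`. -/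
def oct (B : Finset (Point × Point)) (p : Point) (σ : Fin 3 → Bool) : Prop :=
  ∃ c ∈ B, boxOct c p σ

/-- The union of the boxes of `B`. -/
def boxUnion (B : Finset (Point × Point)) : Set Point := ⋃ c ∈ B, Icc c.1 c.2

/-- The octant at `p` that contains the octant `σ` at a point `q` close to `p`. -/
noncomputable def toward (p q : Point) (σ : Fin 3 → Bool) : Fin 3 → Bool := fun i =>
  if p i < q i then true else if q i < p i then false else σ i

theorem mem_boxUnion {B : Finset (Point × Point)} {q : Point} :
    q ∈ boxUnion B ↔ ∃ c ∈ B, q ∈ Icc c.1 c.2 := by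
  simp only [boxUnion, mem_iUnion, exists_prop]

theorem isClosed_boxUnion (B : Finset (Point × Point)) : IsClosed (boxUnion B) :=
  B.finite_toSet.isClosed_biUnion fun _ _ => isClosed_Icc

theorem exists_cOct {a b x : ℝ} (hab : a < b) (h : a ≤ x ∧ x ≤ b) : ∃ s, cOct a b x s := by
  rcases h.2.lt_or_eq with h2 | h2
  · exact ⟨true, by simp [cOct, h, h2]⟩
  · exact ⟨false, by simp [cOct, h2, hab]⟩

theorem cOct.mem {a b x : ℝ} {s : Bool} (h : cOct a b x s) : a ≤ x ∧ x ≤ b := by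
  cases s
  · exact ⟨(h.2 rfl).1.le, (h.2 rfl).2⟩
  · exact ⟨(h.1 rfl).1, (h.1 rfl).2.le⟩

theorem boxOct.mem {c : Point × Point} {p : Point} {σ : Fin 3 → Bool} (h : boxOct c p σ) :
    p ∈ Icc c.1 c.2 :=
  ⟨fun i => (h i).mem.1, fun i => (h i).mem.2⟩

theorem exists_boxOct {c : Point × Point} (hc : ∀ i, c.1 i < c.2 i) {p : Point}
    (hp : p ∈ Icc c.1 c.2) : ∃ σ, boxOct c p σ := by
  choose σ hσ using fun i => exists_cOct (hc i) ⟨hp.1 i, hp.2 i⟩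
  exact ⟨σ, hσ⟩

theorem mem_boxUnion_iff_exists_oct {B : Finset (Point × Point)}
    (hB : ∀ c ∈ B, ∀ i, c.1 i < c.2 i) {q : Point} : q ∈ boxUnion B ↔ ∃ σ, oct B q σ := by
  rw [mem_boxUnion]
  constructor
  · rintro ⟨c, hc, hq⟩
    obtain ⟨σ, hσ⟩ := exists_boxOct (hB c hc) hq
    exact ⟨σ, c, hc, hσ⟩
  · rintro ⟨σ, c, hc, hσ⟩
    exact ⟨c, hc, hσ.mem⟩

theorem oct.mem {B : Finset (Point × Point)} {p : Point} {σ : Fin 3 → Bool} (h : oct B p σ) :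
    p ∈ boxUnion B := by
  obtain ⟨c, hc, h⟩ := h
  exact mem_boxUnion.2 ⟨c, hc, h.mem⟩

theorem eventually_order_nhds (a x : ℝ) :
    ∀ᶠ y in 𝓝 x, (a < x → a < y) ∧ (x < a → y < a) := by
  refine Filter.Eventually.and ?_ ?_
  · by_cases h : a < x
    · filter_upwards [lt_mem_nhds h] with y hy _ using hy
    · simp [h]
  · by_cases h : x < a
    · filter_upwards [gt_mem_nhds h] with y hy _ using hy
    · simp [h]

theorem eventually_cOct (a b x : ℝ) :
    ∀ᶠ y in 𝓝 x, ∀ s,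
      cOct a b y s ↔ cOct a b x (if x < y then true else if y < x then false else s) := by
  filter_upwards [eventually_order_nhds a x, eventually_order_nhds b x] with y ha hb s
  rcases lt_trichotomy x y with h | h | h
  · simp only [h, if_true]
    rcases lt_trichotomy a x with h1 | h1 | h1 <;> rcases lt_trichotomy b x with h2 | h2 | h2 <;>
      cases s <;> simp only [cOct] <;> grind
  · subst h; simp
  · simp only [h, if_true, h.not_gt, if_false]
    rcases lt_trichotomy a x with h1 | h1 | h1 <;> rcases lt_trichotomy b x with h2 | h2 | h2 <;>
      cases s <;> simp only [cOct] <;> grind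

/-- There are only finitely many faces, so close to `p` a coordinate that has moved sees exactly the
side of `p` into which it moved, whereas an unmoved coordinate keeps both of its sides. All local
geometry below (interior, frontier, edges) is derived from this rule. -/
theorem eventually_oct (B : Finset (Point × Point)) (p : Point) :
    ∀ᶠ q in 𝓝 p, ∀ σ, oct B q σ ↔ oct B p (toward p q σ) := by
  have h : ∀ᶠ q in 𝓝 p, ∀ c ∈ B, ∀ i, ∀ s, cOct (c.1 i) (c.2 i) (q i) s ↔
      cOct (c.1 i) (c.2 i) (p i) (if p i < q i then true else if q i < p i then false else s) := by
    rw [Filter.eventually_all_finset]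
    intro c _
    rw [Filter.eventually_all]
    intro i
    exact (continuous_apply i).continuousAt.eventually (eventually_cOct (c.1 i) (c.2 i) (p i))
  filter_upwards [h] with q hq σ
  constructor
  · rintro ⟨c, hc, h⟩
    exact ⟨c, hc, fun i => (hq c hc i _).1 (h i)⟩
  · rintro ⟨c, hc, h⟩
    exact ⟨c, hc, fun i => (hq c hc i _).2 (h i)⟩

theorem eventually_along {p : Point} {Q : Point → Prop} (h : ∀ᶠ q in 𝓝 p, Q q) (d : Point) :
    ∀ᶠ t in 𝓝[>] (0 : ℝ), Q (p + t • d) := by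
  have hc : Continuous fun t : ℝ => p + t • d := by fun_prop
  have := hc.tendsto 0
  simp only [zero_smul, add_zero] at this
  exact (this.mono_left nhdsWithin_le_nhds).eventually h

/-- The direction of the diagonal of an octant. -/
def dir (σ : Fin 3 → Bool) : Point := fun i => if σ i then 1 else -1

theorem toward_dir (p : Point) (σ τ : Fin 3 → Bool) {t : ℝ} (ht : 0 < t) :
    toward p (p + t • dir σ) τ = σ := by
  funext i
  simp only [toward, dir, Pi.add_apply, Pi.smul_apply, smul_eq_mul]
  by_cases h : σ i = true
  · simp [h, ht]
  · simp [h, ht, ht.le]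

/-- The pattern of octants at `p` is determined by the set near `p`. -/
theorem oct_of_frequently {B : Finset (Point × Point)} (hB : ∀ c ∈ B, ∀ i, c.1 i < c.2 i)
    {p : Point} {σ : Fin 3 → Bool}
    (h : ∃ᶠ t in 𝓝[>] (0 : ℝ), p + t • dir σ ∈ boxUnion B) : oct B p σ := by
  obtain ⟨t, h1, h2, h3⟩ := (h.and_eventually
    ((eventually_along (eventually_oct B p) (dir σ)).and self_mem_nhdsWithin)).exists
  obtain ⟨τ, hτ⟩ := (mem_boxUnion_iff_exists_oct hB).1 h1
  rwa [h2, toward_dir p σ τ h3] at hτ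

theorem oct.eventually {B : Finset (Point × Point)}
    {p : Point} {σ : Fin 3 → Bool} (h : oct B p σ) :
    ∀ᶠ t in 𝓝[>] (0 : ℝ), p + t • dir σ ∈ boxUnion B := by
  filter_upwards [eventually_along (eventually_oct B p) (dir σ), self_mem_nhdsWithin] with t h2 h3
  exact oct.mem (σ := σ) ((h2 σ).2 (by rwa [toward_dir p σ σ h3]))

theorem mem_interior_boxUnion {B : Finset (Point × Point)} (hB : ∀ c ∈ B, ∀ i, c.1 i < c.2 i)
    {p : Point} : p ∈ interior (boxUnion B) ↔ ∀ σ, oct B p σ := by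
  constructor
  · intro h σ
    exact oct_of_frequently hB
      (eventually_along (mem_interior_iff_mem_nhds.1 h) (dir σ)).frequently
  · intro h
    rw [mem_interior_iff_mem_nhds]
    filter_upwards [eventually_oct B p] with q hq
    exact oct.mem (σ := fun _ => true) ((hq _).2 (h _))

theorem mem_frontier_boxUnion {B : Finset (Point × Point)} (hB : ∀ c ∈ B, ∀ i, c.1 i < c.2 i)
    {p : Point} : p ∈ frontier (boxUnion B) ↔ (∃ σ, oct B p σ) ∧ ∃ σ, ¬ oct B p σ := by
  rw [(isClosed_boxUnion B).frontier_eq, mem_sdiff, mem_interior_boxUnion hB,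
    mem_boxUnion_iff_exists_oct hB, not_forall]

/-- The pattern of octants depends on the union only and not on its presentation, so any box inside
the union may be used to fill octants, whether or not it belongs to `B`. -/
theorem oct_of_subset {B : Finset (Point × Point)} (hB : ∀ c ∈ B, ∀ i, c.1 i < c.2 i)
    {c : Point × Point} (h : Icc c.1 c.2 ⊆ boxUnion B)
    {p : Point} {σ : Fin 3 → Bool} (hσ : boxOct c p σ) : oct B p σ := by
  apply oct_of_frequently hB
  have h1 : oct {c} p σ := ⟨c, by simp, hσ⟩
  refine (h1.eventually.mono fun t ht => h ?_).frequently
  simpa [boxUnion] using ht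

/-! ### Triples of coordinates -/

/-- The triple with prescribed entries at `i`, at `j`, and at the remaining place. -/
def tri {α : Type*} (i j : Fin 3) (x y z : α) : Fin 3 → α := fun l =>
  if l = i then x else if l = j then y else z

section tri
variable {α : Type*} {i j l : Fin 3} {x y z : α}

@[simp] theorem tri_fst : tri i j x y z i = x := by simp [tri]
theorem tri_snd (h : j ≠ i) : tri i j x y z j = y := by simp [tri, h]
theorem tri_trd (h : l ≠ i) (h' : l ≠ j) : tri i j x y z l = z := by simp [tri, h, h']

end tri

theorem fin3_cases {i j k : Fin 3} (hij : i ≠ j) (hik : i ≠ k) (hjk : j ≠ k) (l : Fin 3) :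
    l = i ∨ l = j ∨ l = k := by
  revert i j k l; decide

theorem fin3_forall {i j k : Fin 3} (hij : i ≠ j) (hik : i ≠ k) (hjk : j ≠ k)
    {Q : Fin 3 → Prop} : (∀ l, Q l) ↔ Q i ∧ Q j ∧ Q k := by
  constructor
  · exact fun h => ⟨h i, h j, h k⟩
  · rintro ⟨h1, h2, h3⟩ l
    rcases fin3_cases hij hik hjk l with rfl | rfl | rfl <;> assumption

theorem fin3_ext {α : Type*} {i j k : Fin 3} (hij : i ≠ j) (hik : i ≠ k) (hjk : j ≠ k)
    {f g : Fin 3 → α} (h1 : f i = g i) (h2 : f j = g j) (h3 : f k = g k) : f = g :=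
  funext ((fin3_forall hij hik hjk).2 ⟨h1, h2, h3⟩)

theorem fin3_sum {M : Type*} [AddCommMonoid M] {i j k : Fin 3} (hij : i ≠ j) (hik : i ≠ k)
    (hjk : j ≠ k) (f : Fin 3 → M) : ∑ l, f l = f i + f j + f k := by
  have : (Finset.univ : Finset (Fin 3)) = {i, j, k} := by revert i j k; decide
  rw [this, Finset.sum_insert (by simp [hij, hik]), Finset.sum_insert (by simp [hjk]),
    Finset.sum_singleton, add_assoc]

theorem tri_eta {α : Type*} {i j k : Fin 3} (hij : i ≠ j) (hik : i ≠ k) (hjk : j ≠ k)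
    (f : Fin 3 → α) : tri i j (f i) (f j) (f k) = f :=
  fin3_ext hij hik hjk tri_fst (tri_snd hij.symm) (tri_trd hik.symm hjk.symm)

theorem exists_others (k : Fin 3) : ∃ i j : Fin 3, i ≠ j ∧ i ≠ k ∧ j ≠ k := by
  revert k; decide

/-! ### Local connectedness of the interior of a manifold -/

/-- The interior of a manifold with boundary is not locally separated by a hyperplane. -/
theorem IsManifoldWithBoundary.exists_interior_eq {P : Set Point} (hP : IsManifoldWithBoundary P)
    {p : Point} (hp : p ∈ P) (i : Fin 3) {U : Set Point} (hU : U ∈ 𝓝 p)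
    (h1 : ∃ᶠ q in 𝓝 p, q ∈ interior P ∧ q i < p i)
    (h2 : ∃ᶠ q in 𝓝 p, q ∈ interior P ∧ p i < q i) : ∃ q ∈ U, q ∈ interior P ∧ q i = p i := by
  obtain ⟨e, hpe, he⟩ := hP p hp
  have hV : e.target ∩ e.symm ⁻¹' U ∈ 𝓝 (e p) := by
    refine Filter.inter_mem (e.open_target.mem_nhds (e.map_source hpe)) ?_
    apply (e.continuousAt_symm (e.map_source hpe)).preimage_mem_nhds
    rwa [e.left_inv hpe]
  obtain ⟨r, hr, hball⟩ := Metric.mem_nhds_iff.1 hV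
  -- An open half-ball is convex, so its image under the inverse chart is a connected open subset of
  -- the interior of `P`; it cannot lie on the two sides of the hyperplane without meeting it.
  set W : Set Point := Metric.ball (e p) r ∩ {y | 0 < y 0} with hW
  have hWopen : IsOpen W := Metric.isOpen_ball.inter (isOpen_lt continuous_const (continuous_apply 0))
  have hWconv : Convex ℝ W := by
    refine (convex_ball _ _).inter ?_
    exact (convex_Ioi (0 : ℝ)).linear_preimage (LinearMap.proj (R := ℝ) (φ := fun _ : Fin 3 => ℝ) 0)
  have hWt : W ⊆ e.target := fun y hy => (hball hy.1).1
  have hWU : e.symm '' W ⊆ U := by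
    rintro _ ⟨y, hy, rfl⟩
    exact (hball hy.1).2
  have hWpre : IsPreconnected (e.symm '' W) :=
    hWconv.isPreconnected.image _ (e.continuousOn_symm.mono hWt)
  have hWint : e.symm '' W ⊆ interior P := by
    apply interior_maximal
    · rintro _ ⟨y, hy, rfl⟩
      rw [he _ (e.map_target (hWt hy)), e.right_inv (hWt hy)]
      exact le_of_lt hy.2
    · exact e.symm.isOpen_image_of_subset_source hWopen hWt
  have hnear : ∀ A : Set Point, IsOpen A → (∃ᶠ q in 𝓝 p, q ∈ interior P ∧ q ∈ A) →
      ((e.symm '' W) ∩ A).Nonempty := by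
    intro A hA hfr
    have hB : e.source ∩ e ⁻¹' Metric.ball (e p) r ∈ 𝓝 p :=
      Filter.inter_mem (e.open_source.mem_nhds hpe)
        ((e.continuousAt hpe).preimage_mem_nhds (Metric.ball_mem_nhds _ hr))
    obtain ⟨q, ⟨hqP, hqA⟩, hqs, hqb⟩ := (hfr.and_eventually hB).exists
    -- the image of a neighbourhood of `q` reaches into the open half-space
    have hN : interior P ∩ A ∩ (e.source ∩ e ⁻¹' Metric.ball (e p) r) ∈ 𝓝 q := by
      refine Filter.inter_mem ((isOpen_interior.inter hA).mem_nhds ⟨hqP, hqA⟩) ?_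
      exact Filter.inter_mem (e.open_source.mem_nhds hqs)
        ((e.continuousAt hqs).preimage_mem_nhds (Metric.isOpen_ball.mem_nhds hqb))
    have hN' : e.target ∩ e.symm ⁻¹' (interior P ∩ A ∩ (e.source ∩ e ⁻¹' Metric.ball (e p) r)) ∈
        𝓝 (e q) := by
      refine Filter.inter_mem (e.open_target.mem_nhds (e.map_source hqs)) ?_
      apply (e.continuousAt_symm (e.map_source hqs)).preimage_mem_nhds
      rwa [e.left_inv hqs]
    have hev := eventually_along hN' (fun _ => (1 : ℝ))
    obtain ⟨t, ⟨ht1, ⟨⟨ht2, ht3⟩, ht4⟩⟩, ht0⟩ := (hev.and self_mem_nhdsWithin).exists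
    refine ⟨_, ⟨_, ⟨?_, ?_⟩, rfl⟩, ht3⟩
    · have := ht4.2
      rwa [mem_preimage, e.right_inv ht1] at this
    · have h0 : 0 ≤ e q 0 := (he q hqs).1 (interior_subset hqP)
      have ht0 : 0 < t := ht0
      simp only [mem_ofPred_eq, Pi.add_apply, Pi.smul_apply, smul_eq_mul]
      linarith
  have hA1 : IsOpen {q : Point | q i < p i} := isOpen_lt (continuous_apply i) continuous_const
  have hA2 : IsOpen {q : Point | p i < q i} := isOpen_lt continuous_const (continuous_apply i)
  have n1 := hnear _ hA1 h1
  have n2 := hnear _ hA2 h2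
  by_contra hcon
  push Not at hcon
  obtain ⟨q, -, hq1, hq2⟩ := hWpre _ _ hA1 hA2 (fun q hq =>
    lt_or_gt_of_ne (hcon q (hWU hq) (hWint hq))) n1 n2
  rw [mem_ofPred] at hq1 hq2
  exact lt_asymm hq1 hq2

/-- The octant on the other side of the `i`-th coordinate plane. -/
def flip (i : Fin 3) (σ : Fin 3 → Bool) : Fin 3 → Bool := Function.update σ i (!σ i)

theorem oct.frequently_interior {B : Finset (Point × Point)} (hB : ∀ c ∈ B, ∀ i, c.1 i < c.2 i)
    {p : Point} {σ : Fin 3 → Bool} (h : oct B p σ) :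
    ∃ᶠ q in 𝓝 p, q ∈ interior (boxUnion B) ∧
      ∀ i, (σ i = true → p i < q i) ∧ (σ i = false → q i < p i) := by
  have hc : Filter.Tendsto (fun t : ℝ => p + t • dir σ) (𝓝[>] 0) (𝓝 p) := by
    have hc : Continuous fun t : ℝ => p + t • dir σ := by fun_prop
    have := hc.tendsto 0
    simp only [zero_smul, add_zero] at this
    exact this.mono_left nhdsWithin_le_nhds
  apply hc.frequently
  apply Filter.Eventually.frequently
  filter_upwards [eventually_along (eventually_oct B p) (dir σ), self_mem_nhdsWithin] with t h2 h3
  refine ⟨(mem_interior_boxUnion hB).2 fun τ => (h2 τ).2 (by rwa [toward_dir p σ τ h3]), ?_⟩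
  have h3 : 0 < t := h3
  intro i
  constructor <;> intro hi <;> simp [dir, hi, h3]

/-- In a manifold with boundary, the octants on the two sides of a coordinate plane communicate. -/
theorem exists_oct_flip {B : Finset (Point × Point)} (hB : ∀ c ∈ B, ∀ i, c.1 i < c.2 i)
    (hP : IsManifoldWithBoundary (boxUnion B)) {p : Point} {i : Fin 3} {σ τ : Fin 3 → Bool}
    (hσ : oct B p σ) (hτ : oct B p τ) (hi : σ i ≠ τ i) :
    ∃ ρ, oct B p ρ ∧ oct B p (flip i ρ) := by
  wlog h : σ i = true generalizing σ τ
  · exact this hτ hσ hi.symm (by cases h1 : σ i <;> cases h2 : τ i <;> simp_all)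
  have h' : τ i = false := by cases h1 : τ i <;> simp_all
  obtain ⟨q, hq, hqi, hqp⟩ := hP.exists_interior_eq hσ.mem i (eventually_oct B p)
    ((hτ.frequently_interior hB).mono fun q hq => ⟨hq.1, (hq.2 i).2 h'⟩)
    ((hσ.frequently_interior hB).mono fun q hq => ⟨hq.1, (hq.2 i).1 h⟩)
  rw [mem_interior_boxUnion hB] at hqi
  -- All octants at the interior point `q` are filled. As `q` lies in the plane through `p`, the two
  -- octants at `q` that differ only in the side along `i` come from two octants at `p` that differ
  -- in the same way.
  refine ⟨toward p q fun _ => true, (hq _).1 (hqi _), ?_⟩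
  convert (hq (Function.update (fun _ => true) i false)).1 (hqi _) using 1
  funext l
  by_cases hl : l = i
  · subst hl; simp [flip, toward, hqp]
  · simp [flip, toward, hl]

/-! ### Edge points in terms of octants -/

theorem oct_iff_eventually {B : Finset (Point × Point)} (hB : ∀ c ∈ B, ∀ i, c.1 i < c.2 i)
    {p : Point} {σ : Fin 3 → Bool} :
    oct B p σ ↔ ∀ᶠ t in 𝓝[>] (0 : ℝ), p + t • dir σ ∈ boxUnion B :=
  ⟨fun h => h.eventually, fun h => oct_of_frequently hB h.frequently⟩

theorem sign_dir_iff {s x t : ℝ} (hs : s ≠ 0) (ht : 0 < t) (b : Bool) :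
    0 ≤ s * (x + t * (if b = true then 1 else -1) - x) ↔ b = decide (0 < s) := by
  rcases hs.lt_or_gt with h | h
  · have := mul_neg_of_neg_of_pos h ht
    cases b <;> simp [h.not_gt, this, this.le]
  · have := mul_pos h ht
    cases b <;> simp [h, this, this.le]

theorem sign_toward_iff {p q : Point} {s : Fin 3 → Bool} (j : Fin 3) :
    0 ≤ dir s j * (q j - p j) ↔ toward p q s j = s j := by
  rcases lt_trichotomy (p j) (q j) with h | h | h
  · cases hs : s j <;> simp [toward, dir, h, hs, h.le]
  · simp [toward, h]
  · cases hs : s j <;> simp [toward, dir, h, hs, h.not_gt, h.le]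

theorem toward_eq_of_eq {p q : Point} {s σ : Fin 3 → Bool} {j : Fin 3}
    (h : toward p q σ j = s j) : toward p q s j = s j := by
  simp only [toward] at h ⊢
  split_ifs at h ⊢ <;> simp_all

/-- Only the signs of the coefficients matter, and testing the wedge along the diagonals of the
octants recovers the pattern. This turns the topological definition into a condition on a subset of
the eight octants. -/
theorem isConvexEdgePoint_iff {B : Finset (Point × Point)} (hB : ∀ c ∈ B, ∀ i, c.1 i < c.2 i)
    {p : Point} {i : Fin 3} : IsConvexEdgePoint (boxUnion B) i p ↔
      ∃ s : Fin 3 → Bool, ∀ σ, oct B p σ ↔ ∀ j, j ≠ i → σ j = s j := by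
  constructor
  · rintro ⟨s, hs, h⟩
    refine ⟨fun j => decide (0 < s j), fun σ => ?_⟩
    rw [oct_iff_eventually hB]
    have h1 := (eventually_along h (dir σ)).and (self_mem_nhdsWithin (s := Ioi (0 : ℝ)))
    rw [Filter.eventually_congr (q := fun _ => ∀ j, j ≠ i → σ j = decide (0 < s j)),
      Filter.eventually_const]
    filter_upwards [h1] with t ht
    rw [ht.1]
    exact forall₂_congr fun j _ => sign_dir_iff (hs j) ht.2 _
  · rintro ⟨s, h⟩
    refine ⟨dir s, fun j => by simp only [dir]; split_ifs <;> norm_num, ?_⟩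
    filter_upwards [eventually_oct B p] with q hq
    rw [mem_boxUnion_iff_exists_oct hB]
    simp only [hq, h, sign_toward_iff]
    exact ⟨fun ⟨σ, hσ⟩ j hj => toward_eq_of_eq (hσ j hj), fun h => ⟨s, h⟩⟩

theorem isReflexEdgePoint_iff {B : Finset (Point × Point)} (hB : ∀ c ∈ B, ∀ i, c.1 i < c.2 i)
    {p : Point} {i : Fin 3} : IsReflexEdgePoint (boxUnion B) i p ↔
      ∃ s : Fin 3 → Bool, ∀ σ, oct B p σ ↔ ∃ j, j ≠ i ∧ σ j = s j := by
  constructor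
  · rintro ⟨s, hs, h⟩
    refine ⟨fun j => decide (0 < s j), fun σ => ?_⟩
    rw [oct_iff_eventually hB]
    have h1 := (eventually_along h (dir σ)).and (self_mem_nhdsWithin (s := Ioi (0 : ℝ)))
    rw [Filter.eventually_congr (q := fun _ => ∃ j, j ≠ i ∧ σ j = decide (0 < s j)),
      Filter.eventually_const]
    filter_upwards [h1] with t ht
    rw [ht.1]
    exact exists_congr fun j => and_congr_right fun _ => sign_dir_iff (hs j) ht.2 _
  · rintro ⟨s, h⟩
    refine ⟨dir s, fun j => by simp only [dir]; split_ifs <;> norm_num, ?_⟩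
    filter_upwards [eventually_oct B p] with q hq
    rw [mem_boxUnion_iff_exists_oct hB]
    simp only [hq, h, sign_toward_iff]
    exact ⟨fun ⟨σ, j, hj, hσ⟩ => ⟨j, hj, toward_eq_of_eq hσ⟩, fun h => ⟨s, h⟩⟩

/-! ### The grid of a union of boxes -/

/-- The `i`-th coordinates of the corners of the boxes of `B`. -/
noncomputable def grid (B : Finset (Point × Point)) (i : Fin 3) : Finset ℝ :=
  B.image (fun c => c.1 i) ∪ B.image (fun c => c.2 i)

theorem fst_mem_grid {B : Finset (Point × Point)} {c : Point × Point} (hc : c ∈ B) (i : Fin 3) :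
    c.1 i ∈ grid B i :=
  Finset.mem_union_left _ (Finset.mem_image_of_mem (fun c => c.1 i) hc)

theorem snd_mem_grid {B : Finset (Point × Point)} {c : Point × Point} (hc : c ∈ B) (i : Fin 3) :
    c.2 i ∈ grid B i :=
  Finset.mem_union_right _ (Finset.mem_image_of_mem (fun c => c.2 i) hc)

theorem mem_boxUnion_of_same_cell {B : Finset (Point × Point)} {p q : Point}
    (h : ∀ i, ∀ g ∈ grid B i, (g ≤ p i → g ≤ q i) ∧ (p i ≤ g → q i ≤ g))
    (hp : p ∈ boxUnion B) : q ∈ boxUnion B := by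
  obtain ⟨c, hc, hp⟩ := mem_boxUnion.1 hp
  exact mem_boxUnion.2 ⟨c, hc, fun i => (h i _ (fst_mem_grid hc i)).1 (hp.1 i),
    fun i => (h i _ (snd_mem_grid hc i)).2 (hp.2 i)⟩

theorem cOct_congr_of_ne {a b x : ℝ} (ha : x ≠ a) (hb : x ≠ b) (s t : Bool) :
    cOct a b x s → cOct a b x t := by
  intro h
  have h1 := h.mem
  have h2 := lt_of_le_of_ne h1.1 ha.symm
  have h3 := lt_of_le_of_ne h1.2 hb
  exact ⟨fun _ => ⟨h1.1, h3⟩, fun _ => ⟨h2, h1.2⟩⟩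

/-- No box has a face at the height of `p`, so each box at `p` extends both upwards and downwards;
the pattern is in effect planar. -/
theorem oct.congr_of_notMem_grid {B : Finset (Point × Point)} {p : Point} {k : Fin 3}
    (hk : p k ∉ grid B k) {σ τ : Fin 3 → Bool} (h : oct B p σ) (hστ : ∀ l, l ≠ k → σ l = τ l) :
    oct B p τ := by
  obtain ⟨c, hc, h⟩ := h
  refine ⟨c, hc, fun l => ?_⟩
  by_cases hl : l = k
  · subst hl
    exact cOct_congr_of_ne (fun h => hk (by rw [h]; exact fst_mem_grid hc _))
      (fun h => hk (by rw [h]; exact snd_mem_grid hc _)) _ _ (h _)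
  · rw [← hστ l hl]; exact h l

/-- Away from the horizontal planes of the grid there is no reflex edge in direction `k`. -/
def NoReflex (B : Finset (Point × Point)) (k : Fin 3) : Prop :=
  ∀ p : Point, p k ∉ grid B k → ∀ i j, i ≠ j → i ≠ k → j ≠ k → ∀ σ,
    oct B p σ → oct B p (flip i σ) → oct B p (flip j σ) → oct B p (flip i (flip j σ))

@[simp] theorem flip_same (i : Fin 3) (σ : Fin 3 → Bool) : flip i σ i = !σ i := by simp [flip]
theorem flip_of_ne {i l : Fin 3} (h : l ≠ i) (σ : Fin 3 → Bool) : flip i σ l = σ l := by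
  simp [flip, h]

theorem continuous_tri (i j : Fin 3) (z : ℝ) :
    Continuous fun w : ℝ × ℝ => (tri i j w.1 w.2 z : Point) := by
  refine continuous_pi fun l => ?_
  simp only [tri]
  split_ifs <;> fun_prop

/-! ### Widening a box through one of its vertical sides -/

/-- If matter sticks out somewhere through the side of a box, it sticks out along the whole side:
where it stopped, two quadrants inside the box and one outside would be filled and the fourth would
not, giving a vertical reflex edge. Hence the box can be prolonged up to the next grid plane. -/
theorem extend_right {B : Finset (Point × Point)} (hB : ∀ c ∈ B, ∀ i, c.1 i < c.2 i)
    {i j k : Fin 3} (hij : i ≠ j) (hik : i ≠ k) (hjk : j ≠ k) (hR : NoReflex B k)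
    {a b : Point} (hab : ∀ l, a l < b l) (hsub : Icc a b ⊆ boxUnion B)
    (hk : ∀ g ∈ grid B k, ¬ (a k < g ∧ g < b k)) {q : Point}
    (hqk : a k < q k ∧ q k < b k) (hqi : q i = b i) {σ : Fin 3 → Bool} (hσ : oct B q σ)
    (hσi : σ i = true) (hσj : cOct (a j) (b j) (q j) (σ j)) :
    ∃ b' ∈ grid B i, b i < b' ∧ Icc a (Function.update b i b') ⊆ boxUnion B := by
  have hji := hij.symm
  have hki := hik.symm
  have hkj := hjk.symm
  have hex : ((grid B i).filter (b i < ·)).Nonempty := by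
    obtain ⟨c, hc, hcσ⟩ := hσ
    refine ⟨c.2 i, Finset.mem_filter.2 ⟨snd_mem_grid hc i, ?_⟩⟩
    rw [← hqi]; exact ((hcσ i).1 hσi).2
  obtain ⟨b', ⟨hb'g, hbb'⟩, hmin⟩ : ∃ b', (b' ∈ grid B i ∧ b i < b') ∧
      ∀ g ∈ grid B i, b i < g → b' ≤ g := by
    refine ⟨_, Finset.mem_filter.1 (Finset.min'_mem _ hex), fun g hg hg' => ?_⟩
    exact Finset.min'_le _ _ (Finset.mem_filter.2 ⟨hg, hg'⟩)
  refine ⟨b', hb'g, hbb', ?_⟩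
  -- As `b'` is the next grid value, no grid plane separates such points in the directions `i` and
  -- `k`, so membership depends on `y` alone.
  have hcell : ∀ x ∈ Ioo (b i) b', ∀ x' ∈ Ioo (b i) b', ∀ y, ∀ z ∈ Ioo (a k) (b k),
      ∀ z' ∈ Ioo (a k) (b k), (tri i j x y z : Point) ∈ boxUnion B →
      (tri i j x' y z' : Point) ∈ boxUnion B := by
    intro x hx x' hx' y z hz z' hz'
    apply mem_boxUnion_of_same_cell
    rw [fin3_forall hij hik hjk]
    simp only [tri_fst, tri_snd hji, tri_trd hki hkj]
    refine ⟨fun g hg => ⟨fun h => ?_, fun h => ?_⟩, by simp, fun g hg => ⟨fun h => ?_, fun h => ?_⟩⟩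
    · rcases lt_or_ge (b i) g with h1 | h1
      · linarith [hmin g hg h1, hx.2]
      · linarith [hx'.1]
    · rcases lt_or_ge (b i) g with h1 | h1
      · linarith [hmin g hg h1, hx'.2]
      · linarith [hx.1]
    · by_contra hcon
      exact hk g hg ⟨by linarith [hz'.1], by linarith [hz.2]⟩
    · by_contra hcon
      exact hk g hg ⟨by linarith [hz.1], by linarith [hz'.2]⟩
  have hz0 : q k ∈ Ioo (a k) (b k) := hqk
  have hqg : q k ∉ grid B k := fun h => hk _ h hz0
  have hx1 : (b i + b') / 2 ∈ Ioo (b i) b' := ⟨by linarith, by linarith⟩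
  -- a point just beyond the side, with the octants of its neighbours seen from the side
  have hloc : ∀ y, ∃ x ∈ Ioo (b i) b', ∀ᶠ y' in 𝓝 y, ∀ τ,
      oct B (tri i j x y' (q k)) τ ↔
        oct B (tri i j (b i) y (q k)) (toward (tri i j (b i) y (q k)) (tri i j x y' (q k)) τ) := by
    intro y
    have h1 := (continuous_tri i j (q k)).continuousAt (x := (b i, y)) |>.eventually
      (eventually_oct B (tri i j (b i) y (q k)))
    have h2 := h1.curry_nhds.filter_mono (nhdsWithin_le_nhds (s := Ioi (b i)))
    obtain ⟨x, hx, hx'⟩ := (h2.and (Ioo_mem_nhdsGT hbb')).exists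
    exact ⟨x, hx', hx⟩
  set D : Set ℝ := {y | (tri i j ((b i + b') / 2) y (q k) : Point) ∈ boxUnion B} with hD
  have hDc : IsClosed D := (isClosed_boxUnion B).preimage
    ((continuous_tri i j (q k)).comp (Continuous.prodMk_right _))
  -- At the point of the side with coordinate `y` all octants on the inner side are filled by the
  -- box and one on the outer side is filled because `y ∈ D`; `hR` then fills the remaining ones, so
  -- a neighbourhood of `y` lies in `D`.
  have hDo : ∀ y ∈ Ioo (a j) (b j), y ∈ D → D ∈ 𝓝 y := by
    intro y hy hyD
    obtain ⟨x, hx, hev⟩ := hloc y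
    obtain ⟨τ, hτ⟩ := (mem_boxUnion_iff_exists_oct hB).1 (hcell _ hx1 _ hx y _ hz0 _ hz0 hyD)
    rw [hev.self_of_nhds] at hτ
    set ρ := toward (tri i j (b i) y (q k)) (tri i j x y (q k)) τ with hρ
    have hρi : ρ i = true := by simp [hρ, toward, hx.1]
    have hgr : (tri i j (b i) y (q k) : Point) k ∉ grid B k := by rwa [tri_trd hki hkj]
    have hin : ∀ τ : Fin 3 → Bool, τ i = false → oct B (tri i j (b i) y (q k)) τ := by
      intro τ hτ
      apply oct_of_subset hB (c := (a, b)) hsub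
      unfold boxOct
      rw [fin3_forall hij hik hjk]
      simp only [tri_fst, tri_snd hji, tri_trd hki hkj, hτ]
      exact ⟨⟨by simp, fun _ => ⟨hab i, le_rfl⟩⟩, ⟨fun _ => ⟨hy.1.le, hy.2⟩, fun _ => ⟨hy.1, hy.2.le⟩⟩,
        ⟨fun _ => ⟨hqk.1.le, hqk.2⟩, fun _ => ⟨hqk.1, hqk.2.le⟩⟩⟩
    have hout : ∀ τ : Fin 3 → Bool, τ i = true → oct B (tri i j (b i) y (q k)) τ := by
      intro τ' hτ'
      by_cases hj : τ' j = ρ j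
      · refine hτ.congr_of_notMem_grid hgr fun l hl => ?_
        rcases fin3_cases hij hik hjk l with rfl | rfl | rfl
        · rw [hρi, hτ']
        · exact hj.symm
        · exact absurd rfl hl
      · have h1 := hR _ hgr i j hij hik hjk (flip i ρ) (hin _ (by simp [hρi]))
          (by convert hτ using 1; funext l; by_cases hl : l = i
              · subst hl; simp
              · simp [flip_of_ne hl])
          (hin _ (by simp [flip_of_ne hij, hρi]))
        refine h1.congr_of_notMem_grid hgr fun l hl => ?_
        rcases fin3_cases hij hik hjk l with rfl | rfl | rfl
        · simp [flip_of_ne hij, hρi, hτ']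
        · rw [flip_of_ne hji, flip_same, flip_of_ne hji]
          cases h3 : ρ l <;> cases h4 : τ' l <;> simp_all
        · exact absurd rfl hl
    filter_upwards [hev] with y' hy'
    refine hcell _ hx _ hx1 y' _ hz0 _ hz0 (oct.mem (σ := fun _ => true) ((hy' _).2 (hout _ ?_)))
    simp [toward, hx.1]
  -- Move from `q` slightly into the octant `σ`; the assumption on `σ j` keeps the `j`-th coordinate
  -- within the open side, even if `q` lies on a vertical edge of the box.
  have hDne : ∃ y ∈ Ioo (a j) (b j), y ∈ D := by
    obtain ⟨x, hx, hev⟩ := hloc (q j)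
    have hqe : (tri i j (b i) (q j) (q k) : Point) = q := by rw [← hqi, tri_eta hij hik hjk]
    rw [hqe] at hev
    have key : ∀ y', (σ j = true → q j < y') → (σ j = false → y' < q j) →
        toward q (tri i j x y' (q k)) σ = σ := by
      intro y' h1 h2
      apply fin3_ext hij hik hjk
      · simp [toward, hqi, hx.1, hσi]
      · simp only [toward, tri_snd hji]
        cases h : σ j
        · simp [h2 h, (h2 h).not_gt]
        · simp [h1 h]
      · simp [toward, tri_trd hki hkj]
    have fin : ∀ y', (σ j = true → q j < y') → (σ j = false → y' < q j) →
        (∀ τ, oct B (tri i j x y' (q k)) τ ↔ oct B q (toward q (tri i j x y' (q k)) τ)) →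
        y' ∈ D := by
      intro y' h1 h2 h3
      refine hcell _ hx _ hx1 y' _ hz0 _ hz0 (oct.mem (σ := σ) ?_)
      rwa [h3, key y' h1 h2]
    cases h : σ j
    · have h1 := (hσj.2 h).1
      have h2 := hev.filter_mono (nhdsWithin_le_nhds (s := Iio (q j)))
      obtain ⟨y, hy, hy'⟩ := (h2.and (Ioo_mem_nhdsLT h1)).exists
      exact ⟨y, ⟨hy'.1, hy'.2.trans_le (hσj.2 h).2⟩, fin y (by simp [h]) (fun _ => hy'.2) hy⟩
    · have h1 := (hσj.1 h).2
      have h2 := hev.filter_mono (nhdsWithin_le_nhds (s := Ioi (q j)))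
      obtain ⟨y, hy, hy'⟩ := (h2.and (Ioo_mem_nhdsGT h1)).exists
      exact ⟨y, ⟨(hσj.1 h).1.trans_lt hy'.1, hy'.2⟩, fin y (fun _ => hy'.1) (by simp [h]) hy⟩
  -- `D` is nonempty, open and closed relative to the interval, which is connected.
  have hall : Ioo (a j) (b j) ⊆ D := by
    refine (isPreconnected_Ioo.subset_of_closure_inter_subset (u := interior D) isOpen_interior ?_
      ?_).trans interior_subset
    · obtain ⟨y, hy, hyD⟩ := hDne
      exact ⟨y, hy, mem_interior_iff_mem_nhds.2 (hDo y hy hyD)⟩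
    · rintro y ⟨hy1, hy2⟩
      exact mem_interior_iff_mem_nhds.2
        (hDo y hy2 (hDc.closure_subset (closure_mono interior_subset hy1)))
  -- the new slice
  have hopen : (Set.univ.pi fun l => Ioo (tri i j (b i) (a j) (a k) l : ℝ)
      (tri i j b' (b j) (b k) l)) ⊆ boxUnion B := by
    intro w hw
    rw [Set.mem_univ_pi, fin3_forall hij hik hjk] at hw
    simp only [tri_fst, tri_snd hji, tri_trd hki hkj] at hw
    have := hcell _ hx1 _ hw.1 (w j) _ hz0 _ hw.2.2 (hall hw.2.1)
    rwa [tri_eta hij hik hjk] at this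
  have hclosed := closure_minimal hopen (isClosed_boxUnion B)
  rw [closure_pi_set] at hclosed
  intro w hw
  rcases le_total (w i) (b i) with h | h
  · refine hsub ⟨hw.1, fun l => ?_⟩
    by_cases hl : l = i
    · rwa [hl]
    · simpa [hl] using hw.2 l
  · apply hclosed
    rw [Set.mem_univ_pi, fin3_forall hij hik hjk]
    simp only [tri_fst, tri_snd hji, tri_trd hki hkj]
    rw [closure_Ioo hbb'.ne, closure_Ioo (hab j).ne, closure_Ioo (hab k).ne]
    refine ⟨⟨h, by simpa using hw.2 i⟩, ⟨hw.1 j, by simpa [hji] using hw.2 j⟩,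
      ⟨hw.1 k, by simpa [hki] using hw.2 k⟩⟩

/-- The boxes opposite to those of `B`. -/
noncomputable def negBoxes (B : Finset (Point × Point)) : Finset (Point × Point) :=
  B.image fun c => (-c.2, -c.1)

theorem boxOct_neg {c : Point × Point} {p : Point} {σ : Fin 3 → Bool} :
    boxOct (-c.2, -c.1) (-p) σ ↔ boxOct c p (fun i => !σ i) := by
  refine forall_congr' fun i => ?_
  simp only [cOct, Pi.neg_apply, neg_le_neg_iff, neg_lt_neg_iff]
  cases σ i <;> simp [and_comm]

theorem oct_negBoxes {B : Finset (Point × Point)} {p : Point} {σ : Fin 3 → Bool} :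
    oct (negBoxes B) (-p) σ ↔ oct B p (fun i => !σ i) := by
  simp only [oct, negBoxes, Finset.mem_image]
  constructor
  · rintro ⟨_, ⟨c, hc, rfl⟩, h⟩
    exact ⟨c, hc, boxOct_neg.1 h⟩
  · rintro ⟨c, hc, h⟩
    exact ⟨_, ⟨c, hc, rfl⟩, boxOct_neg.2 h⟩

theorem mem_negBoxes {B : Finset (Point × Point)} {p : Point} :
    p ∈ boxUnion (negBoxes B) ↔ -p ∈ boxUnion B := by
  simp only [mem_boxUnion, negBoxes, Finset.mem_image]
  constructor
  · rintro ⟨_, ⟨c, hc, rfl⟩, h⟩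
    exact ⟨c, hc, le_neg.1 h.2, neg_le.1 h.1⟩
  · rintro ⟨c, hc, h⟩
    exact ⟨_, ⟨c, hc, rfl⟩, neg_le.1 h.2, le_neg.1 h.1⟩

theorem mem_grid_negBoxes {B : Finset (Point × Point)} {i : Fin 3} {g : ℝ} :
    g ∈ grid (negBoxes B) i ↔ -g ∈ grid B i := by
  simp only [grid, negBoxes, Finset.mem_union, Finset.mem_image, exists_exists_and_eq_and,
    Pi.neg_apply]
  rw [or_comm]
  simp only [neg_eq_iff_eq_neg]

theorem flip_not (i : Fin 3) (σ : Fin 3 → Bool) :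
    (fun l => !flip i σ l) = flip i (fun l => !σ l) := by
  funext l
  by_cases h : l = i
  · subst h; simp
  · simp [flip_of_ne h]

theorem NoReflex.neg {B : Finset (Point × Point)} {k : Fin 3} (h : NoReflex B k) :
    NoReflex (negBoxes B) k := by
  intro p hp i j hij hik hjk σ
  rw [mem_grid_negBoxes] at hp
  rw [← neg_neg p]
  simp only [oct_negBoxes, flip_not]
  exact h (-p) hp i j hij hik hjk _

/-- The point reflection at the origin exchanges the two sides and reduces this to `extend_right`.
-/
theorem extend_left {B : Finset (Point × Point)} (hB : ∀ c ∈ B, ∀ i, c.1 i < c.2 i)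
    {i j k : Fin 3} (hij : i ≠ j) (hik : i ≠ k) (hjk : j ≠ k) (hR : NoReflex B k)
    {a b : Point} (hab : ∀ l, a l < b l) (hsub : Icc a b ⊆ boxUnion B)
    (hk : ∀ g ∈ grid B k, ¬ (a k < g ∧ g < b k)) {q : Point}
    (hqk : a k < q k ∧ q k < b k) (hqi : q i = a i) {σ : Fin 3 → Bool} (hσ : oct B q σ)
    (hσi : σ i = false) (hσj : cOct (a j) (b j) (q j) (σ j)) :
    ∃ a' ∈ grid B i, a' < a i ∧ Icc (Function.update a i a') b ⊆ boxUnion B := by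
  have hnB : ∀ c ∈ negBoxes B, ∀ i, c.1 i < c.2 i := by
    simp only [negBoxes, Finset.mem_image]
    rintro _ ⟨c, hc, rfl⟩ i
    simpa using hB c hc i
  obtain ⟨b', hb', hlt, hsub'⟩ := extend_right hnB hij hik hjk hR.neg (a := -b) (b := -a)
    (fun l => by simpa using hab l)
    (fun p hp => mem_negBoxes.2 (hsub ⟨le_neg.1 hp.2, neg_le.1 hp.1⟩))
    (fun g hg h => hk _ (mem_grid_negBoxes.1 hg)
      ⟨by simpa using lt_neg.1 h.2, by simpa using neg_lt.1 h.1⟩)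
    (q := -q) (by simpa using hqk.symm) (by simp [hqi]) (σ := fun l => !σ l)
    (oct_negBoxes.2 (by simpa using hσ)) (by simp [hσi])
    (by
      simp only [cOct, Pi.neg_apply, neg_le_neg_iff, neg_lt_neg_iff] at hσj ⊢
      cases h : σ j <;> simp [h] at hσj ⊢ <;> tauto)
  refine ⟨-b', mem_grid_negBoxes.1 hb', by simpa using neg_lt_neg hlt, fun p hp => ?_⟩
  have := hsub' (show -p ∈ Icc (-b) (Function.update (-a) i b') from
    ⟨neg_le_neg hp.2, fun l => ?_⟩)
  · simpa using mem_negBoxes.1 this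
  · have h := hp.1 l
    by_cases hl : l = i
    · subst hl; simp at h ⊢; linarith
    · simp [hl] at h ⊢; linarith

/-! ### Bricks between consecutive horizontal planes of the grid -/

/-- A box between two consecutive horizontal planes of the grid that is separated from the rest
of the union between these planes. -/
structure IsSlabBrick (B : Finset (Point × Point)) (k : Fin 3) (c : Point × Point) : Prop where
  nondeg : ∀ i, c.1 i < c.2 i
  fst_mem : ∀ i, c.1 i ∈ grid B i
  snd_mem : ∀ i, c.2 i ∈ grid B i
  subset : Icc c.1 c.2 ⊆ boxUnion B
  consecutive : ∀ g ∈ grid B k, ¬ (c.1 k < g ∧ g < c.2 k)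
  isolated : ∀ q ∈ Icc c.1 c.2, c.1 k < q k → q k < c.2 k → ∀ σ, oct B q σ → boxOct c q σ

/-- Away from the horizontal planes of the grid the octants of a union do not touch
just along a line. -/
def NoPinch (B : Finset (Point × Point)) (k : Fin 3) : Prop :=
  ∀ p : Point, p k ∉ grid B k → ∀ i j, i ≠ j → i ≠ k → j ≠ k → ∀ σ,
    oct B p σ → oct B p (flip i (flip j σ)) → oct B p (flip i σ) ∨ oct B p (flip j σ)

theorem exists_consecutive {G : Finset ℝ} {a b x : ℝ} (ha : a ∈ G) (hb : b ∈ G) (hab : a < b)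
    (hax : a ≤ x) (hxb : x ≤ b) : ∃ l ∈ G, ∃ h ∈ G, a ≤ l ∧ l < h ∧ h ≤ b ∧ l ≤ x ∧ x ≤ h ∧
      ∀ g ∈ G, ¬ (l < g ∧ g < h) := by
  -- `h` is the least value above `a` that is at least `x`, and `l` the greatest one below `h`
  have hH : (G.filter fun g => a < g ∧ x ≤ g).Nonempty := ⟨b, by simp [hb, hab, hxb]⟩
  obtain ⟨h, ⟨hG, hah, hxh⟩, hmin⟩ : ∃ h, (h ∈ G ∧ a < h ∧ x ≤ h) ∧
      ∀ g ∈ G, a < g → x ≤ g → h ≤ g :=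
    ⟨_, Finset.mem_filter.1 (Finset.min'_mem _ hH),
      fun g hg h1 h2 => Finset.min'_le _ _ (Finset.mem_filter.2 ⟨hg, h1, h2⟩)⟩
  have hL : (G.filter (· < h)).Nonempty := ⟨a, by simp [ha, hah]⟩
  obtain ⟨l, ⟨lG, hlh⟩, hmax⟩ : ∃ l, (l ∈ G ∧ l < h) ∧ ∀ g ∈ G, g < h → g ≤ l :=
    ⟨(G.filter (· < h)).max' hL, Finset.mem_filter.1 (Finset.max'_mem _ hL),
      fun g hg h1 => Finset.le_max' _ _ (Finset.mem_filter.2 ⟨hg, h1⟩)⟩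
  have hal := hmax a ha hah
  refine ⟨l, lG, h, hG, hal, hlh, hmin b hb hab hxb, ?_, hxh, fun g hg hgg => ?_⟩
  · by_contra hcon
    push Not at hcon
    rcases hal.eq_or_lt with h1 | h1
    · linarith
    · linarith [hmin l lG h1 hcon.le]
  · linarith [hmax g hg hgg.2]

theorem cOct_not {c : Point × Point} (hc : ∀ i, c.1 i < c.2 i) {q : Point}
    (hq : q ∈ Icc c.1 c.2) {σ : Fin 3 → Bool} {i : Fin 3}
    (hi : ¬ cOct (c.1 i) (c.2 i) (q i) (σ i)) : cOct (c.1 i) (c.2 i) (q i) (!σ i) := by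
  obtain ⟨s, hs⟩ := exists_cOct (hc i) ⟨hq.1 i, hq.2 i⟩
  have : s = !σ i := by
    cases s <;> cases h : σ i <;> simp_all
  rwa [← this]

/-- Take a largest grid box through `p` that fills the height between two consecutive grid planes
and stays in the union. Anything leaving it through a side would allow widening it, and `NoPinch`
reduces anything attached only diagonally along a vertical edge to that case. -/
theorem exists_isSlabBrick {B : Finset (Point × Point)} (hB : ∀ c ∈ B, ∀ i, c.1 i < c.2 i)
    {k : Fin 3} (hR : NoReflex B k) (hN : NoPinch B k) {p : Point} (hp : p ∈ boxUnion B) :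
    ∃ c, IsSlabBrick B k c ∧ p ∈ Icc c.1 c.2 := by
  classical
  obtain ⟨c, hc, hpc⟩ := mem_boxUnion.1 hp
  obtain ⟨l, hlG, h, hhG, hal, hlh, hhb, hlp, hph, hcons⟩ := exists_consecutive
    (fst_mem_grid hc k) (snd_mem_grid hc k) (hB c hc k) (hpc.1 k) (hpc.2 k)
  set V : Finset Point := Fintype.piFinset (grid B) with hV
  set Q : Finset (Point × Point) := (V ×ˢ V).filter fun d => (∀ i, d.1 i < d.2 i) ∧
    Icc d.1 d.2 ⊆ boxUnion B ∧ d.1 k = l ∧ d.2 k = h ∧ p ∈ Icc d.1 d.2 with hQ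
  have hQne : Q.Nonempty := by
    refine ⟨(Function.update c.1 k l, Function.update c.2 k h), ?_⟩
    rw [hQ, Finset.mem_filter, Finset.mem_product, hV, Fintype.mem_piFinset, Fintype.mem_piFinset]
    refine ⟨⟨fun i => ?_, fun i => ?_⟩, fun i => ?_, fun q hq => ?_, by simp, by simp, ?_⟩
    · by_cases hi : i = k
      · subst hi; simpa using hlG
      · simpa [hi] using fst_mem_grid hc i
    · by_cases hi : i = k
      · subst hi; simpa using hhG
      · simpa [hi] using snd_mem_grid hc i
    · by_cases hi : i = k
      · subst hi; simpa using hlh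
      · simpa [hi] using hB c hc i
    · refine mem_boxUnion.2 ⟨c, hc, fun i => ?_, fun i => ?_⟩
      · have := hq.1 i
        by_cases hi : i = k
        · subst hi; simp at this; linarith
        · simpa [hi] using this
      · have := hq.2 i
        by_cases hi : i = k
        · subst hi; simp at this; linarith
        · simpa [hi] using this
    · constructor <;> intro i <;> by_cases hi : i = k
      · subst hi; simpa using hlp
      · simpa [hi] using hpc.1 i
      · subst hi; simpa using hph
      · simpa [hi] using hpc.2 i
  -- The sum of the three side lengths strictly increases with every one-sided extension.
  obtain ⟨d, hdQ, hdmax⟩ := Finset.exists_max_image Q (fun d => ∑ i, (d.2 i - d.1 i)) hQne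
  have hdQ' := hdQ
  rw [hQ, Finset.mem_filter, Finset.mem_product, hV, Fintype.mem_piFinset,
    Fintype.mem_piFinset] at hdQ'
  obtain ⟨⟨hd1, hd2⟩, hdn, hds, hdl, hdh, hpd⟩ := hdQ'
  have hcons' : ∀ g ∈ grid B k, ¬ (d.1 k < g ∧ g < d.2 k) := by rwa [hdl, hdh]
  -- by maximality, no octant sticks out of the box through a side
  have hside : ∀ i, i ≠ k → ∀ j, j ≠ k → i ≠ j → ∀ q ∈ Icc d.1 d.2, d.1 k < q k → q k < d.2 k →
      ∀ σ, oct B q σ → cOct (d.1 j) (d.2 j) (q j) (σ j) → cOct (d.1 i) (d.2 i) (q i) (σ i) := by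
    intro i hik j hjk hij q hq hqk1 hqk2 σ hσ hσj
    have hki := hik.symm
    by_contra hcon
    cases hs : σ i
    · have hqi : q i = d.1 i := by
        by_contra hne
        exact hcon (by rw [hs]; exact ⟨by simp, fun _ => ⟨lt_of_le_of_ne (hq.1 i) (Ne.symm hne), hq.2 i⟩⟩)
      obtain ⟨a', ha', hlt, hsub'⟩ := extend_left hB hij hik hjk hR hdn hds hcons' ⟨hqk1, hqk2⟩
        hqi hσ hs hσj
      have hmem : (Function.update d.1 i a', d.2) ∈ Q := by
        rw [hQ, Finset.mem_filter, Finset.mem_product, hV, Fintype.mem_piFinset,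
          Fintype.mem_piFinset]
        refine ⟨⟨fun m => ?_, hd2⟩, fun m => ?_, hsub', by simp [hki, hdl], hdh,
          fun m => ?_, hpd.2⟩ <;> by_cases hm : m = i
        · subst hm; simpa using ha'
        · simpa [hm] using hd1 m
        · subst hm; simpa using hlt.trans (hdn m)
        · simpa [hm] using hdn m
        · subst hm; simpa using hlt.le.trans (hpd.1 m)
        · simpa [hm] using hpd.1 m
      have := hdmax _ hmem
      refine absurd this (not_le.2 (Finset.sum_lt_sum (fun m _ => ?_) ⟨i, Finset.mem_univ i, ?_⟩))
      · by_cases hm : m = i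
        · subst hm; simp only [Function.update_self]; linarith
        · simp [hm]
      · simpa using hlt
    · have hqi : q i = d.2 i := by
        by_contra hne
        exact hcon (by rw [hs]; exact ⟨fun _ => ⟨hq.1 i, lt_of_le_of_ne (hq.2 i) hne⟩, by simp⟩)
      obtain ⟨b', hb', hlt, hsub'⟩ := extend_right hB hij hik hjk hR hdn hds hcons' ⟨hqk1, hqk2⟩
        hqi hσ hs hσj
      have hmem : (d.1, Function.update d.2 i b') ∈ Q := by
        rw [hQ, Finset.mem_filter, Finset.mem_product, hV, Fintype.mem_piFinset,
          Fintype.mem_piFinset]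
        refine ⟨⟨hd1, fun m => ?_⟩, fun m => ?_, hsub', hdl, by simp [hki, hdh], hpd.1,
          fun m => ?_⟩ <;> by_cases hm : m = i
        · subst hm; simpa using hb'
        · simpa [hm] using hd2 m
        · subst hm; simpa using (hdn m).trans hlt
        · simpa [hm] using hdn m
        · subst hm; simpa using (hpd.2 m).trans hlt.le
        · simpa [hm] using hpd.2 m
      have := hdmax _ hmem
      refine absurd this (not_le.2 (Finset.sum_lt_sum (fun m _ => ?_) ⟨i, Finset.mem_univ i, ?_⟩))
      · by_cases hm : m = i
        · subst hm; simp only [Function.update_self]; linarith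
        · simp [hm]
      · simpa using hlt
  refine ⟨d, ⟨hdn, hd1, hd2, hds, hcons', fun q hq hqk1 hqk2 σ hσ => ?_⟩, hpd⟩
  obtain ⟨i, j, hij, hik, hjk⟩ := exists_others k
  have hqg : q k ∉ grid B k := fun h => hcons' _ h ⟨hqk1, hqk2⟩
  have hvert : ∀ s, cOct (d.1 k) (d.2 k) (q k) s :=
    fun s => ⟨fun _ => ⟨hqk1.le, hqk2⟩, fun _ => ⟨hqk1, hqk2.le⟩⟩
  -- If `σ` points outwards in both horizontal directions, then the diagonally opposite octant is in
  -- the box. By `hN` an intermediate octant is filled as well; it leaves the box in one direction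
  -- only, against `hside`.
  have hor : cOct (d.1 i) (d.2 i) (q i) (σ i) ∨ cOct (d.1 j) (d.2 j) (q j) (σ j) := by
    by_contra hcon
    push Not at hcon
    have hi := cOct_not hdn hq hcon.1
    have hj := cOct_not hdn hq hcon.2
    have hff : oct B q (flip i (flip j σ)) := by
      apply oct_of_subset hB hds
      unfold boxOct
      rw [fin3_forall hij hik hjk]
      refine ⟨by simpa [flip_of_ne hij] using hi, by simpa [flip_of_ne hij.symm] using hj, hvert _⟩
    rcases hN q hqg i j hij hik hjk σ hσ hff with h1 | h1
    · have := hside j hjk i hik hij.symm q hq hqk1 hqk2 _ h1 (by simpa using hi)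
      rw [flip_of_ne hij.symm] at this
      exact hcon.2 this
    · have := hside i hik j hjk hij q hq hqk1 hqk2 _ h1 (by simpa using hj)
      rw [flip_of_ne hij] at this
      exact hcon.1 this
  unfold boxOct
  rw [fin3_forall hij hik hjk]
  rcases hor with h1 | h1
  · exact ⟨h1, hside j hjk i hik hij.symm q hq hqk1 hqk2 σ hσ h1, hvert _⟩
  · exact ⟨hside i hik j hjk hij q hq hqk1 hqk2 σ hσ h1, h1, hvert _⟩

/-! ### The two local conditions for a 2-reflex polyhedron -/

/-- Away from the grid heights the pattern is planar, so three filled quadrants and an empty one are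
exactly a vertical reflex edge. -/
theorem noReflex_of_forall_not {B : Finset (Point × Point)} (hB : ∀ c ∈ B, ∀ i, c.1 i < c.2 i)
    {k : Fin 3} (h : ∀ p, ¬ IsReflexEdgePoint (boxUnion B) k p) : NoReflex B k := by
  intro p hp i j hij hik hjk σ h1 h2 h3
  by_contra h4
  refine h p ((isReflexEdgePoint_iff hB).2 ⟨σ, fun τ => ⟨fun hτ => ?_, ?_⟩⟩)
  · by_contra hcon
    push Not at hcon
    refine h4 (hτ.congr_of_notMem_grid hp fun l hl => ?_)
    have hl' := hcon l hl
    rcases fin3_cases hij hik hjk l with rfl | rfl | rfl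
    · rw [flip_same, flip_of_ne hij]; cases h5 : τ l <;> cases h6 : σ l <;> simp_all
    · rw [flip_of_ne hij.symm, flip_same]; cases h5 : τ l <;> cases h6 : σ l <;> simp_all
    · exact absurd rfl hl
  · rintro ⟨l, hl, hτl⟩
    have key : ∀ ρ, oct B p ρ → ρ i = τ i → ρ j = τ j → oct B p τ := by
      intro ρ hρ hi hj
      refine hρ.congr_of_notMem_grid hp fun m hm => ?_
      rcases fin3_cases hij hik hjk m with rfl | rfl | rfl
      · exact hi
      · exact hj
      · exact absurd rfl hm
    rcases fin3_cases hij hik hjk l with rfl | rfl | rfl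
    · by_cases hj : τ j = σ j
      · exact key _ h1 hτl.symm hj.symm
      · refine key _ h3 (by rw [flip_of_ne hij, hτl]) ?_
        rw [flip_same]; cases h5 : τ j <;> cases h6 : σ j <;> simp_all
    · by_cases hj : τ i = σ i
      · exact key _ h1 hj.symm hτl.symm
      · refine key _ h2 ?_ (by rw [flip_of_ne hij.symm, hτl])
        rw [flip_same]; cases h5 : τ i <;> cases h6 : σ i <;> simp_all
    · exact absurd rfl hl

/-- For two diagonally opposite filled quadrants, `exists_oct_flip` provides two filled quadrants
adjacent across the `i`-th plane; one of these is neither of the given ones. -/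
theorem noPinch_of_isManifoldWithBoundary {B : Finset (Point × Point)}
    (hB : ∀ c ∈ B, ∀ i, c.1 i < c.2 i) (hM : IsManifoldWithBoundary (boxUnion B)) (k : Fin 3) :
    NoPinch B k := by
  intro p hp i j hij hik hjk σ h1 h2
  obtain ⟨ρ, hρ, hρ'⟩ := exists_oct_flip (i := i) hB hM h1 h2 (by simp [flip_of_ne hij])
  have key : ∀ τ ρ, oct B p ρ → ρ i = τ i → ρ j = τ j → oct B p τ := by
    intro τ ρ hρ hi hj
    refine hρ.congr_of_notMem_grid hp fun m hm => ?_
    rcases fin3_cases hij hik hjk m with rfl | rfl | rfl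
    · exact hi
    · exact hj
    · exact absurd rfl hm
  have hi : ρ i = σ i ∨ (flip i ρ) i = σ i := by
    rw [flip_same]; cases ρ i <;> cases σ i <;> simp
  have hi' : ρ i = !σ i ∨ (flip i ρ) i = !σ i := by
    rw [flip_same]; cases ρ i <;> cases σ i <;> simp
  by_cases hj : ρ j = σ j
  · left
    rcases hi' with h | h
    · exact key _ _ hρ (by rw [h, flip_same]) (by rw [flip_of_ne hij.symm, hj])
    · exact key _ _ hρ' (by rw [h, flip_same]) (by rw [flip_of_ne hij.symm, flip_of_ne hij.symm, hj])
  · right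
    have hj' : ρ j = !σ j := by cases h5 : ρ j <;> cases h6 : σ j <;> simp_all
    rcases hi with h | h
    · exact key _ _ hρ (by rw [h, flip_of_ne hij]) (by rw [flip_same, hj'])
    · exact key _ _ hρ' (by rw [h, flip_of_ne hij]) (by rw [flip_same, flip_of_ne hij.symm, hj'])

/-- A decomposition of a set into slab bricks that touch along nondegenerate horizontal
rectangles only. -/
structure IsDecomposition (D : Finset (Point × Point)) (k : Fin 3) : Prop where
  nondeg : ∀ c ∈ D, ∀ i, c.1 i < c.2 i
  slab : ∀ c ∈ D, ∀ c' ∈ D, c.1 k < c'.2 k → c'.1 k < c.2 k → c.1 k = c'.1 k ∧ c.2 k = c'.2 k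
  eq_of_mem : ∀ c ∈ D, ∀ c' ∈ D, c.1 k = c'.1 k → c.2 k = c'.2 k →
    ∀ p, p ∈ Icc c.1 c.2 → p ∈ Icc c'.1 c'.2 → c = c'
  overlap : ∀ c ∈ D, ∀ c' ∈ D, c.2 k = c'.1 k → ∀ p, p ∈ Icc c.1 c.2 → p ∈ Icc c'.1 c'.2 →
    ∀ i, i ≠ k → c.1 i < c'.2 i ∧ c'.1 i < c.2 i

/-! ### Uniqueness of the slab bricks and the decomposition -/

/-- If `c'` extended beyond a side of `c`, move `q` to this side: there `c'` fills an octant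
pointing out of `c`, contrary to the isolation of `c`. -/
theorem IsSlabBrick.le_of_mem {B : Finset (Point × Point)} (hB : ∀ c ∈ B, ∀ i, c.1 i < c.2 i)
    {k : Fin 3} {c c' : Point × Point} (hc : IsSlabBrick B k c) (hc' : IsSlabBrick B k c')
    {q : Point} (hq : q ∈ Icc c.1 c.2) (hq' : q ∈ Icc c'.1 c'.2)
    (hqk : c.1 k < q k ∧ q k < c.2 k) {i : Fin 3} (hi : i ≠ k) :
    c'.2 i ≤ c.2 i ∧ c.1 i ≤ c'.1 i := by
  constructor
  · by_contra hcon
    push Not at hcon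
    have hm : Function.update q i (c.2 i) ∈ Icc c.1 c.2 :=
      ⟨by rw [le_update_iff]; exact ⟨(hc.nondeg i).le, fun j _ => hq.1 j⟩,
        by rw [update_le_iff]; exact ⟨le_rfl, fun j _ => hq.2 j⟩⟩
    have hm' : Function.update q i (c.2 i) ∈ Icc c'.1 c'.2 :=
      ⟨by rw [le_update_iff]; exact ⟨(hq'.1 i).trans (hq.2 i), fun j _ => hq'.1 j⟩,
        by rw [update_le_iff]; exact ⟨hcon.le, fun j _ => hq'.2 j⟩⟩
    obtain ⟨σ, hσ⟩ := exists_boxOct hc'.nondeg hm'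
    have hσ' : boxOct c' (Function.update q i (c.2 i)) (Function.update σ i true) := by
      intro j
      by_cases hj : j = i
      · subst hj
        simp only [Function.update_self]
        exact ⟨fun _ => ⟨(hq'.1 j).trans (hq.2 j), hcon⟩, by simp⟩
      · have := hσ j
        simpa [hj] using this
    have := hc.isolated _ hm (by simpa [hi.symm] using hqk.1) (by simpa [hi.symm] using hqk.2) _
      (oct_of_subset hB hc'.subset hσ') i
    simp [cOct] at this
  · by_contra hcon
    push Not at hcon
    have hm : Function.update q i (c.1 i) ∈ Icc c.1 c.2 :=
      ⟨by rw [le_update_iff]; exact ⟨le_rfl, fun j _ => hq.1 j⟩,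
        by rw [update_le_iff]; exact ⟨(hc.nondeg i).le, fun j _ => hq.2 j⟩⟩
    have hm' : Function.update q i (c.1 i) ∈ Icc c'.1 c'.2 :=
      ⟨by rw [le_update_iff]; exact ⟨hcon.le, fun j _ => hq'.1 j⟩,
        by rw [update_le_iff]; exact ⟨(hq.1 i).trans (hq'.2 i), fun j _ => hq'.2 j⟩⟩
    obtain ⟨σ, hσ⟩ := exists_boxOct hc'.nondeg hm'
    have hσ' : boxOct c' (Function.update q i (c.1 i)) (Function.update σ i false) := by
      intro j
      by_cases hj : j = i
      · subst hj
        simp only [Function.update_self]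
        exact ⟨by simp, fun _ => ⟨hcon, (hq.1 j).trans (hq'.2 j)⟩⟩
      · have := hσ j
        simpa [hj] using this
    have := hc.isolated _ hm (by simpa [hi.symm] using hqk.1) (by simpa [hi.symm] using hqk.2) _
      (oct_of_subset hB hc'.subset hσ') i
    simp [cOct] at this

theorem IsSlabBrick.eq_of_mem {B : Finset (Point × Point)} (hB : ∀ c ∈ B, ∀ i, c.1 i < c.2 i)
    {k : Fin 3} {c c' : Point × Point} (hc : IsSlabBrick B k c) (hc' : IsSlabBrick B k c')
    (h1 : c.1 k = c'.1 k) (h2 : c.2 k = c'.2 k) {p : Point} (hp : p ∈ Icc c.1 c.2)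
    (hp' : p ∈ Icc c'.1 c'.2) : c = c' := by
  have hn := hc.nondeg k
  set q := Function.update p k ((c.1 k + c.2 k) / 2) with hq
  have hqk : c.1 k < q k ∧ q k < c.2 k := by
    rw [hq, Function.update_self]; constructor <;> linarith
  have hqc : q ∈ Icc c.1 c.2 :=
    ⟨by rw [hq, le_update_iff]; exact ⟨by linarith, fun j _ => hp.1 j⟩,
      by rw [hq, update_le_iff]; exact ⟨by linarith, fun j _ => hp.2 j⟩⟩
  have hqc' : q ∈ Icc c'.1 c'.2 :=
    ⟨by rw [hq, le_update_iff]; exact ⟨by linarith, fun j _ => hp'.1 j⟩,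
      by rw [hq, update_le_iff]; exact ⟨by linarith, fun j _ => hp'.2 j⟩⟩
  have e := fun i (hi : i ≠ k) => hc.le_of_mem hB hc' hqc hqc' hqk hi
  have e' := fun i (hi : i ≠ k) => hc'.le_of_mem hB hc hqc' hqc (by rwa [← h1, ← h2]) hi
  refine Prod.ext (funext fun i => ?_) (funext fun i => ?_) <;> by_cases hi : i = k
  · subst hi; exact h1
  · exact le_antisymm (e i hi).2 (e' i hi).2
  · subst hi; exact h2
  · exact le_antisymm (e' i hi).1 (e i hi).1

/-- All slab bricks together do it. That stacked bricks overlap in a rectangle of positive area,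
rather than touching in a segment or a point, is a second use of the manifold property, now across a
horizontal plane. -/
theorem exists_isDecomposition {P : Set Point} {k : Fin 3} (hP : IsTwoReflex P k) :
    ∃ D, IsDecomposition D k ∧ P = boxUnion D := by
  classical
  obtain ⟨⟨-, hM, B, hB, hPB⟩, hR⟩ := hP
  change P = boxUnion B at hPB
  rw [hPB] at hM hR
  have hNR := noReflex_of_forall_not hB hR
  have hNP := noPinch_of_isManifoldWithBoundary hB hM k
  set D : Finset (Point × Point) :=
    (Fintype.piFinset (grid B) ×ˢ Fintype.piFinset (grid B)).filter (IsSlabBrick B k) with hD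
  have hmem : ∀ c, c ∈ D ↔ IsSlabBrick B k c := by
    intro c
    rw [hD, Finset.mem_filter, Finset.mem_product, Fintype.mem_piFinset, Fintype.mem_piFinset]
    exact ⟨fun h => h.2, fun h => ⟨⟨h.fst_mem, h.snd_mem⟩, h⟩⟩
  have hDn : ∀ c ∈ D, ∀ i, c.1 i < c.2 i := fun c hc => ((hmem c).1 hc).nondeg
  have hBD : boxUnion B = boxUnion D := by
    ext p
    constructor
    · intro hp
      obtain ⟨c, hc, hpc⟩ := exists_isSlabBrick hB hNR hNP hp
      exact mem_boxUnion.2 ⟨c, (hmem c).2 hc, hpc⟩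
    · intro hp
      obtain ⟨c, hc, hpc⟩ := mem_boxUnion.1 hp
      exact ((hmem c).1 hc).subset hpc
  have hslab : ∀ c ∈ D, ∀ c' ∈ D, c.1 k < c'.2 k → c'.1 k < c.2 k →
      c.1 k = c'.1 k ∧ c.2 k = c'.2 k := by
    intro c hc c' hc' h1 h2
    rw [hmem] at hc hc'
    constructor
    · apply le_antisymm
      · by_contra hcon
        exact hc'.consecutive _ (hc.fst_mem k) ⟨not_le.1 hcon, h1⟩
      · by_contra hcon
        exact hc.consecutive _ (hc'.fst_mem k) ⟨not_le.1 hcon, h2⟩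
    · apply le_antisymm
      · by_contra hcon
        exact hc.consecutive _ (hc'.snd_mem k) ⟨h1, not_le.1 hcon⟩
      · by_contra hcon
        exact hc'.consecutive _ (hc.snd_mem k) ⟨h2, not_le.1 hcon⟩
  have heq : ∀ c ∈ D, ∀ c' ∈ D, c.1 k = c'.1 k → c.2 k = c'.2 k →
      ∀ p, p ∈ Icc c.1 c.2 → p ∈ Icc c'.1 c'.2 → c = c' := by
    intro c hc c' hc' h1 h2 p hp hp'
    exact ((hmem c).1 hc).eq_of_mem hB ((hmem c').1 hc') h1 h2 hp hp'
  refine ⟨D, ⟨hDn, hslab, heq, ?_⟩, hPB.trans hBD⟩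
  intro c hc c' hc' hcc p hp hp'
  have hpk : p k = c.2 k := le_antisymm (hp.2 k) (hcc.trans_le (hp'.1 k))
  obtain ⟨σ, hσ⟩ := exists_boxOct (hDn c hc) hp
  obtain ⟨τ, hτ⟩ := exists_boxOct (hDn c' hc') hp'
  have hσk : σ k = false := by
    by_contra h
    have := ((hσ k).1 (by simpa using h)).2
    linarith
  have hτk : τ k = true := by
    by_contra h
    have := ((hτ k).2 (by simpa using h)).1
    linarith
  rw [hBD] at hM
  -- Two filled octants lie directly one above the other. By uniqueness within a slab the lower one
  -- belongs to `c` and the upper one to `c'`, so their horizontal sections share a quadrant at `p`.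
  obtain ⟨ρ, hρ, hρ'⟩ := exists_oct_flip (i := k) hDn hM ⟨c, hc, hσ⟩ ⟨c', hc', hτ⟩ (by simp [hσk, hτk])
  have low : ∀ ρ : Fin 3 → Bool, ρ k = false → oct D p ρ → boxOct c p ρ := by
    rintro ρ hρk ⟨e, he, hρ⟩
    have h1 := (hρ k).2 hρk
    have h2 := hDn c hc k
    have h3 := hslab e he c hc (by linarith) (by linarith)
    rwa [← heq e he c hc h3.1 h3.2 p hρ.mem hp]
  have upp : ∀ ρ : Fin 3 → Bool, ρ k = true → oct D p ρ → boxOct c' p ρ := by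
    rintro ρ hρk ⟨e, he, hρ⟩
    have h1 := (hρ k).1 hρk
    have h2 := hDn c' hc' k
    have h3 := hslab e he c' hc' (by linarith) (by linarith)
    rwa [← heq e he c' hc' h3.1 h3.2 p hρ.mem hp']
  have fin : ∀ ρ ρ' : Fin 3 → Bool, boxOct c p ρ → boxOct c' p ρ' → (∀ i, i ≠ k → ρ i = ρ' i) →
      ∀ i, i ≠ k → c.1 i < c'.2 i ∧ c'.1 i < c.2 i := by
    intro ρ ρ' h1 h2 h3 i hi
    have h4 := h1 i
    have h5 := h2 i
    rw [← h3 i hi] at h5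
    cases hs : ρ i
    · have h6 := h4.2 hs
      have h7 := h5.2 hs
      constructor <;> linarith
    · have h6 := h4.1 hs
      have h7 := h5.1 hs
      constructor <;> linarith
  cases hk : ρ k
  · exact fin _ _ (low _ hk hρ) (upp _ (by simp [hk]) hρ') fun i hi => (flip_of_ne hi _).symm
  · exact fin _ _ (low _ (by simp [hk]) hρ') (upp _ hk hρ) fun i hi => flip_of_ne hi _

/-! ### Edges of unions of boxes -/

/-- The octants of the pattern `O` form a wedge of angle `π / 2` around the `i`-th axis. -/
def IsConvexWedge (i : Fin 3) (O : (Fin 3 → Bool) → Prop) : Prop :=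
  ∃ s : Fin 3 → Bool, ∀ σ, O σ ↔ ∀ j, j ≠ i → σ j = s j

/-- The octants of the pattern `O` form a wedge of angle `3 π / 2` around the `i`-th axis. -/
def IsReflexWedge (i : Fin 3) (O : (Fin 3 → Bool) → Prop) : Prop :=
  ∃ s : Fin 3 → Bool, ∀ σ, O σ ↔ ∃ j, j ≠ i ∧ σ j = s j

/-- The octants of the pattern `O` form a wedge around the `i`-th axis. -/
def IsWedge (i : Fin 3) (O : (Fin 3 → Bool) → Prop) : Prop :=
  IsConvexWedge i O ∨ IsReflexWedge i O

theorem mem_edgePoints_iff {B : Finset (Point × Point)} (hB : ∀ c ∈ B, ∀ i, c.1 i < c.2 i)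
    {p : Point} : p ∈ edgePoints (boxUnion B) ↔ ∃ i, IsWedge i (oct B p) := by
  simp only [edgePoints, mem_ofPred, isConvexEdgePoint_iff hB, isReflexEdgePoint_iff hB, IsWedge,
    IsConvexWedge, IsReflexWedge]

theorem IsWedge.congr {i : Fin 3} {O : (Fin 3 → Bool) → Prop} (h : IsWedge i O)
    {σ τ : Fin 3 → Bool} (hστ : ∀ l, l ≠ i → σ l = τ l) : O σ ↔ O τ := by
  rcases h with ⟨s, h⟩ | ⟨s, h⟩
  · rw [h, h]
    exact forall₂_congr fun j hj => by rw [hστ j hj]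
  · rw [h, h]
    exact exists_congr fun j => and_congr_right fun hj => by rw [hστ j hj]

theorem exists_third {i j : Fin 3} (h : i ≠ j) : ∃ m, m ≠ i ∧ m ≠ j := by
  revert i j; decide

/-- Together with `IsWedge.congr` this recovers the axis from the pattern: it is the only direction
in which a wedge is invariant. -/
theorem IsWedge.exists_flip {i j : Fin 3} {O : (Fin 3 → Bool) → Prop} (h : IsWedge i O)
    (hji : j ≠ i) : ∃ σ, O σ ∧ ¬ O (flip j σ) := by
  rcases h with ⟨s, h⟩ | ⟨s, h⟩
  · refine ⟨s, (h s).2 fun _ _ => rfl, fun hcon => ?_⟩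
    simpa using (h _).1 hcon j hji
  · obtain ⟨m, hmi, hmj⟩ := exists_third hji.symm
    refine ⟨flip m s, (h _).2 ⟨j, hji, flip_of_ne hmj.symm s⟩, fun hcon => ?_⟩
    obtain ⟨l, hl, hls⟩ := (h _).1 hcon
    rcases fin3_cases hji.symm hmi.symm hmj.symm l with rfl | rfl | rfl
    · exact hl rfl
    · simp [flip_of_ne hmj.symm] at hls
    · simp [flip_of_ne hmj] at hls

theorem not_isConvexWedge_and_isReflexWedge {i : Fin 3} {O : (Fin 3 → Bool) → Prop}
    (h : IsConvexWedge i O) (h' : IsReflexWedge i O) : False := by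
  obtain ⟨s, h⟩ := h
  obtain ⟨s', h'⟩ := h'
  obtain ⟨j, hj⟩ : ∃ j, j ≠ i := exists_ne i
  obtain ⟨m, hmi, hmj⟩ := exists_third hj.symm
  have := (h (fun l => if l = j then s' l else !s l)).1
    ((h' _).2 ⟨j, hj, by simp⟩) m hmi
  simp [hmj] at this

theorem IsConvexWedge.congr_set {i : Fin 3} {O O' : (Fin 3 → Bool) → Prop} (h : ∀ σ, O σ ↔ O' σ)
    (hO : IsConvexWedge i O) : IsConvexWedge i O' :=
  hO.imp fun _ hs σ => (h σ).symm.trans (hs σ)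

theorem IsReflexWedge.congr_set {i : Fin 3} {O O' : (Fin 3 → Bool) → Prop} (h : ∀ σ, O σ ↔ O' σ)
    (hO : IsReflexWedge i O) : IsReflexWedge i O' :=
  hO.imp fun _ hs σ => (h σ).symm.trans (hs σ)

theorem IsWedge.congr_set {i : Fin 3} {O O' : (Fin 3 → Bool) → Prop} (h : ∀ σ, O σ ↔ O' σ)
    (hO : IsWedge i O) : IsWedge i O' :=
  hO.imp (·.congr_set h) (·.congr_set h)

/-- Along a wedge, the only edge points are those of its ridge. -/
theorem IsWedge.eventually {B : Finset (Point × Point)} {i : Fin 3} {p : Point}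
    (h : IsWedge i (oct B p)) : ∀ᶠ q in 𝓝 p,
      (∀ i', IsWedge i' (oct B q) → i' = i ∧ ∀ j, j ≠ i → q j = p j) ∧
      ((∀ j, j ≠ i → q j = p j) → ∀ σ, oct B q σ ↔ oct B p σ) := by
  filter_upwards [eventually_oct B p] with q hq
  have hline : (∀ j, j ≠ i → q j = p j) → ∀ σ, oct B q σ ↔ oct B p σ := by
    intro hl σ
    rw [hq]
    exact h.congr fun l hl' => by simp [toward, hl l hl']
  refine ⟨fun i' hi' => ?_, hline⟩
  -- If `q` has left the ridge in the direction `j`, the pattern at `q` is invariant both along `j`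
  -- and along `i`. A wedge has only one invariant direction, so there is none at `q`.
  have hl : ∀ j, j ≠ i → q j = p j := by
    intro j hj
    by_contra hne
    by_cases hji : j = i'
    · obtain ⟨σ, h1, h2⟩ := hi'.exists_flip (j := i) (by rw [← hji]; exact hj.symm)
      rw [hq] at h1 h2
      refine h2 ((h.congr fun l hl => ?_).1 h1)
      simp [toward, flip_of_ne hl]
    · obtain ⟨σ, h1, h2⟩ := hi'.exists_flip (j := j) hji
      rw [hq] at h1 h2
      refine h2 ((h.congr fun l hl => ?_).1 h1)
      by_cases hlj : l = j
      · subst hlj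
        rcases lt_or_gt_of_ne hne with h3 | h3 <;> simp [toward, h3, h3.not_gt]
      · simp [toward, flip_of_ne hlj]
  refine ⟨?_, hl⟩
  by_contra hne
  obtain ⟨σ, h1, h2⟩ := hi'.exists_flip (j := i) (Ne.symm hne)
  rw [hline hl] at h1 h2
  exact h2 ((h.congr fun l hl => by simp [flip_of_ne hl]).1 h1)

theorem continuous_update_const (p : Point) (i : Fin 3) :
    Continuous fun t : ℝ => Function.update p i t :=
  continuous_const.update i continuous_id

/-- An edge of a union of boxes is an open segment, and its ends are not edge points. -/
theorem exists_segment {B : Finset (Point × Point)} (hB : ∀ c ∈ B, ∀ i, c.1 i < c.2 i)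
    {i : Fin 3} {p : Point} (h : IsWedge i (oct B p)) : ∃ α β, α < p i ∧ p i < β ∧
      (∀ t ∈ Ioo α β, ∀ σ, oct B (Function.update p i t) σ ↔ oct B p σ) ∧
      Function.update p i β ∉ edgePoints (boxUnion B) ∧
      connectedComponentIn (edgePoints (boxUnion B)) p = Function.update p i '' Ioo α β ∧
      ∀ σ, oct B p σ ↔ oct B (Function.update p i β) (Function.update σ i false) := by
  set ℓ : ℝ → Point := fun t => Function.update p i t with hℓ
  have hc : Continuous ℓ := continuous_update_const p i
  -- The edge is the component at `p i` of the parameters with an unchanged pattern. This set is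
  -- open, because a wedge is locally constant along its ridge, and bounded by the grid.
  set T : Set ℝ := {t | ∀ σ, oct B (ℓ t) σ ↔ oct B p σ} with hT
  have hpT : p i ∈ T := by simp [hT, hℓ]
  have hwT : ∀ t ∈ T, IsWedge i (oct B (ℓ t)) := fun t ht => h.congr_set fun σ => (ht σ).symm
  have hToc : IsOpen T := by
    rw [isOpen_iff_mem_nhds]
    intro t ht
    filter_upwards [hc.continuousAt.eventually (hwT t ht).eventually] with s hs σ
    rw [hs.2 (fun j hj => by simp [hℓ, hj]) σ, ht σ]
  obtain ⟨σ₀, hσ₀, -⟩ := h.exists_flip (exists_ne i).choose_spec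
  have hbd : ∀ t ∈ T, ∃ g ∈ grid B i, t ≤ g := by
    intro t ht
    obtain ⟨c, hc, hcσ⟩ := (ht σ₀).2 hσ₀
    exact ⟨_, snd_mem_grid hc i, by simpa [hℓ] using (hcσ i).mem.2⟩
  have hbd' : ∀ t ∈ T, ∃ g ∈ grid B i, g ≤ t := by
    intro t ht
    obtain ⟨c, hc, hcσ⟩ := (ht σ₀).2 hσ₀
    exact ⟨_, fst_mem_grid hc i, by simpa [hℓ] using (hcσ i).mem.1⟩
  obtain ⟨β, hβT, hpβ, hβ⟩ : ∃ β, β ∉ T ∧ p i < β ∧ Ico (p i) β ⊆ T := by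
    have hne : (Tᶜ ∩ Ici (p i)).Nonempty := by
      obtain ⟨M, hM⟩ := (grid B i).exists_le
      refine ⟨max (M + 1) (p i), fun hcon => ?_, mem_Ici.2 (le_max_right _ _)⟩
      obtain ⟨g, hg, hgt⟩ := hbd _ hcon
      have := hM g hg
      have := le_max_left (M + 1) (p i)
      linarith
    have hbb : BddBelow (Tᶜ ∩ Ici (p i)) := ⟨p i, fun _ hx => hx.2⟩
    have hmem := (hToc.isClosed_compl.inter isClosed_Ici).csInf_mem hne hbb
    refine ⟨_, hmem.1, lt_of_le_of_ne hmem.2 fun he => hmem.1 (he ▸ hpT), fun t ht => ?_⟩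
    by_contra hcon
    exact (csInf_le hbb ⟨hcon, ht.1⟩).not_gt ht.2
  obtain ⟨α, hαT, hpα, hα⟩ : ∃ α, α ∉ T ∧ α < p i ∧ Ioc α (p i) ⊆ T := by
    have hne : (Tᶜ ∩ Iic (p i)).Nonempty := by
      obtain ⟨M, hM⟩ := (grid B i).finite_toSet.bddBelow
      refine ⟨min (M - 1) (p i), fun hcon => ?_, mem_Iic.2 (min_le_right _ _)⟩
      obtain ⟨g, hg, hgt⟩ := hbd' _ hcon
      have := hM (Finset.mem_coe.2 hg)
      have := min_le_left (M - 1) (p i)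
      linarith
    have hbb : BddAbove (Tᶜ ∩ Iic (p i)) := ⟨p i, fun _ hx => hx.2⟩
    have hmem := (hToc.isClosed_compl.inter isClosed_Iic).csSup_mem hne hbb
    refine ⟨_, hmem.1, lt_of_le_of_ne hmem.2 fun he => hmem.1 (by rw [he]; exact hpT),
      fun t ht => ?_⟩
    by_contra hcon
    exact (le_csSup hbb ⟨hcon, ht.2⟩).not_gt ht.1
  have hαβ : Ioo α β ⊆ T := by
    intro t ht
    rcases le_total t (p i) with h1 | h1
    · exact hα ⟨ht.1, h1⟩
    · exact hβ ⟨h1, ht.2⟩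
  -- Near an edge point all edge points lie on its ridge and share its pattern, so a limit of
  -- parameters in `T` that is an edge point would have the pattern of `p`.
  have hlim : ∀ t, t ∉ T → t ∈ closure T → ℓ t ∉ edgePoints (boxUnion B) := by
    intro t ht htc hE
    obtain ⟨i', hi'⟩ := (mem_edgePoints_iff hB).1 hE
    obtain ⟨s, hs, hsT⟩ := (mem_closure_iff_frequently.1 htc).and_eventually
      (hc.continuousAt.eventually hi'.eventually) |>.exists
    obtain ⟨hii, hsl⟩ := hsT.1 i (hwT s hs)
    subst hii
    refine ht fun σ => ?_
    rw [← hsT.2 hsl σ, hs σ]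
  have hclos : Icc α β ⊆ closure T := by
    rw [← closure_Ioo (hpα.trans hpβ).ne]
    exact closure_mono hαβ
  have hβE := hlim β hβT (hclos ⟨(hpα.trans hpβ).le, le_rfl⟩)
  have hαE := hlim α hαT (hclos ⟨le_rfl, (hpα.trans hpβ).le⟩)
  have hsub : ℓ '' Ioo α β ⊆ edgePoints (boxUnion B) := by
    rintro _ ⟨t, ht, rfl⟩
    exact (mem_edgePoints_iff hB).2 ⟨i, hwT t (hαβ ht)⟩
  have hpA : p ∈ ℓ '' Ioo α β := ⟨p i, ⟨hpα, hpβ⟩, by simp [hℓ]⟩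
  refine ⟨α, β, hpα, hpβ, hαβ, hβE, Subset.antisymm ?_ ?_, ?_⟩
  · have hK := isPreconnected_connectedComponentIn (F := edgePoints (boxUnion B)) (x := p)
    rw [isPreconnected_iff_subset_of_disjoint] at hK
    -- The segment is relatively open in the set of edge points, as witnessed by `U`, and relatively
    -- closed, since its ends are not edge points; so it contains the component.
    set U := interior {q | q ∈ edgePoints (boxUnion B) → q ∈ ℓ '' Ioo α β} with hU
    have hAU : ℓ '' Ioo α β ⊆ U := by
      rintro _ ⟨t, ht, rfl⟩
      rw [hU, mem_interior_iff_mem_nhds]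
      have hn := (continuous_apply (A := fun _ : Fin 3 => ℝ) i).continuousAt (x := ℓ t)
        |>.preimage_mem_nhds (t := Ioo α β) (by simpa [hℓ] using Ioo_mem_nhds ht.1 ht.2)
      filter_upwards [(hwT t (hαβ ht)).eventually, hn] with q hq hqi hqE
      obtain ⟨i', hi'⟩ := (mem_edgePoints_iff hB).1 hqE
      refine ⟨q i, hqi, funext fun j => ?_⟩
      by_cases hj : j = i
      · subst hj; simp [hℓ]
      · rw [(hq.1 i' hi').2 j hj]; simp [hℓ, hj]
    have hclA : closure (ℓ '' Ioo α β) ⊆ ℓ '' Icc α β :=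
      closure_minimal (image_mono Ioo_subset_Icc_self) (isCompact_Icc.image hc).isClosed
    have hclE : ∀ q ∈ edgePoints (boxUnion B), q ∈ closure (ℓ '' Ioo α β) → q ∈ ℓ '' Ioo α β := by
      intro q hq hqc
      obtain ⟨t, ht, rfl⟩ := hclA hqc
      refine ⟨t, ⟨lt_of_le_of_ne ht.1 ?_, lt_of_le_of_ne ht.2 ?_⟩, rfl⟩
      · rintro rfl; exact hαE hq
      · rintro rfl; exact hβE hq
    have hKE := connectedComponentIn_subset (edgePoints (boxUnion B)) p
    have hcov : connectedComponentIn (edgePoints (boxUnion B)) p ⊆ U ∪ (closure (ℓ '' Ioo α β))ᶜ := by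
      intro q hq
      by_cases hqc : q ∈ closure (ℓ '' Ioo α β)
      · exact Or.inl (hAU (hclE q (hKE hq) hqc))
      · exact Or.inr hqc
    have hdis : connectedComponentIn (edgePoints (boxUnion B)) p ∩
        (U ∩ (closure (ℓ '' Ioo α β))ᶜ) = ∅ := by
      rw [eq_empty_iff_forall_notMem]
      rintro q ⟨hq, hqU, hqV⟩
      exact hqV (subset_closure (interior_subset hqU (hKE hq)))
    rcases hK U (closure (ℓ '' Ioo α β))ᶜ isOpen_interior isClosed_closure.isOpen_compl
      hcov hdis with h1 | h1
    · exact fun q hq => interior_subset (h1 hq) (hKE hq)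
    · exact absurd (subset_closure hpA) (h1 (mem_connectedComponentIn (hsub hpA)))
  · exact (isPreconnected_Ioo.image _ hc.continuousOn).subset_connectedComponentIn hpA hsub
  · intro σ
    have hev := (hc.continuousAt (x := β)).eventually (eventually_oct B (ℓ β))
    obtain ⟨t, ht, ht'⟩ := ((hev.filter_mono (nhdsWithin_le_nhds (s := Iio β))).and
      (Ioo_mem_nhdsLT (hpα.trans hpβ))).exists
    rw [← hαβ ht' σ, ht σ]
    have : toward (ℓ β) (ℓ t) σ = Function.update σ i false := by
      funext j
      by_cases hj : j = i
      · subst hj; simp [toward, hℓ, ht'.2, ht'.2.not_gt]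
      · simp [toward, hℓ, hj]
    rw [this]

/-- The half of the pattern `O` below the `i`-th coordinate plane. -/
def lowerHalf (i : Fin 3) (O : (Fin 3 → Bool) → Prop) : (Fin 3 → Bool) → Prop :=
  fun σ => O (Function.update σ i false)

/-- The pattern `O` is not symmetric with respect to the `i`-th coordinate plane. -/
def IsAsymmetric (i : Fin 3) (O : (Fin 3 → Bool) → Prop) : Prop :=
  ∃ σ, ¬ (O σ ↔ lowerHalf i O σ)

/-- A point with an asymmetric pattern whose lower half is a wedge is the upper end of an edge. -/
theorem exists_edge_of_end {B : Finset (Point × Point)} (hB : ∀ c ∈ B, ∀ i, c.1 i < c.2 i)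
    {v : Point} {i : Fin 3} (hw : IsWedge i (lowerHalf i (oct B v)))
    (ha : IsAsymmetric i (oct B v)) :
    ∃ p α, α < v i ∧ (∀ σ, oct B p σ ↔ lowerHalf i (oct B v) σ) ∧
      p ∈ edgePoints (boxUnion B) ∧
      connectedComponentIn (edgePoints (boxUnion B)) p = Function.update v i '' Ioo α (v i) := by
  have hev := ((continuous_update_const v i).continuousAt (x := v i)).eventually
    (eventually_oct B (Function.update v i (v i)))
  rw [Function.update_eq_self] at hev
  obtain ⟨a, ha1, ha2⟩ := (mem_nhdsLT_iff_exists_Ioo_subset' (show v i - 1 < v i by linarith)).1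
    (hev.filter_mono (nhdsWithin_le_nhds (s := Iio (v i))))
  have hlow : ∀ t ∈ Ioo a (v i), ∀ σ,
      oct B (Function.update v i t) σ ↔ lowerHalf i (oct B v) σ := by
    intro t ht σ
    rw [show oct B (Function.update v i t) σ ↔ _ from ha2 ht σ]
    have : toward v (Function.update v i t) σ = Function.update σ i false := by
      funext j
      by_cases hj : j = i
      · subst hj; simp [toward, ht.2, ht.2.not_gt]
      · simp [toward, hj]
    rw [this]; rfl
  have ha1 : a < v i := ha1
  obtain ⟨t, ht⟩ : ∃ t, t ∈ Ioo a (v i) := nonempty_Ioo.2 ha1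
  have hpw : IsWedge i (oct B (Function.update v i t)) := hw.congr_set fun σ => (hlow t ht σ).symm
  obtain ⟨α, β, hα, hβ, hconst, hβE, hK, -⟩ := exists_segment hB hpw
  simp only [Function.update_self] at hα hβ
  have hup : ∀ s, Function.update (Function.update v i t) i s = Function.update v i s :=
    fun s => by simp
  simp only [hup] at hconst hβE hK
  -- Just below `v` there is a constant wedge, so the edge cannot stop earlier. If it went on
  -- through `v`, the pattern at `v` would agree with its lower half, against the asymmetry.
  have hβv : β = v i := by
    rcases lt_trichotomy β (v i) with h | h | h
    · exact absurd ((mem_edgePoints_iff hB).2 ⟨i, hw.congr_set fun σ =>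
        (hlow β ⟨ht.1.trans hβ, h⟩ σ).symm⟩) hβE
    · exact h
    · obtain ⟨σ, hσ⟩ := ha
      have := hconst (v i) ⟨hα.trans ht.2, h⟩ σ
      rw [Function.update_eq_self, hlow t ht] at this
      exact absurd this hσ
  subst hβv
  exact ⟨_, α, hα.trans ht.2, hlow t ht, (mem_edgePoints_iff hB).2 ⟨i, hpw⟩, hK⟩

theorem segment_inj {v v' : Point} {i i' : Fin 3} {α α' : ℝ} (hα : α < v i) (hα' : α' < v' i')
    (h : Function.update v i '' Ioo α (v i) = Function.update v' i' '' Ioo α' (v' i')) :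
    v = v' ∧ i = i' := by
  have hmem : ∀ t ∈ Ioo α (v i), Function.update v i t ∈ Function.update v' i' '' Ioo α' (v' i') :=
    fun t ht => h ▸ mem_image_of_mem _ ht
  have hii : i = i' := by
    by_contra hne
    obtain ⟨s, hs, hs'⟩ := exists_between hα
    obtain ⟨t, ht, ht'⟩ := exists_between hs'
    obtain ⟨x, -, hx⟩ := hmem s ⟨hs, hs'⟩
    obtain ⟨y, -, hy⟩ := hmem t ⟨hs.trans ht, ht'⟩
    have h1 := congrFun hx i
    have h2 := congrFun hy i
    simp only [Function.update_of_ne hne, Function.update_self] at h1 h2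
    linarith
  subst hii
  refine ⟨funext fun j => ?_, rfl⟩
  by_cases hj : j = i
  · subst hj
    have h1 : (fun q : Point => q j) '' (Function.update v j '' Ioo α (v j)) = Ioo α (v j) := by
      simp [image_image]
    have h2 : (fun q : Point => q j) '' (Function.update v' j '' Ioo α' (v' j)) = Ioo α' (v' j) := by
      simp [image_image]
    have := h1.symm.trans ((congrArg _ h).trans h2)
    rw [← csSup_Ioo hα, this, csSup_Ioo hα']
  · obtain ⟨s, hs, hs'⟩ := exists_between hα
    obtain ⟨x, -, hx⟩ := hmem s ⟨hs, hs'⟩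
    have h1 := congrFun hx j
    simpa [hj] using h1.symm

/-- Off the grid in some coordinate the pattern is invariant under the flip of that coordinate. The
wedge excludes this for the two transverse directions and the asymmetry for the direction of the
edge. Hence all ends are among finitely many points. -/
theorem mem_grid_of_end {B : Finset (Point × Point)} {v : Point} {i : Fin 3}
    (hw : IsWedge i (lowerHalf i (oct B v))) (ha : IsAsymmetric i (oct B v)) (j : Fin 3) :
    v j ∈ grid B j := by
  by_contra hj
  by_cases hji : j = i
  · subst hji
    obtain ⟨σ, hσ⟩ := ha
    refine hσ ⟨fun h => h.congr_of_notMem_grid hj ?_, fun h => oct.congr_of_notMem_grid hj h ?_⟩ <;>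
      intro l hl <;> simp [hl]
  · obtain ⟨σ, h1, h2⟩ := hw.exists_flip hji
    refine h2 (oct.congr_of_notMem_grid hj h1 fun l hl => ?_)
    by_cases hli : l = i
    · subst hli; simp
    · simp [hli, flip_of_ne hl]

/-- The points where the coordinates of the corners of the boxes meet. -/
noncomputable def gridPoints (B : Finset (Point × Point)) : Finset Point :=
  Fintype.piFinset (grid B)

open Classical in
/-- The upper ends of the convex edges, with the directions of these edges. -/
noncomputable def convexEnds (B : Finset (Point × Point)) : Finset (Point × Fin 3) :=
  (gridPoints B ×ˢ Finset.univ).filter fun e =>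
    IsConvexWedge e.2 (lowerHalf e.2 (oct B e.1)) ∧ IsAsymmetric e.2 (oct B e.1)

open Classical in
/-- The upper ends of the reflex edges, with the directions of these edges. -/
noncomputable def reflexEnds (B : Finset (Point × Point)) : Finset (Point × Fin 3) :=
  (gridPoints B ×ˢ Finset.univ).filter fun e =>
    IsReflexWedge e.2 (lowerHalf e.2 (oct B e.1)) ∧ IsAsymmetric e.2 (oct B e.1)

theorem mem_convexEnds {B : Finset (Point × Point)} {e : Point × Fin 3} : e ∈ convexEnds B ↔
    IsConvexWedge e.2 (lowerHalf e.2 (oct B e.1)) ∧ IsAsymmetric e.2 (oct B e.1) := by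
  simp only [convexEnds, Finset.mem_filter, Finset.mem_product, gridPoints, Fintype.mem_piFinset]
  exact ⟨fun h => h.2, fun h => ⟨⟨mem_grid_of_end (Or.inl h.1) h.2, Finset.mem_univ _⟩, h⟩⟩

theorem mem_reflexEnds {B : Finset (Point × Point)} {e : Point × Fin 3} : e ∈ reflexEnds B ↔
    IsReflexWedge e.2 (lowerHalf e.2 (oct B e.1)) ∧ IsAsymmetric e.2 (oct B e.1) := by
  simp only [reflexEnds, Finset.mem_filter, Finset.mem_product, gridPoints, Fintype.mem_piFinset]
  exact ⟨fun h => h.2, fun h => ⟨⟨mem_grid_of_end (Or.inr h.1) h.2, Finset.mem_univ _⟩, h⟩⟩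

/-- The edge below an upper end. -/
def IsEdgeBelow (e : Set Point) (v : Point × Fin 3) : Prop :=
  ∃ α, α < v.1 v.2 ∧ e = Function.update v.1 v.2 '' Ioo α (v.1 v.2)

theorem exists_end_of_edge {B : Finset (Point × Point)} (hB : ∀ c ∈ B, ∀ i, c.1 i < c.2 i)
    {i : Fin 3} {p : Point} (hp : IsWedge i (oct B p)) :
    ∃ v : Point × Fin 3, v.2 = i ∧ (∀ σ, oct B p σ ↔ lowerHalf i (oct B v.1) σ) ∧
      IsAsymmetric i (oct B v.1) ∧
      IsEdgeBelow (connectedComponentIn (edgePoints (boxUnion B)) p) v := by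
  obtain ⟨α, β, hα, hβ, -, hβE, hK, hlow⟩ := exists_segment hB hp
  refine ⟨(Function.update p i β, i), rfl, hlow, ?_, α, by simpa using hα.trans hβ, ?_⟩
  · by_contra hcon
    simp only [IsAsymmetric, not_exists, not_not] at hcon
    exact hβE ((mem_edgePoints_iff hB).2 ⟨i, hp.congr_set fun σ => (hlow σ).trans (hcon σ).symm⟩)
  · rw [hK]; simp

/-- The numbers of edges compared with those of their upper ends. -/
theorem card_ends {B : Finset (Point × Point)} (hB : ∀ c ∈ B, ∀ i, c.1 i < c.2 i) :
    (reflexEdges (boxUnion B)).ncard ≤ (reflexEnds B).card ∧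
    (convexEnds B).card + (reflexEdges (boxUnion B)).ncard ≤ (edges (boxUnion B)).ncard := by
  classical
  -- Two segments with the same direction and the same upper end share points near it, and edges are
  -- components.
  have hinj : ∀ e e' v, IsEdgeBelow e v → IsEdgeBelow e' v →
      e ∈ edges (boxUnion B) → e' ∈ edges (boxUnion B) → e = e' := by
    rintro _ _ v ⟨α, hα, rfl⟩ ⟨α', hα', rfl⟩ ⟨p, hp, h⟩ ⟨p', hp', h'⟩
    obtain ⟨x, hx, hx'⟩ := exists_between (max_lt hα hα')
    have hmem : Function.update v.1 v.2 x ∈ connectedComponentIn (edgePoints (boxUnion B)) p :=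
      h ▸ mem_image_of_mem _ ⟨(le_max_left _ _).trans_lt hx, hx'⟩
    have hmem' : Function.update v.1 v.2 x ∈ connectedComponentIn (edgePoints (boxUnion B)) p' :=
      h' ▸ mem_image_of_mem _ ⟨(le_max_right _ _).trans_lt hx, hx'⟩
    rw [h, h', connectedComponentIn_eq hmem, connectedComponentIn_eq hmem']
  have hinj' : ∀ e v v', IsEdgeBelow e v → IsEdgeBelow e v' → v = v' := by
    rintro _ ⟨v, i⟩ ⟨v', i'⟩ ⟨α, hα, rfl⟩ ⟨α', hα', h⟩
    obtain ⟨h1, h2⟩ := segment_inj hα hα' h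
    exact Prod.ext h1 h2
  have hend : ∀ e ∈ edges (boxUnion B), ∃ v, IsEdgeBelow e v ∧ (v ∈ convexEnds B ∨ v ∈ reflexEnds B) := by
    rintro _ ⟨p, hp, rfl⟩
    obtain ⟨i, hi⟩ := (mem_edgePoints_iff hB).1 hp
    obtain ⟨v, rfl, h1, h2, h3⟩ := exists_end_of_edge hB hi
    refine ⟨v, h3, ?_⟩
    rw [mem_convexEnds, mem_reflexEnds]
    exact hi.imp (fun h => ⟨h.congr_set h1, h2⟩) (fun h => ⟨h.congr_set h1, h2⟩)
  have hrefl : ∀ e ∈ reflexEdges (boxUnion B), ∃ v, IsEdgeBelow e v ∧ v ∈ reflexEnds B := by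
    rintro _ ⟨⟨p, hp, rfl⟩, hr⟩
    obtain ⟨i, hi⟩ := hr p (mem_connectedComponentIn hp)
    have hi' : IsReflexWedge i (oct B p) := (isReflexEdgePoint_iff hB).1 hi
    obtain ⟨v, rfl, h1, h2, h3⟩ := exists_end_of_edge hB (Or.inr hi')
    exact ⟨v, h3, mem_reflexEnds.2 ⟨hi'.congr_set h1, h2⟩⟩
  choose f hf hf' using hend
  choose g hg hg' using hrefl
  -- Since `ncard` vanishes on infinite sets, the lower bound on the number of edges requires
  -- finiteness. The value `0` off the edges is a dummy.
  have hfin : (edges (boxUnion B)).Finite := by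
    refine Set.Finite.of_injOn (f := fun e => if h : e ∈ edges (boxUnion B) then f e h else 0)
      (t := ↑(convexEnds B ∪ reflexEnds B)) ?_ ?_ (Finset.finite_toSet _)
    · intro e he
      simp only [he, dif_pos]
      exact Finset.mem_coe.2 (Finset.mem_union.2 (hf' e he))
    · intro e he e' he' hee
      simp only [he, he', dif_pos] at hee
      exact hinj e e' _ (hf e he) (hee ▸ hf e' he') he he'
  have hsub : reflexEdges (boxUnion B) ⊆ edges (boxUnion B) := fun e he => he.1
  constructor
  · rw [← Set.ncard_coe_finset]
    refine Set.ncard_le_ncard_of_injOn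
      (fun e => if h : e ∈ reflexEdges (boxUnion B) then g e h else 0) ?_ ?_ (Finset.finite_toSet _)
    · intro e he
      simp only [he, dif_pos]
      exact hg' e he
    · intro e he e' he' hee
      simp only [he, he', dif_pos] at hee
      exact hinj e e' _ (hg e he) (hee ▸ hg e' he') he.1 he'.1
  · have hc : ∀ v ∈ convexEnds B, ∃ e, e ∈ edges (boxUnion B) ∧ e ∉ reflexEdges (boxUnion B) ∧
        IsEdgeBelow e v := by
      intro v hv
      obtain ⟨h1, h2⟩ := mem_convexEnds.1 hv
      obtain ⟨p, α, hα, hlow, hp, hK⟩ := exists_edge_of_end hB (Or.inl h1) h2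
      refine ⟨_, ⟨p, hp, rfl⟩, fun hr => ?_, α, hα, hK⟩
      obtain ⟨i, hi⟩ := hr.2 p (mem_connectedComponentIn hp)
      have hi' : IsReflexWedge i (oct B p) := (isReflexEdgePoint_iff hB).1 hi
      have hpc : IsConvexWedge v.2 (oct B p) := h1.congr_set fun σ => (hlow σ).symm
      have hw : IsWedge v.2 (oct B p) := Or.inl hpc
      obtain rfl := (hw.eventually.self_of_nhds.1 i (Or.inr hi')).1
      exact not_isConvexWedge_and_isReflexWedge hpc hi'
    -- The edges below convex ends are distinct and not reflex, so they can be counted in addition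
    -- to the reflex edges.
    choose! h hh1 hh2 hh3 using hc
    rw [← Set.ncard_sdiff_add_ncard_of_subset hsub hfin, ← Set.ncard_coe_finset]
    refine Nat.add_le_add_right (Set.ncard_le_ncard_of_injOn (t := edges (boxUnion B) \
      reflexEdges (boxUnion B)) h (fun v hv => ⟨hh1 v hv, hh2 v hv⟩) ?_ hfin.sdiff) _
    intro v hv v' hv' hvv
    exact hinj' _ v v' (hh3 v hv) (hvv ▸ hh3 v' hv')

/-! ### Counting the upper ends of edges at a point -/

/-- The number of quadrants filled by a planar pattern. -/
def faceCount (F : Bool → Bool → Bool) : ℕ :=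
  (F false false).toNat + (F false true).toNat + (F true false).toNat + (F true true).toNat

/-- The weight of an upper end: `1` for a convex edge, `-3` for a reflex edge, given the patterns
below and above it. -/
def faceScore (F G : Bool → Bool → Bool) : ℤ :=
  if (F false false == G false false) && (F false true == G false true) &&
    (F true false == G true false) && (F true true == G true true) then 0
  else if faceCount F == 1 then 1 else if faceCount F == 3 then -3 else 0

/-- The total weight of the upper ends at a point with the pattern `f`. -/
def score (f : Bool → Bool → Bool → Bool) : ℤ :=
  faceScore (f false) (f true) + faceScore (fun x z => f x false z) (fun x z => f x true z) +
    faceScore (fun x y => f x y false) (fun x y => f x y true)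

/-- Across an edge the pattern is planar, with one filled quadrant for a convex edge and three for a
reflex one. Counting quadrants makes the local weight a computable function of eight Booleans, open
to `decide`. -/
theorem faceCount_eq_one_iff (F : Bool → Bool → Bool) :
    (∃ a b, ∀ y z, F y z = true ↔ y = a ∧ z = b) ↔ faceCount F = 1 := by
  revert F; decide

theorem faceCount_eq_three_iff (F : Bool → Bool → Bool) :
    (∃ a b, ∀ y z, F y z = true ↔ y = a ∨ z = b) ↔ faceCount F = 3 := by
  revert F; decide

theorem isConvexWedge_iff {l m n : Fin 3} (hlm : l ≠ m) (hln : l ≠ n) (hmn : m ≠ n)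
    {O : (Fin 3 → Bool) → Prop} {F : Bool → Bool → Bool} (h : ∀ σ, O σ ↔ F (σ m) (σ n) = true) :
    IsConvexWedge l O ↔ faceCount F = 1 := by
  rw [← faceCount_eq_one_iff]
  have key : ∀ (σ s : Fin 3 → Bool), (∀ j, j ≠ l → σ j = s j) ↔ σ m = s m ∧ σ n = s n := by
    intro σ s
    rw [fin3_forall hlm hln hmn]
    simp [hlm.symm, hln.symm]
  simp only [IsConvexWedge, key, h]
  constructor
  · rintro ⟨s, hs⟩
    refine ⟨s m, s n, fun y z => ?_⟩
    have := hs (tri l m true y z)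
    rwa [tri_snd hlm.symm, tri_trd hln.symm hmn.symm] at this
  · rintro ⟨a, b, hs⟩
    exact ⟨tri l m true a b, fun σ => by
      simpa [tri_snd hlm.symm, tri_trd hln.symm hmn.symm] using hs (σ m) (σ n)⟩

theorem isReflexWedge_iff {l m n : Fin 3} (hlm : l ≠ m) (hln : l ≠ n) (hmn : m ≠ n)
    {O : (Fin 3 → Bool) → Prop} {F : Bool → Bool → Bool} (h : ∀ σ, O σ ↔ F (σ m) (σ n) = true) :
    IsReflexWedge l O ↔ faceCount F = 3 := by
  rw [← faceCount_eq_three_iff]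
  have key : ∀ (σ s : Fin 3 → Bool), (∃ j, j ≠ l ∧ σ j = s j) ↔ σ m = s m ∨ σ n = s n := by
    intro σ s
    constructor
    · rintro ⟨j, hj, h⟩
      clear * - hj h hlm hln hmn
      rcases fin3_cases hlm hln hmn j with rfl | rfl | rfl
      · exact absurd rfl hj
      · exact Or.inl h
      · exact Or.inr h
    · rintro (h | h)
      · exact ⟨m, hlm.symm, h⟩
      · exact ⟨n, hln.symm, h⟩
  simp only [IsReflexWedge, key, h]
  constructor
  · rintro ⟨s, hs⟩
    refine ⟨s m, s n, fun y z => ?_⟩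
    have := hs (tri l m true y z)
    rwa [tri_snd hlm.symm, tri_trd hln.symm hmn.symm] at this
  · rintro ⟨a, b, hs⟩
    exact ⟨tri l m true a b, fun σ => by
      simpa [tri_snd hlm.symm, tri_trd hln.symm hmn.symm] using hs (σ m) (σ n)⟩

theorem isAsymmetric_iff {l m n : Fin 3} (hlm : l ≠ m) (hln : l ≠ n) (hmn : m ≠ n)
    {O : (Fin 3 → Bool) → Prop} {g : Bool → Bool → Bool → Bool}
    (h : ∀ σ, O σ ↔ g (σ l) (σ m) (σ n) = true) :
    IsAsymmetric l O ↔ ∃ y z, g false y z ≠ g true y z := by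
  simp only [IsAsymmetric, lowerHalf, h, Function.update_self, Function.update_of_ne hlm.symm,
    Function.update_of_ne hln.symm]
  constructor
  · rintro ⟨σ, hσ⟩
    refine ⟨σ m, σ n, fun he => hσ ?_⟩
    cases σ l <;> simp [he]
  · rintro ⟨y, z, hyz⟩
    refine ⟨tri l m true y z, fun he => hyz ?_⟩
    simp only [tri_fst, tri_snd hlm.symm, tri_trd hln.symm hmn.symm] at he
    exact (Bool.eq_iff_iff.2 he).symm

open Classical in
/-- The weight of the upper end of an edge in direction `l` at a point with the pattern `O`. -/
noncomputable def endScore (l : Fin 3) (O : (Fin 3 → Bool) → Prop) : ℤ :=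
  (if IsConvexWedge l (lowerHalf l O) ∧ IsAsymmetric l O then 1 else 0) -
    3 * (if IsReflexWedge l (lowerHalf l O) ∧ IsAsymmetric l O then 1 else 0)

theorem endScore_eq {l m n : Fin 3} (hlm : l ≠ m) (hln : l ≠ n) (hmn : m ≠ n)
    {O : (Fin 3 → Bool) → Prop} {g : Bool → Bool → Bool → Bool}
    (h : ∀ σ, O σ ↔ g (σ l) (σ m) (σ n) = true) :
    endScore l O = faceScore (g false) (g true) := by
  have hl : ∀ σ, lowerHalf l O σ ↔ g false (σ m) (σ n) = true := by
    intro σ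
    simp only [lowerHalf, h, Function.update_self, Function.update_of_ne hlm.symm,
      Function.update_of_ne hln.symm]
  simp only [endScore, isConvexWedge_iff hlm hln hmn hl, isReflexWedge_iff hlm hln hmn hl,
    isAsymmetric_iff hlm hln hmn h, faceScore]
  by_cases he : ∃ y z, g false y z ≠ g true y z
  · have h2 : ((g false false false == g true false false) && (g false false true == g true false true) &&
        (g false true false == g true true false) && (g false true true == g true true true)) = false := by
      by_contra hcon
      simp only [Bool.not_eq_false, Bool.and_eq_true, beq_iff_eq] at hcon
      obtain ⟨y, z, hyz⟩ := he
      cases y <;> cases z <;> tauto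
    rw [h2]
    simp only [he, and_true, beq_iff_eq]
    by_cases h1 : faceCount (g false) = 1
    · simp [h1]
    · by_cases h3 : faceCount (g false) = 3
      · simp [h3]
      · simp [h1, h3]
  · simp only [he, and_false, if_false]
    push Not at he
    simp [he]

theorem sum_endScore {i j k : Fin 3} (hij : i ≠ j) (hik : i ≠ k) (hjk : j ≠ k)
    {O : (Fin 3 → Bool) → Prop} {f : Bool → Bool → Bool → Bool}
    (h : ∀ σ, O σ ↔ f (σ i) (σ j) (σ k) = true) : ∑ l, endScore l O = score f := by
  rw [fin3_sum hij hik hjk, endScore_eq hij hik hjk h,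
    endScore_eq (g := fun y x z => f x y z) hij.symm hjk hik h,
    endScore_eq (g := fun z x y => f x y z) hik.symm hjk.symm hij h]
  rfl

/-- The local weights `1` and `-3` are chosen to add up to the right side, which is the total number
of edges minus four times that of reflex ones. -/
theorem sum_sum_endScore (B : Finset (Point × Point)) :
    ∑ v ∈ gridPoints B, ∑ l, endScore l (oct B v) =
      ((convexEnds B).card : ℤ) - 3 * ((reflexEnds B).card : ℤ) := by
  classical
  simp only [endScore, convexEnds, reflexEnds, ← Finset.sum_product', Finset.sum_sub_distrib,
    ← Finset.mul_sum, Finset.card_filter, Nat.cast_sum, Nat.cast_ite, Nat.cast_one, Nat.cast_zero]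

/-- The pattern at a point of the top (if `a`) of a box and of the bottom (if `b`) of another one;
the other arguments tell whether the sides `-` and `+` of the point are filled. -/
def touch (a xm xp ym yp b xm' xp' ym' yp' : Bool) : Bool → Bool → Bool → Bool := fun x y z =>
  bif z then b && (bif x then xp' else xm') && (bif y then yp' else ym')
  else a && (bif x then xp else xm) && (bif y then yp else ym)

/-- The number of upper ends at a point of the bottom of an isolated box. -/
def bottomScore (xm xp ym yp : Bool) : ℤ :=
  if (xm && xp) || (ym && yp) then 0 else (!xp).toNat + (!yp).toNat

/-- The number of upper ends at a point of the top of an isolated box. -/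
def topScore (xm xp ym yp : Bool) : ℤ :=
  if (xm && xp) || (ym && yp) then 0 else 1 + ((!xp).toNat + (!yp).toNat)

/-- The deviation caused by the contact of two boxes. -/
def contactScore (xm xp ym yp xm' xp' ym' yp' : Bool) : ℤ :=
  if ((xm && xm') && (xp && xp')) || ((ym && ym') && (yp && yp')) then 0
  else score (touch true xm xp ym yp true xm' xp' ym' yp') - topScore xm xp ym yp
    - bottomScore xm' xp' ym' yp'

theorem score_touch_none (xm xp ym yp xm' xp' ym' yp' : Bool) :
    score (touch false xm xp ym yp false xm' xp' ym' yp') = 0 := by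
  revert xm xp ym yp xm' xp' ym' yp'; decide

theorem score_touch_top (xm xp ym yp xm' xp' ym' yp' : Bool) (hx : (xm || xp) = true)
    (hy : (ym || yp) = true) :
    score (touch true xm xp ym yp false xm' xp' ym' yp') = topScore xm xp ym yp := by
  revert xm xp ym yp xm' xp' ym' yp'; decide

theorem score_touch_bottom (xm xp ym yp xm' xp' ym' yp' : Bool) (hx : (xm' || xp') = true)
    (hy : (ym' || yp') = true) :
    score (touch false xm xp ym yp true xm' xp' ym' yp') = bottomScore xm' xp' ym' yp' := by
  revert xm xp ym yp xm' xp' ym' yp'; decide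

/-- The content lies in the first case of `contactScore`: where both boxes run straight through in a
common direction there is no correction at all. This confines the corrections to the corners of the
contact rectangle. -/
theorem score_touch_both (xm xp ym yp xm' xp' ym' yp' : Bool)
    (hx : ((xm && xm') || (xp && xp')) = true) (hy : ((ym && ym') || (yp && yp')) = true) :
    score (touch true xm xp ym yp true xm' xp' ym' yp') =
      topScore xm xp ym yp + bottomScore xm' xp' ym' yp' +
        contactScore xm xp ym yp xm' xp' ym' yp' := by
  revert xm xp ym yp xm' xp' ym' yp'; decide

/-- The total deviation at the corners of a contact rectangle. The arguments tell, for each of its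
sides, whether the lower or the upper box (with a prime) extends beyond it. -/
theorem sum_contactScore (l r d u l' r' d' u' : Bool) (hl : (l && l') = false)
    (hr : (r && r') = false) (hd : (d && d') = false) (hu : (u && u') = false) :
    -12 - 4 * (if (l && r && d && u) || (l' && r' && d' && u') then 1 else 0) ≤
      contactScore l true d true l' true d' true + contactScore l true true u l' true true u' +
      contactScore true r d true true r' d' true + contactScore true r true u true r' true u' := by
  revert l r d u l' r' d' u'; decide

/-! ### Summation over the grid points -/

open Classical in
/-- The pairs of a box and a box on top of it that touch each other. -/
noncomputable def contacts (D : Finset (Point × Point)) (k : Fin 3) :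
    Finset ((Point × Point) × (Point × Point)) :=
  (D ×ˢ D).filter fun x => x.1.2 k = x.2.1 k ∧ (Icc x.1.1 x.1.2 ∩ Icc x.2.1 x.2.2).Nonempty

theorem mem_contacts {D : Finset (Point × Point)} {k : Fin 3} {c c' : Point × Point} :
    (c, c') ∈ contacts D k ↔
      c ∈ D ∧ c' ∈ D ∧ c.2 k = c'.1 k ∧ (Icc c.1 c.2 ∩ Icc c'.1 c'.2).Nonempty := by
  simp only [contacts, Finset.mem_filter, Finset.mem_product, and_assoc]

/-- The box `c` extends beyond `v` in the direction of `-` along the `l`-th axis. -/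
noncomputable def below (c : Point × Point) (v : Point) (l : Fin 3) : Bool := decide (c.1 l < v l)

/-- The box `c` extends beyond `v` in the direction of `+` along the `l`-th axis. -/
noncomputable def above (c : Point × Point) (v : Point) (l : Fin 3) : Bool := decide (v l < c.2 l)

theorem cOct_iff_bif {c : Point × Point} {v : Point} (hv : v ∈ Icc c.1 c.2) (l : Fin 3) (s : Bool) :
    cOct (c.1 l) (c.2 l) (v l) s ↔ (bif s then above c v l else below c v l) = true := by
  have h1 := hv.1 l
  have h2 := hv.2 l
  cases s <;> simp [cOct, above, below, h1, h2]

section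
variable {D : Finset (Point × Point)} {k : Fin 3}

/-- Every grid height bounds some box, and boxes with overlapping height ranges have equal ones. So
at a grid point a box is present only with its top or its bottom. -/
theorem IsDecomposition.eq_top_or_bottom (hD : IsDecomposition D k) {v : Point}
    (hv : v k ∈ grid D k) {c : Point × Point} (hc : c ∈ D) : ¬ (c.1 k < v k ∧ v k < c.2 k) := by
  rintro ⟨h1, h2⟩
  simp only [grid, Finset.mem_union, Finset.mem_image] at hv
  rcases hv with ⟨e, he, hev⟩ | ⟨e, he, hev⟩
  · have := hD.nondeg e he k
    have := (hD.slab c hc e he (by linarith) (by linarith)).1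
    linarith
  · have := hD.nondeg e he k
    have := (hD.slab c hc e he (by linarith) (by linarith)).2
    linarith

theorem IsDecomposition.eq_of_top (hD : IsDecomposition D k) {v : Point} {c c' : Point × Point}
    (hc : c ∈ D) (hc' : c' ∈ D) (hv : v ∈ Icc c.1 c.2) (hv' : v ∈ Icc c'.1 c'.2)
    (h : v k = c.2 k) (h' : v k = c'.2 k) : c = c' := by
  have h1 := hD.nondeg c hc k
  have h2 := hD.nondeg c' hc' k
  obtain ⟨h3, h4⟩ := hD.slab c hc c' hc' (by linarith) (by linarith)
  exact hD.eq_of_mem c hc c' hc' h3 h4 v hv hv'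

theorem IsDecomposition.eq_of_bottom (hD : IsDecomposition D k) {v : Point} {c c' : Point × Point}
    (hc : c ∈ D) (hc' : c' ∈ D) (hv : v ∈ Icc c.1 c.2) (hv' : v ∈ Icc c'.1 c'.2)
    (h : v k = c.1 k) (h' : v k = c'.1 k) : c = c' := by
  have h1 := hD.nondeg c hc k
  have h2 := hD.nondeg c' hc' k
  obtain ⟨h3, h4⟩ := hD.slab c hc c' hc' (by linarith) (by linarith)
  exact hD.eq_of_mem c hc c' hc' h3 h4 v hv hv'

theorem IsDecomposition.oct_of_false (hD : IsDecomposition D k) {i j : Fin 3} (hij : i ≠ j)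
    (hik : i ≠ k) (hjk : j ≠ k) {v : Point} (hv : v k ∈ grid D k) {σ : Fin 3 → Bool}
    (hσ : σ k = false) : oct D v σ ↔ ∃ c ∈ D, (v ∈ Icc c.1 c.2 ∧ v k = c.2 k) ∧
      (bif σ i then above c v i else below c v i) = true ∧
      (bif σ j then above c v j else below c v j) = true := by
  constructor
  · rintro ⟨c, hc, h⟩
    have hvc := h.mem
    refine ⟨c, hc, ⟨hvc, ?_⟩, (cOct_iff_bif hvc i _).1 (h i), (cOct_iff_bif hvc j _).1 (h j)⟩
    have h1 := (h k).2 hσ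
    exact h1.2.eq_or_lt.resolve_right fun h2 => hD.eq_top_or_bottom hv hc ⟨h1.1, h2⟩
  · rintro ⟨c, hc, ⟨hvc, hk⟩, h1, h2⟩
    refine ⟨c, hc, (fin3_forall hij hik hjk).2
      ⟨(cOct_iff_bif hvc i _).2 h1, (cOct_iff_bif hvc j _).2 h2, ?_⟩⟩
    have := hD.nondeg c hc k
    exact ⟨by simp [hσ], fun _ => ⟨by linarith, hk.le⟩⟩

theorem IsDecomposition.oct_of_true (hD : IsDecomposition D k) {i j : Fin 3} (hij : i ≠ j)
    (hik : i ≠ k) (hjk : j ≠ k) {v : Point} (hv : v k ∈ grid D k) {σ : Fin 3 → Bool}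
    (hσ : σ k = true) : oct D v σ ↔ ∃ c ∈ D, (v ∈ Icc c.1 c.2 ∧ v k = c.1 k) ∧
      (bif σ i then above c v i else below c v i) = true ∧
      (bif σ j then above c v j else below c v j) = true := by
  constructor
  · rintro ⟨c, hc, h⟩
    have hvc := h.mem
    refine ⟨c, hc, ⟨hvc, ?_⟩, (cOct_iff_bif hvc i _).1 (h i), (cOct_iff_bif hvc j _).1 (h j)⟩
    have h1 := (h k).1 hσ
    exact (h1.1.eq_or_lt.resolve_right fun h2 => hD.eq_top_or_bottom hv hc ⟨h2, h1.2⟩).symm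
  · rintro ⟨c, hc, ⟨hvc, hk⟩, h1, h2⟩
    refine ⟨c, hc, (fin3_forall hij hik hjk).2
      ⟨(cOct_iff_bif hvc i _).2 h1, (cOct_iff_bif hvc j _).2 h2, ?_⟩⟩
    have := hD.nondeg c hc k
    exact ⟨fun _ => ⟨hk.ge, by linarith⟩, by simp [hσ]⟩

open Classical in
/-- The contribution of the top of a box. -/
noncomputable def boxTop (i j k : Fin 3) (c : Point × Point) (v : Point) : ℤ :=
  if v ∈ Icc c.1 c.2 ∧ v k = c.2 k then
    topScore (below c v i) (above c v i) (below c v j) (above c v j) else 0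

open Classical in
/-- The contribution of the bottom of a box. -/
noncomputable def boxBottom (i j k : Fin 3) (c : Point × Point) (v : Point) : ℤ :=
  if v ∈ Icc c.1 c.2 ∧ v k = c.1 k then
    bottomScore (below c v i) (above c v i) (below c v j) (above c v j) else 0

open Classical in
/-- The contribution of a contact. -/
noncomputable def boxContact (i j : Fin 3) (c c' : Point × Point) (v : Point) : ℤ :=
  if v ∈ Icc c.1 c.2 ∧ v ∈ Icc c'.1 c'.2 then
    contactScore (below c v i) (above c v i) (below c v j) (above c v j)
      (below c' v i) (above c' v i) (below c' v j) (above c' v j) else 0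

theorem below_or_above {c : Point × Point} {v : Point} {l : Fin 3} (h : c.1 l < c.2 l) :
    (below c v l || above c v l) = true := by
  simp only [below, above, Bool.or_eq_true, decide_eq_true_eq]
  exact (lt_or_ge (c.1 l) (v l)).imp_right fun h' => h'.trans_lt h

theorem common_side {c c' : Point × Point} {v : Point} {l : Fin 3} (hv : v ∈ Icc c.1 c.2)
    (hv' : v ∈ Icc c'.1 c'.2) (h1 : c.1 l < c.2 l) (h2 : c'.1 l < c'.2 l)
    (h3 : c.1 l < c'.2 l) (h4 : c'.1 l < c.2 l) :
    ((below c v l && below c' v l) || (above c v l && above c' v l)) = true := by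
  have := hv.1 l
  have := hv.2 l
  have := hv'.1 l
  have := hv'.2 l
  simp only [below, above, Bool.or_eq_true, Bool.and_eq_true, decide_eq_true_eq]
  by_contra hcon
  grind

/-- At most one box has its top at `v` and at most one its bottom, so each sum has at most one
nonzero term and the pattern is a `touch`. The four cases of presence correspond to the four
evaluations of `score`. -/
theorem IsDecomposition.sum_endScore (hD : IsDecomposition D k) {i j : Fin 3} (hij : i ≠ j)
    (hik : i ≠ k) (hjk : j ≠ k) {v : Point} (hv : v k ∈ grid D k) :
    ∑ l, endScore l (oct D v) = (∑ c ∈ D, boxTop i j k c v) + (∑ c ∈ D, boxBottom i j k c v) +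
      ∑ x ∈ contacts D k, boxContact i j x.1 x.2 v := by
  classical
  have hTop : ∀ c ∈ D, v ∈ Icc c.1 c.2 ∧ v k = c.2 k → ∑ c ∈ D, boxTop i j k c v =
      topScore (below c v i) (above c v i) (below c v j) (above c v j) := by
    intro c hc h
    rw [Finset.sum_eq_single_of_mem c hc, boxTop, if_pos h]
    intro e he hne
    rw [boxTop, if_neg]
    exact fun h' => hne (hD.eq_of_top he hc h'.1 h.1 h'.2 h.2)
  have hBot : ∀ c ∈ D, v ∈ Icc c.1 c.2 ∧ v k = c.1 k → ∑ c ∈ D, boxBottom i j k c v =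
      bottomScore (below c v i) (above c v i) (below c v j) (above c v j) := by
    intro c hc h
    rw [Finset.sum_eq_single_of_mem c hc, boxBottom, if_pos h]
    intro e he hne
    rw [boxBottom, if_neg]
    exact fun h' => hne (hD.eq_of_bottom he hc h'.1 h.1 h'.2 h.2)
  have hk : ∀ c c' : Point × Point, c.2 k = c'.1 k → v ∈ Icc c.1 c.2 → v ∈ Icc c'.1 c'.2 →
      v k = c.2 k ∧ v k = c'.1 k := by
    intro c c' h h1 h2
    have := h1.2 k
    have := h2.1 k
    constructor <;> linarith
  by_cases hA : ∃ c ∈ D, v ∈ Icc c.1 c.2 ∧ v k = c.2 k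
  · obtain ⟨c, hc, hA⟩ := hA
    have hcn := hD.nondeg c hc
    have hlow : ∀ σ : Fin 3 → Bool, σ k = false → (oct D v σ ↔
        (bif σ i then above c v i else below c v i) = true ∧
        (bif σ j then above c v j else below c v j) = true) := by
      intro σ hσ
      rw [hD.oct_of_false hij hik hjk hv hσ]
      constructor
      · rintro ⟨e, he, he', h⟩
        rwa [← hD.eq_of_top he hc he'.1 hA.1 he'.2 hA.2]
      · exact fun h => ⟨c, hc, hA, h⟩
    by_cases hB : ∃ c ∈ D, v ∈ Icc c.1 c.2 ∧ v k = c.1 k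
    · obtain ⟨c', hc', hB⟩ := hB
      have hcn' := hD.nondeg c' hc'
      have hcc : c.2 k = c'.1 k := by rw [← hA.2, hB.2]
      have hov := hD.overlap c hc c' hc' hcc v hA.1 hB.1
      have hcon : ∑ x ∈ contacts D k, boxContact i j x.1 x.2 v = boxContact i j c c' v := by
        rw [Finset.sum_eq_single_of_mem (c, c')
          (mem_contacts.2 ⟨hc, hc', hcc, v, hA.1, hB.1⟩)]
        rintro ⟨e, e'⟩ hee hne
        obtain ⟨he, he', hek, -⟩ := mem_contacts.1 hee
        rw [boxContact, if_neg]
        rintro ⟨h1, h2⟩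
        obtain ⟨h3, h4⟩ := hk e e' hek h1 h2
        exact hne (Prod.ext (hD.eq_of_top he hc h1 hA.1 h3 hA.2)
          (hD.eq_of_bottom he' hc' h2 hB.1 h4 hB.2))
      rw [hTop c hc hA, hBot c' hc' hB, hcon, boxContact, if_pos ⟨hA.1, hB.1⟩,
        OrthoPoly.sum_endScore hij hik hjk (f := touch true (below c v i) (above c v i)
          (below c v j) (above c v j) true (below c' v i) (above c' v i) (below c' v j)
          (above c' v j))]
      · exact score_touch_both _ _ _ _ _ _ _ _
          (common_side hA.1 hB.1 (hcn i) (hcn' i) (hov i hik).1 (hov i hik).2)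
          (common_side hA.1 hB.1 (hcn j) (hcn' j) (hov j hjk).1 (hov j hjk).2)
      · intro σ
        cases hσ : σ k
        · rw [hlow σ hσ]; simp [touch]
        · rw [hD.oct_of_true hij hik hjk hv hσ]
          simp only [touch, cond_true, Bool.true_and, Bool.and_eq_true]
          constructor
          · rintro ⟨e, he, he', h⟩
            rwa [← hD.eq_of_bottom he hc' he'.1 hB.1 he'.2 hB.2]
          · exact fun h => ⟨c', hc', hB, h⟩
    · have h0 : ∑ c ∈ D, boxBottom i j k c v = 0 := Finset.sum_eq_zero fun e he => by
        rw [boxBottom, if_neg fun h => hB ⟨e, he, h⟩]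
      have h1 : ∑ x ∈ contacts D k, boxContact i j x.1 x.2 v = 0 := by
        refine Finset.sum_eq_zero fun x hx => ?_
        obtain ⟨-, he', hek, -⟩ := mem_contacts.1 hx
        rw [boxContact, if_neg]
        exact fun h => hB ⟨x.2, he', h.2, (hk _ _ hek h.1 h.2).2⟩
      -- The upper box is absent, and the last four arguments of `touch` are dummies.
      rw [hTop c hc hA, h0, h1, add_zero, add_zero,
        OrthoPoly.sum_endScore hij hik hjk (f := touch true (below c v i) (above c v i)
          (below c v j) (above c v j) false true true true true)]
      · exact score_touch_top _ _ _ _ _ _ _ _ (below_or_above (hcn i)) (below_or_above (hcn j))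
      · intro σ
        cases hσ : σ k
        · rw [hlow σ hσ]; simp [touch]
        · rw [hD.oct_of_true hij hik hjk hv hσ]
          simp only [touch, cond_true, Bool.false_and, Bool.false_eq_true, iff_false]
          rintro ⟨e, he, he', -⟩
          exact hB ⟨e, he, he'⟩
  · have h0 : ∑ c ∈ D, boxTop i j k c v = 0 := Finset.sum_eq_zero fun e he => by
      rw [boxTop, if_neg fun h => hA ⟨e, he, h⟩]
    have h1 : ∑ x ∈ contacts D k, boxContact i j x.1 x.2 v = 0 := by
      refine Finset.sum_eq_zero fun x hx => ?_
      obtain ⟨he, -, hek, -⟩ := mem_contacts.1 hx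
      rw [boxContact, if_neg]
      exact fun h => hA ⟨x.1, he, h.1, (hk _ _ hek h.1 h.2).1⟩
    have hlow : ∀ σ : Fin 3 → Bool, σ k = false → ¬ oct D v σ := by
      intro σ hσ
      rw [hD.oct_of_false hij hik hjk hv hσ]
      rintro ⟨e, he, he', -⟩
      exact hA ⟨e, he, he'⟩
    by_cases hB : ∃ c ∈ D, v ∈ Icc c.1 c.2 ∧ v k = c.1 k
    · obtain ⟨c', hc', hB⟩ := hB
      have hcn' := hD.nondeg c' hc'
      rw [h0, h1, hBot c' hc' hB, add_zero, zero_add,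
        OrthoPoly.sum_endScore hij hik hjk (f := touch false true true true true
          true (below c' v i) (above c' v i) (below c' v j) (above c' v j))]
      · exact score_touch_bottom _ _ _ _ _ _ _ _ (below_or_above (hcn' i))
          (below_or_above (hcn' j))
      · intro σ
        cases hσ : σ k
        · simpa [touch] using hlow σ hσ
        · rw [hD.oct_of_true hij hik hjk hv hσ]
          simp only [touch, cond_true, Bool.true_and, Bool.and_eq_true]
          constructor
          · rintro ⟨e, he, he', h⟩
            rwa [← hD.eq_of_bottom he hc' he'.1 hB.1 he'.2 hB.2]
          · exact fun h => ⟨c', hc', hB, h⟩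
    · have h2 : ∑ c ∈ D, boxBottom i j k c v = 0 := Finset.sum_eq_zero fun e he => by
        rw [boxBottom, if_neg fun h => hB ⟨e, he, h⟩]
      rw [h0, h1, h2, OrthoPoly.sum_endScore hij hik hjk
        (f := touch false true true true true false true true true true)]
      · exact score_touch_none _ _ _ _ _ _ _ _
      · intro σ
        cases hσ : σ k
        · simpa [touch] using hlow σ hσ
        · rw [hD.oct_of_true hij hik hjk hv hσ]
          simp only [touch, cond_true, Bool.false_and, Bool.false_eq_true, iff_false]
          rintro ⟨e, he, he', -⟩
          exact hB ⟨e, he, he'⟩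

/-- The point with coordinates `i` and `j` chosen from given pairs. -/
def corner (i j : Fin 3) (x₀ x₁ y₀ y₁ z : ℝ) (s : Bool × Bool) : Point :=
  tri i j (bif s.1 then x₁ else x₀) (bif s.2 then y₁ else y₀) z

theorem corner_injective {i j : Fin 3} (hij : i ≠ j) {x₀ x₁ y₀ y₁ z : ℝ} (hx : x₀ ≠ x₁)
    (hy : y₀ ≠ y₁) : Function.Injective (corner i j x₀ x₁ y₀ y₁ z) := by
  rintro ⟨a, b⟩ ⟨a', b'⟩ h
  have h1 := congrFun h i
  have h2 := congrFun h j
  simp only [corner, tri_fst, tri_snd hij.symm] at h1 h2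
  cases a <;> cases a' <;> cases b <;> cases b' <;> simp_all

/-- A sum that is supported in the corners of a rectangle. -/
theorem sum_eq_sum_corner {i j : Fin 3} (hij : i ≠ j) {x₀ x₁ y₀ y₁ z : ℝ} (hx : x₀ ≠ x₁)
    (hy : y₀ ≠ y₁) {V : Finset Point} (hV : ∀ s, corner i j x₀ x₁ y₀ y₁ z s ∈ V)
    {F : Point → ℤ} (hF : ∀ v ∈ V, F v ≠ 0 → ∃ s, corner i j x₀ x₁ y₀ y₁ z s = v) :
    ∑ v ∈ V, F v = F (tri i j x₀ y₀ z) + F (tri i j x₀ y₁ z) + F (tri i j x₁ y₀ z) +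
      F (tri i j x₁ y₁ z) := by
  rw [← Finset.sum_of_injOn (s := Finset.univ) (f := fun s => F (corner i j x₀ x₁ y₀ y₁ z s))
    (corner i j x₀ x₁ y₀ y₁ z) ((corner_injective hij hx hy).injOn) (fun s _ => hV s) ?_
    (fun _ _ => rfl)]
  · rw [Fintype.sum_prod_type]
    simp only [Fintype.sum_bool, corner, cond_true, cond_false]
    ring
  · intro v hv hvs
    by_contra hne
    obtain ⟨s, hs⟩ := hF v hv hne
    exact hvs ⟨s, by simp, hs⟩

end

/-! ### Global contributions of the boxes and of the contacts -/

theorem eq_or_eq_of_not_below_and_above {c : Point × Point} {v : Point} {l : Fin 3}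
    (hv : v ∈ Icc c.1 c.2) (h : (below c v l && above c v l) = false) : v l = c.1 l ∨ v l = c.2 l := by
  have h1 := hv.1 l
  have h2 := hv.2 l
  simp only [below, above, Bool.and_eq_false_iff, decide_eq_false_iff_not, not_lt] at h
  exact h.imp (fun h => le_antisymm h h1) (fun h => le_antisymm h2 h)

theorem tri_mem_Icc {i j k : Fin 3} (hij : i ≠ j) (hik : i ≠ k) (hjk : j ≠ k)
    {c : Point × Point} {x y z : ℝ} : (tri i j x y z : Point) ∈ Icc c.1 c.2 ↔
      x ∈ Icc (c.1 i) (c.2 i) ∧ y ∈ Icc (c.1 j) (c.2 j) ∧ z ∈ Icc (c.1 k) (c.2 k) := by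
  simp only [mem_Icc, Pi.le_def, fin3_forall hij hik hjk, tri_fst, tri_snd hij.symm,
    tri_trd hik.symm hjk.symm]
  tauto

section
variable {D : Finset (Point × Point)} {k : Fin 3}

theorem tri_mem_gridPoints {i j : Fin 3} (hij : i ≠ j) (hik : i ≠ k) (hjk : j ≠ k) {x y z : ℝ} :
    (tri i j x y z : Point) ∈ gridPoints D ↔ x ∈ grid D i ∧ y ∈ grid D j ∧ z ∈ grid D k := by
  simp only [gridPoints, Fintype.mem_piFinset, fin3_forall hij hik hjk, tri_fst, tri_snd hij.symm,
    tri_trd hik.symm hjk.symm]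

theorem eq_tri_of_eq {i j : Fin 3} (hij : i ≠ j) (hik : i ≠ k) (hjk : j ≠ k)
    {v : Point} {x₀ x₁ y₀ y₁ z : ℝ} (hx : v i = x₀ ∨ v i = x₁) (hy : v j = y₀ ∨ v j = y₁)
    (hz : v k = z) : ∃ s, corner i j x₀ x₁ y₀ y₁ z s = v := by
  have key : ∀ a b : ℝ, v i = a → v j = b → tri i j a b z = v := by
    rintro a b rfl rfl
    rw [← hz, tri_eta hij hik hjk]
  rcases hx with hx | hx <;> rcases hy with hy | hy
  · exact ⟨(false, false), key _ _ hx hy⟩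
  · exact ⟨(false, true), key _ _ hx hy⟩
  · exact ⟨(true, false), key _ _ hx hy⟩
  · exact ⟨(true, true), key _ _ hx hy⟩

/-- The corners of the top face carry the upper ends of the four vertical edges and of the four
edges of that face. The remaining four edges of the box are those of
`IsDecomposition.sum_boxBottom`. -/
theorem IsDecomposition.sum_boxTop (hD : IsDecomposition D k) {i j : Fin 3} (hij : i ≠ j)
    (hik : i ≠ k) (hjk : j ≠ k) {c : Point × Point} (hc : c ∈ D) :
    ∑ v ∈ gridPoints D, boxTop i j k c v = 8 := by
  have hi := hD.nondeg c hc i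
  have hj := hD.nondeg c hc j
  have hk := hD.nondeg c hc k
  rw [sum_eq_sum_corner hij hi.ne hj.ne (z := c.2 k)]
  · simp only [boxTop, tri_mem_Icc hij hik hjk, tri_trd hik.symm hjk.symm, below, above, tri_fst,
      tri_snd hij.symm, left_mem_Icc, right_mem_Icc, hi.le, hj.le, hk.le, and_self, if_true,
      lt_self_iff_false, hi, hj]
    decide
  · rintro ⟨a, b⟩
    rw [corner, tri_mem_gridPoints hij hik hjk]
    refine ⟨?_, ?_, snd_mem_grid hc k⟩
    · cases a
      exacts [fst_mem_grid hc i, snd_mem_grid hc i]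
    · cases b
      exacts [fst_mem_grid hc j, snd_mem_grid hc j]
  · intro v _ hv
    rw [boxTop] at hv
    split_ifs at hv with h
    · rw [topScore] at hv
      split_ifs at hv with h'
      · exact absurd rfl hv
      · simp only [Bool.or_eq_true, not_or, Bool.not_eq_true] at h'
        exact eq_tri_of_eq hij hik hjk (eq_or_eq_of_not_below_and_above h.1 h'.1)
          (eq_or_eq_of_not_below_and_above h.1 h'.2) h.2
    · exact absurd rfl hv

theorem IsDecomposition.sum_boxBottom (hD : IsDecomposition D k) {i j : Fin 3} (hij : i ≠ j)
    (hik : i ≠ k) (hjk : j ≠ k) {c : Point × Point} (hc : c ∈ D) :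
    ∑ v ∈ gridPoints D, boxBottom i j k c v = 4 := by
  have hi := hD.nondeg c hc i
  have hj := hD.nondeg c hc j
  have hk := hD.nondeg c hc k
  rw [sum_eq_sum_corner hij hi.ne hj.ne (z := c.1 k)]
  · simp only [boxBottom, tri_mem_Icc hij hik hjk, tri_trd hik.symm hjk.symm, below, above, tri_fst,
      tri_snd hij.symm, left_mem_Icc, right_mem_Icc, hi.le, hj.le, hk.le, and_self, if_true,
      lt_self_iff_false, hi, hj]
    decide
  · rintro ⟨a, b⟩
    rw [corner, tri_mem_gridPoints hij hik hjk]
    refine ⟨?_, ?_, fst_mem_grid hc k⟩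
    · cases a
      exacts [fst_mem_grid hc i, snd_mem_grid hc i]
    · cases b
      exacts [fst_mem_grid hc j, snd_mem_grid hc j]
  · intro v _ hv
    rw [boxBottom] at hv
    split_ifs at hv with h
    · rw [bottomScore] at hv
      split_ifs at hv with h'
      · exact absurd rfl hv
      · simp only [Bool.or_eq_true, not_or, Bool.not_eq_true] at h'
        exact eq_tri_of_eq hij hik hjk (eq_or_eq_of_not_below_and_above h.1 h'.1)
          (eq_or_eq_of_not_below_and_above h.1 h'.2) h.2
    · exact absurd rfl hv

/-- One of the boxes is strictly narrower than the other one on all four sides. -/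
def IsCollarPair (k : Fin 3) (x : (Point × Point) × (Point × Point)) : Prop :=
  IsNarrower k x.2.1 x.2.2 x.1.1 x.1.2 ∨ IsNarrower k x.1.1 x.1.2 x.2.1 x.2.2

theorem isNarrower_iff {i j : Fin 3} (hij : i ≠ j) (hik : i ≠ k) (hjk : j ≠ k) {a b a' b' : Point} :
    IsNarrower k a b a' b' ↔ (a' i < a i ∧ b i < b' i) ∧ (a' j < a j ∧ b j < b' j) := by
  rw [IsNarrower, fin3_forall hij hik hjk]
  simp [hik, hjk]

theorem max_mem_or {a b : ℝ} {G : Finset ℝ} (ha : a ∈ G) (hb : b ∈ G) : max a b ∈ G := by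
  rcases max_choice a b with h | h <;> rwa [h]

theorem min_mem_or {a b : ℝ} {G : Finset ℝ} (ha : a ∈ G) (hb : b ∈ G) : min a b ∈ G := by
  rcases min_choice a b with h | h <;> rwa [h]

theorem eq_max_or_eq_min {c c' : Point × Point} {v : Point} {l : Fin 3}
    (hv : v ∈ Icc c.1 c.2) (hv' : v ∈ Icc c'.1 c'.2)
    (h : ((below c v l && below c' v l) && (above c v l && above c' v l)) = false) :
    v l = max (c.1 l) (c'.1 l) ∨ v l = min (c.2 l) (c'.2 l) := by
  have h1 := max_le (hv.1 l) (hv'.1 l)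
  have h2 := le_min (hv.2 l) (hv'.2 l)
  by_contra hcon
  push Not at hcon
  have h3 := max_lt_iff.1 (lt_of_le_of_ne h1 hcon.1.symm)
  have h4 := lt_min_iff.1 (lt_of_le_of_ne h2 hcon.2)
  simp [below, above, h3, h4] at h

-- The correction is supported in the four corners of the contact rectangle. Its values there depend
-- only on which of the two boxes, if any, extends beyond each of the four sides, which leaves the
-- finite check in `sum_contactScore`.
open Classical in
theorem IsDecomposition.sum_boxContact (hD : IsDecomposition D k) {i j : Fin 3} (hij : i ≠ j)
    (hik : i ≠ k) (hjk : j ≠ k) {x : (Point × Point) × (Point × Point)} (hx : x ∈ contacts D k) :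
    -12 - 4 * (if IsCollarPair k x then 1 else 0) ≤
      ∑ v ∈ gridPoints D, boxContact i j x.1 x.2 v := by
  obtain ⟨c, c'⟩ := x
  obtain ⟨hc, hc', hcc, w, hw, hw'⟩ := mem_contacts.1 hx
  have hov := hD.overlap c hc c' hc' hcc w hw hw'
  have hi := hD.nondeg c hc i
  have hj := hD.nondeg c hc j
  have hk := hD.nondeg c hc k
  have hi' := hD.nondeg c' hc' i
  have hj' := hD.nondeg c' hc' j
  have hk' := hD.nondeg c' hc' k
  have hoi := hov i hik
  have hoj := hov j hjk
  have hX : max (c.1 i) (c'.1 i) < min (c.2 i) (c'.2 i) := by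
    simp [hi, hi', hoi.1, hoi.2]
  have hY : max (c.1 j) (c'.1 j) < min (c.2 j) (c'.2 j) := by
    simp [hj, hj', hoj.1, hoj.2]
  rw [sum_eq_sum_corner hij hX.ne hY.ne (z := c.2 k)]
  · have hz : c.2 k ∈ Icc (c.1 k) (c.2 k) := ⟨hk.le, le_rfl⟩
    have hz' : c.2 k ∈ Icc (c'.1 k) (c'.2 k) := ⟨hcc.ge, hcc.le.trans hk'.le⟩
    have hmem : ∀ l, c.1 l < c.2 l → c'.1 l < c'.2 l → c.1 l < c'.2 l → c'.1 l < c.2 l →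
        (max (c.1 l) (c'.1 l) ∈ Icc (c.1 l) (c.2 l) ∧ max (c.1 l) (c'.1 l) ∈ Icc (c'.1 l) (c'.2 l)) ∧
        min (c.2 l) (c'.2 l) ∈ Icc (c.1 l) (c.2 l) ∧
        min (c.2 l) (c'.2 l) ∈ Icc (c'.1 l) (c'.2 l) := by
      intro l h1 h2 h3 h4
      simp [h1.le, h2.le, h3.le, h4.le]
    have hmi := hmem i hi hi' hoi.1 hoi.2
    have hmj := hmem j hj hj' hoj.1 hoj.2
    simp only [boxContact, tri_mem_Icc hij hik hjk, hmi, hmj, hz, hz', and_self, if_true, below,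
      above, tri_fst, tri_snd hij.symm, lt_max_iff, max_lt_iff, lt_min_iff, min_lt_iff,
      lt_self_iff_false, false_or, or_false, hi, hj, hi', hj', hoi, hoj, decide_true]
    have hcol : IsCollarPair k (c, c') ↔
        ((decide (c.1 i < c'.1 i) && decide (c'.2 i < c.2 i) && decide (c.1 j < c'.1 j) &&
          decide (c'.2 j < c.2 j)) ||
        (decide (c'.1 i < c.1 i) && decide (c.2 i < c'.2 i) && decide (c'.1 j < c.1 j) &&
          decide (c.2 j < c'.2 j))) = true := by
      simp only [IsCollarPair, isNarrower_iff hij hik hjk, Bool.or_eq_true, Bool.and_eq_true,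
        decide_eq_true_eq, and_assoc]
    have key := sum_contactScore (decide (c.1 i < c'.1 i)) (decide (c'.2 i < c.2 i))
      (decide (c.1 j < c'.1 j)) (decide (c'.2 j < c.2 j)) (decide (c'.1 i < c.1 i))
      (decide (c.2 i < c'.2 i)) (decide (c'.1 j < c.1 j)) (decide (c.2 j < c'.2 j))
      (by simpa using le_of_lt) (by simpa using le_of_lt) (by simpa using le_of_lt)
      (by simpa using le_of_lt)
    simp only [← hcol] at key
    convert key using 3
  · rintro ⟨a, b⟩
    rw [corner, tri_mem_gridPoints hij hik hjk]
    refine ⟨?_, ?_, snd_mem_grid hc k⟩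
    · cases a
      exacts [max_mem_or (fst_mem_grid hc i) (fst_mem_grid hc' i),
        min_mem_or (snd_mem_grid hc i) (snd_mem_grid hc' i)]
    · cases b
      exacts [max_mem_or (fst_mem_grid hc j) (fst_mem_grid hc' j),
        min_mem_or (snd_mem_grid hc j) (snd_mem_grid hc' j)]
  · intro v _ hv
    rw [boxContact] at hv
    split_ifs at hv with h
    · rw [contactScore] at hv
      split_ifs at hv with h'
      · exact absurd rfl hv
      · simp only [Bool.or_eq_true, not_or, Bool.not_eq_true] at h'
        refine eq_tri_of_eq hij hik hjk (eq_max_or_eq_min h.1 h.2 h'.1)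
          (eq_max_or_eq_min h.1 h.2 h'.2) ?_
        have h1 := h.1.2 k
        have h2 := h.2.1 k
        exact le_antisymm h1 (hcc.trans_le h2)
    · exact absurd rfl hv

open Classical in
/-- The count of the ends of edges in terms of the boxes and of their contacts. -/
theorem IsDecomposition.card_ends_ge (hD : IsDecomposition D k) :
    12 * (D.card : ℤ) - 12 * ((contacts D k).card : ℤ) -
      4 * (((contacts D k).filter (IsCollarPair k)).card : ℤ) ≤
      ((convexEnds D).card : ℤ) - 3 * ((reflexEnds D).card : ℤ) := by
  obtain ⟨i, j, hij, hik, hjk⟩ := exists_others k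
  have h1 : ∑ v ∈ gridPoints D, ∑ l, endScore l (oct D v) = ∑ v ∈ gridPoints D,
      ((∑ c ∈ D, boxTop i j k c v) + (∑ c ∈ D, boxBottom i j k c v) +
      ∑ x ∈ contacts D k, boxContact i j x.1 x.2 v) :=
    Finset.sum_congr rfl fun v hv => hD.sum_endScore hij hik hjk (Fintype.mem_piFinset.1 hv k)
  rw [← sum_sum_endScore, h1, Finset.sum_add_distrib, Finset.sum_add_distrib,
    Finset.sum_comm, Finset.sum_comm (s := gridPoints D) (t := D),
    Finset.sum_comm (s := gridPoints D) (t := contacts D k),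
    Finset.sum_congr rfl fun c hc => hD.sum_boxTop hij hik hjk hc,
    Finset.sum_congr rfl fun c hc => hD.sum_boxBottom hij hik hjk hc]
  have h2 := Finset.sum_le_sum fun x hx => hD.sum_boxContact hij hik hjk (x := x) hx
  rw [Finset.sum_sub_distrib, ← Finset.mul_sum] at h2
  simp only [Finset.sum_const, nsmul_eq_mul, Finset.card_filter, Nat.cast_sum, Nat.cast_ite,
    Nat.cast_one, Nat.cast_zero] at h2 ⊢
  linarith

end

/-! ### Maximal bricks and collars -/

section
variable {D : Finset (Point × Point)} {k : Fin 3}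

theorem update_mem_Icc {c : Point × Point} {p : Point} (hp : p ∈ Icc c.1 c.2) {z : ℝ}
    (hz : c.1 k ≤ z ∧ z ≤ c.2 k) : Function.update p k z ∈ Icc c.1 c.2 :=
  ⟨le_update_iff.2 ⟨hz.1, fun j _ => hp.1 j⟩, update_le_iff.2 ⟨hz.2, fun j _ => hp.2 j⟩⟩

theorem IsDecomposition.eq_of_inside (hD : IsDecomposition D k) {c c' : Point × Point}
    (hc : c ∈ D) (hc' : c' ∈ D) {p : Point} (hp : p ∈ Icc c.1 c.2) (hp' : p ∈ Icc c'.1 c'.2)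
    (h1 : c.1 k < p k) (h2 : p k < c.2 k) : c = c' := by
  obtain ⟨h3, h4⟩ := hD.slab c hc c' hc' (h1.trans_le (hp'.2 k)) ((hp'.1 k).trans_lt h2)
  exact hD.eq_of_mem c hc c' hc' h3 h4 p hp hp'

/-- Strictly between its bottom and top, `c` is disjoint from the other boxes. These and `c` are
closed, so no connected part of the section leaves `c`. -/
theorem IsDecomposition.isSectionBox (hD : IsDecomposition D k) {c : Point × Point} (hc : c ∈ D) :
    IsSectionBox (boxUnion D) k c.1 c.2 := by
  refine ⟨hD.nondeg c hc, fun p hp h1 h2 => Subset.antisymm ?_ ?_⟩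
  · have hK := isPreconnected_connectedComponentIn (F := {q ∈ boxUnion D | q k = p k}) (x := p)
    have hKS := connectedComponentIn_subset {q ∈ boxUnion D | q k = p k} p
    have hpS : p ∈ {q ∈ boxUnion D | q k = p k} := ⟨mem_boxUnion.2 ⟨c, hc, hp⟩, rfl⟩
    rw [isPreconnected_closed_iff] at hK
    intro q hq
    refine ⟨?_, (hKS hq).2⟩
    by_contra hqc
    obtain ⟨z, hz, hzc, hz'⟩ := hK (Icc c.1 c.2) (boxUnion (D.erase c)) isClosed_Icc
      (isClosed_boxUnion _) (fun z hz => by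
        obtain ⟨e, he, hze⟩ := mem_boxUnion.1 (hKS hz).1
        by_cases hec : e = c
        · subst hec; exact Or.inl hze
        · exact Or.inr (mem_boxUnion.2 ⟨e, Finset.mem_erase.2 ⟨hec, he⟩, hze⟩))
      ⟨p, mem_connectedComponentIn hpS, hp⟩
      ⟨q, hq, by
        obtain ⟨e, he, hze⟩ := mem_boxUnion.1 (hKS hq).1
        refine mem_boxUnion.2 ⟨e, Finset.mem_erase.2 ⟨?_, he⟩, hze⟩
        rintro rfl
        exact hqc hze⟩
    obtain ⟨e, he, hze⟩ := mem_boxUnion.1 hz'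
    have hzk : z k = p k := (hKS hz).2
    exact (Finset.mem_erase.1 he).1 (hD.eq_of_inside hc (Finset.mem_erase.1 he).2 hzc hze
      (by rwa [hzk]) (by rwa [hzk])).symm
  · have hconv : Convex ℝ {q ∈ Icc c.1 c.2 | q k = p k} :=
      (convex_Icc c.1 c.2).inter ((convex_singleton (p k)).linear_preimage
        (LinearMap.proj (R := ℝ) (φ := fun _ : Fin 3 => ℝ) k))
    exact hconv.isPreconnected.subset_connectedComponentIn ⟨hp, rfl⟩
      fun q hq => ⟨mem_boxUnion.2 ⟨c, hc, hq.1⟩, hq.2⟩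

theorem le_of_section_subset {a b a' b' : Point} {z : ℝ} (hab : ∀ i, a i ≤ b i)
    (hz : a k ≤ z ∧ z ≤ b k) (h : {q ∈ Icc a b | q k = z} ⊆ {q ∈ Icc a' b' | q k = z}) {i : Fin 3}
    (hi : i ≠ k) : a' i ≤ a i ∧ b i ≤ b' i := by
  have h1 := h (show Function.update a k z ∈ {q ∈ Icc a b | q k = z} from
    ⟨update_mem_Icc (c := (a, b)) ⟨le_rfl, hab⟩ hz, by simp⟩)
  have h2 := h (show Function.update b k z ∈ {q ∈ Icc a b | q k = z} from
    ⟨update_mem_Icc (c := (a, b)) ⟨hab, le_rfl⟩ hz, by simp⟩)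
  exact ⟨by simpa [hi] using h1.1.1 i, by simpa [hi] using h2.1.2 i⟩

/-- Two section boxes with a common point strictly between their bottoms and tops have the same
horizontal section. -/
theorem IsSectionBox.eq_of_common {P : Set Point} {a b a' b' p : Point} (h : IsSectionBox P k a b)
    (h' : IsSectionBox P k a' b') (hp : p ∈ Icc a b) (hp' : p ∈ Icc a' b')
    (h1 : a k < p k) (h2 : p k < b k) (h3 : a' k < p k) (h4 : p k < b' k) :
    ∀ i, i ≠ k → a' i = a i ∧ b' i = b i := by
  have he := (h.2 p hp h1 h2).symm.trans (h'.2 p hp' h3 h4)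
  intro i hi
  have e1 := le_of_section_subset (fun i => (h.1 i).le) ⟨h1.le, h2.le⟩ he.subset hi
  have e2 := le_of_section_subset (fun i => (h'.1 i).le) ⟨h3.le, h4.le⟩ he.symm.subset hi
  exact ⟨le_antisymm e1.1 e2.1, le_antisymm e2.2 e1.2⟩

/-- At the height `z` the rectangle with corners `a` and `b` is a component of the section. -/
def IsSectionAt (P : Set Point) (k : Fin 3) (a b : Point) (z : ℝ) : Prop :=
  ∀ p : Point, (∀ i, i ≠ k → a i ≤ p i ∧ p i ≤ b i) → p k = z →
    connectedComponentIn {q ∈ P | q k = z} p = {q | (∀ i, i ≠ k → a i ≤ q i ∧ q i ≤ b i) ∧ q k = z}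

theorem mem_Icc_iff_of_ne {a b q : Point} : q ∈ Icc a b ↔
    (∀ i, i ≠ k → a i ≤ q i ∧ q i ≤ b i) ∧ a k ≤ q k ∧ q k ≤ b k := by
  simp only [mem_Icc, Pi.le_def]
  constructor
  · exact fun h => ⟨fun i _ => ⟨h.1 i, h.2 i⟩, h.1 k, h.2 k⟩
  · rintro ⟨h, hk⟩
    refine ⟨fun i => ?_, fun i => ?_⟩ <;> by_cases hi : i = k
    · exact hi ▸ hk.1
    · exact (h i hi).1
    · exact hi ▸ hk.2
    · exact (h i hi).2

theorem isSectionBox_iff {P : Set Point} {a b : Point} : IsSectionBox P k a b ↔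
    (∀ i, a i < b i) ∧ ∀ z ∈ Ioo (a k) (b k), IsSectionAt P k a b z := by
  refine and_congr_right fun _ => ⟨fun h z hz p hp hpz => ?_, fun h p hp h1 h2 => ?_⟩
  · have hpI : p ∈ Icc a b := mem_Icc_iff_of_ne.2 ⟨hp, hpz.symm ▸ ⟨hz.1.le, hz.2.le⟩⟩
    have := h p hpI (hpz.symm ▸ hz.1) (hpz.symm ▸ hz.2)
    rw [hpz] at this
    rw [this]
    ext q
    simp only [mem_ofPred, mem_Icc_iff_of_ne (k := k)]
    refine ⟨fun h => ⟨h.1.1, h.2⟩, fun h => ⟨⟨h.1, ?_⟩, h.2⟩⟩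
    rw [h.2]; exact ⟨hz.1.le, hz.2.le⟩
  · rw [h (p k) ⟨h1, h2⟩ p (mem_Icc_iff_of_ne.1 hp).1 rfl]
    ext q
    simp only [mem_ofPred, mem_Icc_iff_of_ne (k := k)]
    refine ⟨fun h => ⟨⟨h.1, ?_⟩, h.2⟩, fun h => ⟨h.1.1, h.2⟩⟩
    rw [h.2]; exact ⟨h1.le, h2.le⟩

theorem IsSectionAt.congr {P : Set Point} {a b a' b' : Point} {z : ℝ} (h : IsSectionAt P k a b z)
    (hab : ∀ i, i ≠ k → a' i = a i ∧ b' i = b i) : IsSectionAt P k a' b' z := by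
  have key : ∀ p : Point, (∀ i, i ≠ k → a' i ≤ p i ∧ p i ≤ b' i) ↔
      (∀ i, i ≠ k → a i ≤ p i ∧ p i ≤ b i) :=
    fun p => forall₂_congr fun i hi => by rw [(hab i hi).1, (hab i hi).2]
  intro p hp hpz
  rw [h p ((key p).1 hp) hpz]
  simp only [key]

theorem IsSectionAt.mem {P : Set Point} {a b : Point} {z : ℝ} (h : IsSectionAt P k a b z)
    (hab : ∀ i, a i < b i) : Function.update a k z ∈ P := by
  have h1 : ∀ i, i ≠ k → a i ≤ Function.update a k z i ∧ Function.update a k z i ≤ b i :=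
    fun i hi => by simp [hi, (hab i).le]
  have h2 := h _ h1 (by simp)
  have h3 : Function.update a k z ∈ connectedComponentIn {q ∈ P | q k = z} (Function.update a k z) := by
    rw [h2]; exact ⟨h1, by simp⟩
  exact (connectedComponentIn_subset _ _ h3).1

theorem isSectionBox_update {P : Set Point} {a b : Point} {s t : ℝ} (hst : s < t)
    (hab : ∀ i, a i < b i) (h : ∀ z ∈ Ioo s t, IsSectionAt P k a b z) :
    IsSectionBox P k (Function.update a k s) (Function.update b k t) := by
  rw [isSectionBox_iff]
  refine ⟨fun i => ?_, fun z hz => ?_⟩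
  · by_cases hi : i = k
    · subst hi; simpa using hst
    · simpa [hi] using hab i
  · simp only [Function.update_self] at hz
    exact (h z hz).congr fun i hi => by simp [hi]

theorem exists_bounds_of_isSectionAt (D : Finset (Point × Point)) {a b : Point}
    (hab : ∀ i, a i < b i) : ∃ m M : ℝ, ∀ z, IsSectionAt (boxUnion D) k a b z → m ≤ z ∧ z ≤ M := by
  obtain ⟨m, hm⟩ := (grid D k).finite_toSet.bddBelow
  obtain ⟨M, hM⟩ := (grid D k).finite_toSet.bddAbove
  refine ⟨m, M, fun z hz => ?_⟩
  obtain ⟨c, hc, h⟩ := mem_boxUnion.1 (hz.mem hab)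
  have h1 := h.1 k
  have h2 := h.2 k
  rw [Function.update_self] at h1 h2
  exact ⟨(hm (Finset.mem_coe.2 (fst_mem_grid hc k))).trans h1,
    h2.trans (hM (Finset.mem_coe.2 (snd_mem_grid hc k)))⟩

/-- Every section box with horizontal sides `a`, `b` is contained in a brick. -/
theorem exists_isBrick {P : Set Point} {a b : Point} (hab : IsSectionBox P k a b)
    (hbd : ∃ m M : ℝ, ∀ z, IsSectionAt P k a b z → m ≤ z ∧ z ≤ M) : ∃ s t, s ≤ a k ∧ b k ≤ t ∧
      IsBrick P k (Function.update a k s) (Function.update b k t) := by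
  obtain ⟨m, M, hbd⟩ := hbd
  obtain ⟨hn, hz⟩ := isSectionBox_iff.1 hab
  have hk := hn k
  -- The brick reaches from `sInf S` to `sSup T`, the extreme heights up to which the rectangle
  -- remains a component of the sections.
  set S : Set ℝ := {s | s < b k ∧ ∀ z ∈ Ioo s (b k), IsSectionAt P k a b z} with hS
  set T : Set ℝ := {t | a k < t ∧ ∀ z ∈ Ioo (a k) t, IsSectionAt P k a b z} with hT
  have haS : a k ∈ S := ⟨hk, hz⟩
  have hbT : b k ∈ T := ⟨hk, hz⟩
  have hSb : BddBelow S := by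
    refine ⟨min m (b k), fun s hs => ?_⟩
    by_contra hcon
    obtain ⟨z, hz1, hz2⟩ := exists_between (not_le.1 hcon)
    have := (hbd z (hs.2 z ⟨hz1, hz2.trans_le (min_le_right _ _)⟩)).1
    exact (hz2.trans_le (min_le_left _ _)).not_ge this
  have hTb : BddAbove T := by
    refine ⟨max M (a k), fun t ht => ?_⟩
    by_contra hcon
    obtain ⟨z, hz1, hz2⟩ := exists_between (not_le.1 hcon)
    have := (hbd z (ht.2 z ⟨(le_max_right _ _).trans_lt hz1, hz2⟩)).2
    exact ((le_max_left _ _).trans_lt hz1).not_ge this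
  have hs := csInf_le hSb haS
  have ht := le_csSup hTb hbT
  have hgood : ∀ z ∈ Ioo (sInf S) (sSup T), IsSectionAt P k a b z := by
    intro z hz
    rcases lt_or_ge z (b k) with h | h
    · obtain ⟨s, hs, hsz⟩ := exists_lt_of_csInf_lt ⟨_, haS⟩ hz.1
      exact hs.2 z ⟨hsz, h⟩
    · obtain ⟨t, ht, hzt⟩ := exists_lt_of_lt_csSup ⟨_, hbT⟩ hz.2
      exact ht.2 z ⟨hk.trans_le h, hzt⟩
  have hlt : sInf S < sSup T := by linarith
  refine ⟨_, _, hs, ht, isSectionBox_update hlt hn hgood, fun a' b' h' hsub => ?_⟩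
  have hle := (Icc_subset_Icc_iff (update_le_update_iff.2 ⟨hlt.le, fun i _ => (hn i).le⟩)).1 hsub
  have hak : a' k ≤ sInf S := by simpa using hle.1 k
  have hbk : sSup T ≤ b' k := by simpa using hle.2 k
  -- a common point
  obtain ⟨z, hz1, hz2⟩ := exists_between hk
  have hp : Function.update a k z ∈ Icc a b :=
    update_mem_Icc (c := (a, b)) ⟨le_rfl, fun i => (hn i).le⟩ ⟨hz1.le, hz2.le⟩
  have hp' : Function.update a k z ∈ Icc a' b' := by
    apply hsub
    refine (mem_Icc_iff_of_ne (k := k)).2 ⟨fun i hi => by simp [hi, (hn i).le], ?_⟩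
    simp only [Function.update_self]
    constructor <;> linarith
  -- A larger section box has the same horizontal section, so its bottom and top lie in `S` and `T`
  -- and cannot exceed the extreme heights.
  have he := hab.eq_of_common h' hp hp' (by simpa using hz1) (by simpa using hz2)
    (by rw [Function.update_self]; linarith) (by rw [Function.update_self]; linarith)
  obtain ⟨hn', hz'⟩ := isSectionBox_iff.1 h'
  have haS' : a' k ∈ S := ⟨by linarith, fun z hz =>
    (hz' z ⟨hz.1, by linarith [hz.2]⟩).congr fun i hi => ⟨(he i hi).1.symm, (he i hi).2.symm⟩⟩
  have hbT' : b' k ∈ T := ⟨by linarith, fun z hz =>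
    (hz' z ⟨by linarith [hz.1], hz.2⟩).congr fun i hi => ⟨(he i hi).1.symm, (he i hi).2.symm⟩⟩
  constructor
  · rw [Function.eq_update_iff]
    exact ⟨le_antisymm hak (csInf_le hSb haS'), fun i hi => (he i hi).1⟩
  · rw [Function.eq_update_iff]
    exact ⟨le_antisymm (le_csSup hTb hbT') hbk, fun i hi => (he i hi).2⟩

/-- A brick contains every section box that it meets strictly between bottoms and tops. -/
theorem IsBrick.le_of_common {P : Set Point} {a b a' b' p : Point} (h : IsBrick P k a b)
    (h' : IsSectionBox P k a' b') (hp : p ∈ Icc a b) (hp' : p ∈ Icc a' b')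
    (h1 : a k < p k) (h2 : p k < b k) (h3 : a' k < p k) (h4 : p k < b' k) :
    (∀ i, i ≠ k → a' i = a i ∧ b' i = b i) ∧ a k ≤ a' k ∧ b' k ≤ b k := by
  have he := h.1.eq_of_common h' hp hp' h1 h2 h3 h4
  obtain ⟨hn, hz⟩ := isSectionBox_iff.1 h.1
  obtain ⟨hn', hz'⟩ := isSectionBox_iff.1 h'
  have hlt : min (a k) (a' k) < max (b k) (b' k) :=
    (min_le_left _ _).trans_lt ((hn k).trans_le (le_max_left _ _))
  -- Both height ranges contain `p k`, so their union is an interval and spans a section box. By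
  -- maximality of the brick it is not larger than the brick.
  have hbox := isSectionBox_update (P := P) hlt hn fun z hz1 => by
    have hz2 := min_lt_iff.1 hz1.1
    have hz3 := lt_max_iff.1 hz1.2
    have hcase : z ∈ Ioo (a k) (b k) ∨ z ∈ Ioo (a' k) (b' k) := by
      simp only [mem_Ioo]
      rcases lt_trichotomy z (p k) with h5 | h5 | h5
      · exact hz2.imp (fun h => ⟨h, by linarith⟩) (fun h => ⟨h, by linarith⟩)
      · left; constructor <;> linarith
      · exact hz3.imp (fun h => ⟨by linarith, h⟩) (fun h => ⟨by linarith, h⟩)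
    rcases hcase with h5 | h5
    · exact hz z h5
    · exact (hz' z h5).congr fun i hi => ⟨(he i hi).1.symm, (he i hi).2.symm⟩
  have := h.2 _ _ hbox (Icc_subset_Icc (update_le_iff.2 ⟨min_le_left _ _, fun _ _ => le_rfl⟩)
    (le_update_iff.2 ⟨le_max_left _ _, fun _ _ => le_rfl⟩))
  have h5 := congrFun this.1 k
  have h6 := congrFun this.2 k
  simp only [Function.update_self] at h5 h6
  exact ⟨he, min_eq_left_iff.1 h5, max_eq_left_iff.1 h6⟩

theorem eventually_gap (G : Finset ℝ) (a : ℝ) : ∀ᶠ z in 𝓝[>] a, ∀ g ∈ G, ¬ (a < g ∧ g ≤ z) := by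
  rw [Filter.eventually_all_finset]
  intro g _
  by_cases h : a < g
  · filter_upwards [Ioo_mem_nhdsGT h] with z hz hg
    exact hz.2.not_ge hg.2
  · exact Filter.Eventually.of_forall fun z hz => h hz.1

theorem eventually_gap' (G : Finset ℝ) (a : ℝ) : ∀ᶠ z in 𝓝[<] a, ∀ g ∈ G, ¬ (z ≤ g ∧ g < a) := by
  rw [Filter.eventually_all_finset]
  intro g _
  by_cases h : g < a
  · filter_upwards [Ioo_mem_nhdsLT h] with z hz hg
    exact hz.1.not_ge hg.1
  · exact Filter.Eventually.of_forall fun z hz => h hz.2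

/-- At a generic height just above its bottom, the brick contains a box of the decomposition with
the same section. The bottom of this box is a grid value, and as there are no grid values slightly
above the bottom of the brick, the two bottoms agree; likewise for the tops. This makes the collars
finite in number, so that their `ncard` is meaningful. -/
theorem IsDecomposition.isBrick_mem (hD : IsDecomposition D k) {a b : Point}
    (h : IsBrick (boxUnion D) k a b) : a ∈ gridPoints D ∧ b ∈ gridPoints D := by
  obtain ⟨hn, hz⟩ := isSectionBox_iff.1 h.1
  have hk := hn k
  have key : ∀ z ∈ Ioo (a k) (b k), z ∉ grid D k → ∃ c ∈ D, c.1 k < z ∧ z < c.2 k ∧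
      (∀ i, i ≠ k → c.1 i = a i ∧ c.2 i = b i) ∧ a k ≤ c.1 k ∧ c.2 k ≤ b k := by
    intro z hzz hzg
    obtain ⟨c, hc, hpc⟩ := mem_boxUnion.1 ((hz z hzz).mem hn)
    have h1 := hpc.1 k
    have h2 := hpc.2 k
    rw [Function.update_self] at h1 h2
    have h3 : c.1 k < z := lt_of_le_of_ne h1 fun h => hzg (h ▸ fst_mem_grid hc k)
    have h4 : z < c.2 k := lt_of_le_of_ne h2 fun h => hzg (h ▸ snd_mem_grid hc k)
    refine ⟨c, hc, h3, h4, h.le_of_common (hD.isSectionBox hc) (p := Function.update a k z)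
      (update_mem_Icc (c := (a, b)) ⟨le_rfl, fun i => (hn i).le⟩ ⟨hzz.1.le, hzz.2.le⟩) hpc ?_ ?_ ?_ ?_⟩
    · simpa using hzz.1
    · simpa using hzz.2
    · simpa using h3
    · simpa using h4
  simp only [gridPoints, Fintype.mem_piFinset]
  obtain ⟨z, hz1, hz2⟩ := ((eventually_gap (grid D k) (a k)).and (Ioo_mem_nhdsGT hk)).exists
  obtain ⟨c, hc, h1, h2, h3, h4, -⟩ := key z hz2 fun hg => hz1 z hg ⟨hz2.1, le_rfl⟩
  obtain ⟨z', hz1', hz2'⟩ := ((eventually_gap' (grid D k) (b k)).and (Ioo_mem_nhdsLT hk)).exists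
  obtain ⟨c', hc', h1', h2', -, -, h4'⟩ := key z' hz2' fun hg => hz1' z' hg ⟨le_rfl, hz2'.2⟩
  constructor <;> intro i <;> by_cases hi : i = k
  · subst hi
    rcases h4.eq_or_lt with h5 | h5
    · rw [h5]; exact fst_mem_grid hc i
    · exact absurd ⟨h5, h1.le⟩ (hz1 _ (fst_mem_grid hc i))
  · rw [← (h3 i hi).1]; exact fst_mem_grid hc i
  · subst hi
    rcases h4'.eq_or_lt with h5 | h5
    · rw [← h5]; exact snd_mem_grid hc' i
    · exact absurd ⟨h2'.le, h5⟩ (hz1' _ (snd_mem_grid hc' i))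
  · rw [← (h3 i hi).2]; exact snd_mem_grid hc i

theorem IsDecomposition.finite_collars (hD : IsDecomposition D k) :
    (collars (boxUnion D) k).Finite := by
  refine (((gridPoints D ×ˢ gridPoints D) ×ˢ (gridPoints D ×ˢ gridPoints D)).finite_toSet.image
    fun x => Icc x.1.1 x.1.2 ∩ Icc x.2.1 x.2.2).subset ?_
  rintro _ ⟨a, b, a', b', h, h', -, rfl, -⟩
  refine ⟨((a, b), (a', b')), ?_, rfl⟩
  simp only [Finset.coe_product, mem_prod, Finset.mem_coe]
  exact ⟨hD.isBrick_mem h, hD.isBrick_mem h'⟩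

-- Two boxes in collar position have different sections, so the maximal bricks around them cannot
-- pass through the plane of contact: the contact is one of bricks, along the same rectangle. The
-- rectangle determines the two boxes, since a point has at most one box ending there from below and
-- at most one starting above.
open Classical in
theorem IsDecomposition.card_collars (hD : IsDecomposition D k) :
    ((contacts D k).filter (IsCollarPair k)).card ≤ (collars (boxUnion D) k).ncard := by
  rw [← Set.ncard_coe_finset]
  refine Set.ncard_le_ncard_of_injOn (fun x => Icc x.1.1 x.1.2 ∩ Icc x.2.1 x.2.2) ?_ ?_
    hD.finite_collars
  · rintro ⟨c, c'⟩ hx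
    obtain ⟨hcc, hcol⟩ := Finset.mem_filter.1 (Finset.mem_coe.1 hx)
    obtain ⟨hc, hc', hk, w, hw, hw'⟩ := mem_contacts.1 hcc
    have hn := hD.nondeg c hc
    have hn' := hD.nondeg c' hc'
    obtain ⟨s, t, hs, ht, hb⟩ := exists_isBrick (hD.isSectionBox hc)
      (exists_bounds_of_isSectionAt D hn)
    obtain ⟨s', t', hs', ht', hb'⟩ := exists_isBrick (hD.isSectionBox hc')
      (exists_bounds_of_isSectionAt D hn')
    have hdiff : ¬ ∀ i, i ≠ k → c'.1 i = c.1 i ∧ c'.2 i = c.2 i := by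
      intro he
      obtain ⟨i, hi⟩ : ∃ i, i ≠ k := exists_ne k
      rcases hcol with h | h
      · have := (h i hi).1
        have := (he i hi).1
        simp only at *
        linarith
      · have := (h i hi).1
        have := (he i hi).1
        simp only at *
        linarith
    have hnk := hn k
    have hnk' := hn' k
    -- Otherwise the brick around `c` would meet the inside of `c'` just above `w`, and then `c'`
    -- would have the same section as `c`.
    have ht1 : t = c.2 k := by
      by_contra hne
      have hlt : c.2 k < t := lt_of_le_of_ne ht (Ne.symm hne)
      obtain ⟨z, hz1, hz2⟩ := exists_between (lt_min hlt (hk.trans_lt hnk'))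
      have hz3 := hz2.trans_le (min_le_left _ _)
      have hz4 := hz2.trans_le (min_le_right _ _)
      have h1 : Function.update w k z ∈ Icc (Function.update c.1 k s) (Function.update c.2 k t) := by
        refine (mem_Icc_iff_of_ne (k := k)).2 ⟨fun i hi => ?_, ?_⟩
        · simpa [hi] using ⟨hw.1 i, hw.2 i⟩
        · simp only [Function.update_self]
          constructor <;> linarith
      have := hb.le_of_common (hD.isSectionBox hc') h1 (update_mem_Icc hw' ⟨by linarith, hz4.le⟩)
        (by simp only [Function.update_self]; linarith) (by simp only [Function.update_self]; linarith)
        (by simp only [Function.update_self]; linarith) (by simp only [Function.update_self]; linarith)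
      exact hdiff fun i hi => by simpa [hi] using this.1 i hi
    have hs1 : s' = c'.1 k := by
      by_contra hne
      have hlt : s' < c'.1 k := lt_of_le_of_ne hs' hne
      obtain ⟨z, hz1, hz2⟩ := exists_between (max_lt hlt (hnk.trans_eq hk))
      have hz3 := (le_max_left _ _).trans_lt hz1
      have hz4 := (le_max_right _ _).trans_lt hz1
      have h1 : Function.update w k z ∈ Icc (Function.update c'.1 k s') (Function.update c'.2 k t') := by
        refine (mem_Icc_iff_of_ne (k := k)).2 ⟨fun i hi => ?_, ?_⟩
        · simpa [hi] using ⟨hw'.1 i, hw'.2 i⟩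
        · simp only [Function.update_self]
          constructor <;> linarith
      have := hb'.le_of_common (hD.isSectionBox hc) h1 (update_mem_Icc hw ⟨hz4.le, by linarith⟩)
        (by simp only [Function.update_self]; linarith) (by simp only [Function.update_self]; linarith)
        (by simp only [Function.update_self]; linarith) (by simp only [Function.update_self]; linarith)
      refine hdiff fun i hi => ?_
      have := this.1 i hi
      simp only [Function.update_of_ne hi] at this
      exact ⟨this.1.symm, this.2.symm⟩
    subst ht1 hs1
    rw [Function.update_eq_self] at hb hb'
    refine ⟨_, _, _, _, hb, hb', hk, ?_, ?_⟩
    -- The bricks may be higher than the boxes, but only away from the plane of contact, so the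
    -- intersection is the same.
    · ext q
      simp only [mem_inter_iff, mem_Icc_iff_of_ne (k := k), Function.update_self]
      have e1 : ∀ (a : Point) s, (∀ i, i ≠ k → Function.update a k s i = a i) :=
        fun a s i hi => by simp [hi]
      have e2 : (∀ i, i ≠ k → Function.update c.1 k s i ≤ q i ∧ q i ≤ c.2 i) ↔
          ∀ i, i ≠ k → c.1 i ≤ q i ∧ q i ≤ c.2 i :=
        forall₂_congr fun i hi => by rw [e1 _ _ i hi]
      have e3 : (∀ i, i ≠ k → c'.1 i ≤ q i ∧ q i ≤ Function.update c'.2 k t' i) ↔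
          ∀ i, i ≠ k → c'.1 i ≤ q i ∧ q i ≤ c'.2 i :=
        forall₂_congr fun i hi => by rw [e1 _ _ i hi]
      rw [e2, e3]
      constructor
      · rintro ⟨⟨h1, h2, h3⟩, h4, h5, h6⟩
        exact ⟨⟨h1, by linarith, h3⟩, h4, h5, by linarith⟩
      · rintro ⟨⟨h1, h2, h3⟩, h4, h5, h6⟩
        exact ⟨⟨h1, by linarith, h3⟩, h4, h5, by linarith⟩
    · refine hcol.imp (fun h i hi => ?_) (fun h i hi => ?_)
      · simpa [hi] using h i hi
      · simpa [hi] using h i hi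
  · rintro ⟨c, c'⟩ hx ⟨e, e'⟩ hy hxy
    obtain ⟨hc, hc', hk, w, hw, hw'⟩ := mem_contacts.1 (Finset.mem_filter.1 (Finset.mem_coe.1 hx)).1
    obtain ⟨he, he', hk', -⟩ := mem_contacts.1 (Finset.mem_filter.1 (Finset.mem_coe.1 hy)).1
    have hwe : w ∈ Icc e.1 e.2 ∩ Icc e'.1 e'.2 := by
      rw [← show Icc c.1 c.2 ∩ Icc c'.1 c'.2 = Icc e.1 e.2 ∩ Icc e'.1 e'.2 from hxy]
      exact ⟨hw, hw'⟩
    have h1 := hw.2 k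
    have h2 := hw'.1 k
    have h3 := hwe.1.2 k
    have h4 := hwe.2.1 k
    exact Prod.ext (hD.eq_of_top hc he hw hwe.1 (by linarith) (by linarith))
      (hD.eq_of_bottom hc' he' hw' hwe.2 (by linarith) (by linarith))

end

/-! ### Linked points -/

/-- The points `p` and `q` lie in a common preconnected subset of `S`. -/
def Linked {X : Type*} [TopologicalSpace X] (S : Set X) (p q : X) : Prop :=
  ∃ K ⊆ S, IsPreconnected K ∧ p ∈ K ∧ q ∈ K

section Linked
variable {X : Type*} [TopologicalSpace X] {S : Set X} {p q r : X}

theorem Linked.refl (hp : p ∈ S) : Linked S p p :=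
  ⟨{p}, by simpa using hp, isPreconnected_singleton, rfl, rfl⟩

theorem Linked.symm (h : Linked S p q) : Linked S q p := by
  obtain ⟨K, hK, h1, h2, h3⟩ := h
  exact ⟨K, hK, h1, h3, h2⟩

theorem Linked.trans (h : Linked S p q) (h' : Linked S q r) : Linked S p r := by
  obtain ⟨K, hK, h1, h2, h3⟩ := h
  obtain ⟨K', hK', h1', h2', h3'⟩ := h'
  exact ⟨K ∪ K', union_subset hK hK', h1.union q h3 h2' h1', Or.inl h2, Or.inr h3'⟩

theorem Linked.image {Y : Type*} [TopologicalSpace Y] {f : X → Y} (hf : Continuous f) {T : Set Y}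
    (hfT : MapsTo f S T) (h : Linked S p q) : Linked T (f p) (f q) := by
  obtain ⟨K, hK, h1, h2, h3⟩ := h
  exact ⟨f '' K, (hfT.mono_left hK).image_subset, h1.image f hf.continuousOn,
    mem_image_of_mem f h2, mem_image_of_mem f h3⟩

theorem isPreconnected_of_linked (x : X) (h : ∀ p ∈ S, Linked S x p) : IsPreconnected S := by
  apply isPreconnected_of_forall x
  intro p hp
  obtain ⟨K, hK, h1, h2, h3⟩ := h p hp
  exact ⟨K, hK, h2, h3, h1⟩

end Linked

/-! ### Planar rectangles with obstacles -/

theorem linked_of_Icc_subset {S : Set (ℝ × ℝ)} {u v : ℝ × ℝ} (huv : u ≤ v) (h : Icc u v ⊆ S) :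
    Linked S u v :=
  ⟨Icc u v, h, (convex_Icc u v).isPreconnected, left_mem_Icc.2 huv, right_mem_Icc.2 huv⟩

/-- Finitely many disjoint rectangles keep a positive distance. -/
theorem exists_margin {R : Finset ((ℝ × ℝ) × (ℝ × ℝ))} (hne : ∀ r ∈ R, r.1 ≤ r.2)
    (hR : ∀ r ∈ R, ∀ r' ∈ R, r ≠ r' → Disjoint (Icc r.1 r.2) (Icc r'.1 r'.2)) :
    ∃ ε : ℝ, 0 < ε ∧ ∀ r ∈ R, ∀ r' ∈ R, r ≠ r' →
      Disjoint (Icc (r.1 - (ε, ε)) (r.2 + (ε, ε))) (Icc r'.1 r'.2) := by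
  have hev : ∀ᶠ ε in 𝓝[>] (0 : ℝ), ∀ r ∈ R, ∀ r' ∈ R, r ≠ r' →
      Disjoint (Icc (r.1 - (ε, ε)) (r.2 + (ε, ε))) (Icc r'.1 r'.2) := by
    rw [Filter.eventually_all_finset]
    intro r hr
    rw [Filter.eventually_all_finset]
    intro r' hr'
    by_cases hrr : r = r'
    · simp [hrr]
    have h1 := hne r hr
    have h2 := hne r' hr'
    -- Disjoint rectangles are separated in one of the coordinates; otherwise the coordinatewise
    -- maximum of their lower corners would be common to both. The gap bounds `ε`.
    have h3 : r.2.1 < r'.1.1 ∨ r'.2.1 < r.1.1 ∨ r.2.2 < r'.1.2 ∨ r'.2.2 < r.1.2 := by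
      by_contra hcon
      push Not at hcon
      refine (hR r hr r' hr' hrr).ne_of_mem (a := (max r.1.1 r'.1.1, max r.1.2 r'.1.2))
        (b := (max r.1.1 r'.1.1, max r.1.2 r'.1.2)) ⟨?_, ?_⟩ ⟨?_, ?_⟩ rfl
      · exact ⟨le_max_left _ _, le_max_left _ _⟩
      · exact ⟨max_le h1.1 hcon.1, max_le h1.2 hcon.2.2.1⟩
      · exact ⟨le_max_right _ _, le_max_right _ _⟩
      · exact ⟨max_le hcon.2.1 h2.1, max_le hcon.2.2.2 h2.2⟩
    rcases h3 with h | h | h | h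
    · filter_upwards [Ioo_mem_nhdsGT (sub_pos.2 h)] with ε hε _
      rw [Set.disjoint_left]
      rintro x ⟨-, hx⟩ ⟨hx', -⟩
      have := hx.1
      have := hx'.1
      simp only [Prod.fst_add] at *
      linarith [hε.2]
    · filter_upwards [Ioo_mem_nhdsGT (sub_pos.2 h)] with ε hε _
      rw [Set.disjoint_left]
      rintro x ⟨hx, -⟩ ⟨-, hx'⟩
      have := hx.1
      have := hx'.1
      simp only [Prod.fst_sub] at *
      linarith [hε.2]
    · filter_upwards [Ioo_mem_nhdsGT (sub_pos.2 h)] with ε hε _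
      rw [Set.disjoint_left]
      rintro x ⟨-, hx⟩ ⟨hx', -⟩
      have := hx.2
      have := hx'.2
      simp only [Prod.snd_add] at *
      linarith [hε.2]
    · filter_upwards [Ioo_mem_nhdsGT (sub_pos.2 h)] with ε hε _
      rw [Set.disjoint_left]
      rintro x ⟨hx, -⟩ ⟨-, hx'⟩
      have := hx.2
      have := hx'.2
      simp only [Prod.snd_sub] at *
      linarith [hε.2]
  obtain ⟨ε, h1, h2⟩ := (hev.and self_mem_nhdsWithin).exists
  exact ⟨ε, h2, h1⟩

/-- A point of a rectangle outside of some disjoint rectangular obstacles can be linked to the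
boundary. -/
theorem exists_linked_boundary {R : Finset ((ℝ × ℝ) × (ℝ × ℝ))} (hne : ∀ r ∈ R, r.1 ≤ r.2)
    (hR : ∀ r ∈ R, ∀ r' ∈ R, r ≠ r' → Disjoint (Icc r.1 r.2) (Icc r'.1 r'.2)) {a b p : ℝ × ℝ}
    (hp : p ∈ Icc a b \ ⋃ r ∈ R, Icc r.1 r.2) :
    ∃ q ∈ Icc a b \ ⋃ r ∈ R, Icc r.1 r.2, (q.1 = b.1 ∨ q.2 = b.2) ∧
      Linked (Icc a b \ ⋃ r ∈ R, Icc r.1 r.2) p q := by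
  classical
  obtain ⟨ε, hε, hmar⟩ := exists_margin hne hR
  set F := Icc a b \ ⋃ r ∈ R, Icc r.1 r.2 with hF
  have hmem : ∀ w, w ∈ F ↔ w ∈ Icc a b ∧ ∀ r ∈ R, w ∉ Icc r.1 r.2 := by
    intro w; simp only [hF, mem_sdiff, mem_iUnion, exists_prop, not_exists, not_and]
  -- Walk to the right, and around the top of the first obstacle met, at distance at most `ε` from
  -- it. Either the right or the upper side is reached, or the obstacle is left behind and fewer
  -- obstacles have their right side ahead.
  induction hn : (R.filter fun r => p.1 < r.2.1).card using Nat.strong_induction_on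
    generalizing p with
  | _ n ih =>
  obtain ⟨hpab, hpR⟩ := (hmem p).1 hp
  have hpa1 := hpab.1.1
  have hpa2 := hpab.1.2
  have hpb1 := hpab.2.1
  have hpb2 := hpab.2.2
  rcases (R.filter fun r => (r.1.2 ≤ p.2 ∧ p.2 ≤ r.2.2) ∧ p.1 < r.1.1 ∧ r.1.1 ≤ b.1).eq_empty_or_nonempty
    with hO | hO
  · have hsub : Icc p (b.1, p.2) ⊆ F := by
      rintro w ⟨h1, h2⟩
      have hw1 : p.1 ≤ w.1 := h1.1
      have hw2 : w.1 ≤ b.1 := h2.1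
      have hw3 : w.2 = p.2 := le_antisymm h2.2 h1.2
      refine (hmem w).2 ⟨⟨⟨by linarith, by linarith⟩, ⟨hw2, by linarith⟩⟩, fun r hr hwr => ?_⟩
      have e1 := hwr.1.1
      have e2 := hwr.1.2
      have e3 := hwr.2.1
      have e4 := hwr.2.2
      rw [Finset.filter_eq_empty_iff] at hO
      refine hO hr ⟨⟨by linarith, by linarith⟩, ?_, by linarith⟩
      by_contra hcon
      exact hpR r hr ⟨⟨by linarith, by linarith⟩, ⟨by linarith, by linarith⟩⟩
    have hle : p ≤ (b.1, p.2) := ⟨hpb1, le_rfl⟩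
    exact ⟨(b.1, p.2), hsub (right_mem_Icc.2 hle), Or.inl rfl, linked_of_Icc_subset hle hsub⟩
  · obtain ⟨r, hrO, hmin⟩ := Finset.exists_min_image _ (fun r => r.1.1) hO
    obtain ⟨hrR, ⟨hr1, hr2⟩, hr3, hr4⟩ := Finset.mem_filter.1 hrO
    have hrn := (hne r hrR).1
    -- Inside the `ε`-margin of `r` the only obstacle is `r` itself.
    have hexp : ∀ w : ℝ × ℝ, r.1.1 - ε ≤ w.1 → w.1 ≤ r.2.1 + ε → r.1.2 - ε ≤ w.2 →
        w.2 ≤ r.2.2 + ε → w ∈ Icc a b → w ∉ Icc r.1 r.2 → w ∈ F := by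
      intro w h1 h2 h3 h4 h5 h6
      refine (hmem w).2 ⟨h5, fun r' hr' hwr => ?_⟩
      by_cases hrr : r = r'
      · subst hrr; exact h6 hwr
      · exact Set.disjoint_left.1 (hmar r hrR r' hr' hrr) ⟨⟨h1, h3⟩, ⟨h2, h4⟩⟩ hwr
    set x₀ := max p.1 (r.1.1 - ε) with hx₀
    have hx₀1 : p.1 ≤ x₀ := le_max_left _ _
    have hx₀2 : r.1.1 - ε ≤ x₀ := le_max_right _ _
    have hx₀3 : x₀ < r.1.1 := max_lt hr3 (by linarith)
    -- to the right, up to the obstacle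
    have hsub1 : Icc p (x₀, p.2) ⊆ F := by
      rintro w ⟨h1, h2⟩
      have hw1 : p.1 ≤ w.1 := h1.1
      have hw2 : w.1 ≤ x₀ := h2.1
      have hw3 : w.2 = p.2 := le_antisymm h2.2 h1.2
      refine (hmem w).2 ⟨⟨⟨by linarith, by linarith⟩, ⟨by linarith, by linarith⟩⟩, fun r' hr' hwr => ?_⟩
      have e1 := hwr.1.1
      have e2 := hwr.1.2
      have e3 := hwr.2.1
      have e4 := hwr.2.2
      have hlt : p.1 < r'.1.1 := by
        by_contra hcon
        exact hpR r' hr' ⟨⟨by linarith, by linarith⟩, ⟨by linarith, by linarith⟩⟩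
      have := hmin r' (Finset.mem_filter.2 ⟨hr', ⟨by linarith, by linarith⟩, hlt, by linarith⟩)
      linarith
    have hl1 : Linked F p (x₀, p.2) := linked_of_Icc_subset ⟨hx₀1, le_rfl⟩ hsub1
    -- upwards
    set y₁ := min (r.2.2 + ε) b.2 with hy₁
    have hy₁1 : p.2 ≤ y₁ := le_min (by linarith) hpb2
    have hy₁2 : y₁ ≤ r.2.2 + ε := min_le_left _ _
    have hy₁3 : y₁ ≤ b.2 := min_le_right _ _
    have hsub2 : Icc (x₀, p.2) (x₀, y₁) ⊆ F := by
      rintro w ⟨h1, h2⟩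
      have hw1 : w.1 = x₀ := le_antisymm h2.1 h1.1
      have hw2 : p.2 ≤ w.2 := h1.2
      have hw3 : w.2 ≤ y₁ := h2.2
      refine hexp w (by linarith) (by linarith) (by linarith) (by linarith)
        ⟨⟨by linarith, by linarith⟩, ⟨by linarith, by linarith⟩⟩ fun hwr => ?_
      have := hwr.1.1
      linarith
    have hl2 : Linked F p (x₀, y₁) := hl1.trans
      (linked_of_Icc_subset (u := (x₀, p.2)) (v := (x₀, y₁)) ⟨le_rfl, hy₁1⟩ hsub2)
    rcases le_total b.2 (r.2.2 + ε) with hb | hb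
    · exact ⟨(x₀, y₁), hsub2 ⟨⟨le_rfl, hy₁1⟩, ⟨le_rfl, le_rfl⟩⟩, Or.inr (min_eq_right hb), hl2⟩
    have hy₁4 : y₁ = r.2.2 + ε := min_eq_left hb
    -- and beyond the obstacle
    set x₁ := min (r.2.1 + ε) b.1 with hx₁
    have hx₁1 : x₀ ≤ x₁ := le_min (by linarith) (by linarith)
    have hx₁2 : x₁ ≤ r.2.1 + ε := min_le_left _ _
    have hx₁3 : x₁ ≤ b.1 := min_le_right _ _
    have hsub3 : Icc (x₀, y₁) (x₁, y₁) ⊆ F := by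
      rintro w ⟨h1, h2⟩
      have hw1 : x₀ ≤ w.1 := h1.1
      have hw2 : w.1 ≤ x₁ := h2.1
      have hw3 : w.2 = y₁ := le_antisymm h2.2 h1.2
      refine hexp w (by linarith) (by linarith) (by linarith) (by linarith)
        ⟨⟨by linarith, by linarith⟩, ⟨by linarith, by linarith⟩⟩ fun hwr => ?_
      have := hwr.2.2
      linarith
    have hl3 : Linked F p (x₁, y₁) := hl2.trans
      (linked_of_Icc_subset (u := (x₀, y₁)) (v := (x₁, y₁)) ⟨hx₁1, le_rfl⟩ hsub3)
    have hmem3 : (x₁, y₁) ∈ F := hsub3 ⟨⟨hx₁1, le_rfl⟩, ⟨le_rfl, le_rfl⟩⟩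
    rcases le_total b.1 (r.2.1 + ε) with hb' | hb'
    · exact ⟨(x₁, y₁), hmem3, Or.inl (min_eq_right hb'), hl3⟩
    have hx₁4 : x₁ = r.2.1 + ε := min_eq_left hb'
    have hcard : (R.filter fun r => x₁ < r.2.1).card < n := by
      rw [← hn]
      apply Finset.card_lt_card
      rw [Finset.ssubset_iff_of_subset]
      · refine ⟨r, Finset.mem_filter.2 ⟨hrR, by linarith⟩, fun h => ?_⟩
        have := (Finset.mem_filter.1 h).2
        linarith
      · intro r' h
        obtain ⟨h1, h2⟩ := Finset.mem_filter.1 h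
        exact Finset.mem_filter.2 ⟨h1, by linarith⟩
    obtain ⟨q, hq, hqb, hql⟩ := ih _ hcard hmem3 rfl
    exact ⟨q, hq, hqb, hl3.trans hql⟩

/-! ### The boundary of a rectangle -/

/-- The boundary of a planar rectangle. -/
def rectBoundary (a b : ℝ × ℝ) : Set (ℝ × ℝ) :=
  {w ∈ Icc a b | (w.1 = a.1 ∨ w.1 = b.1) ∨ (w.2 = a.2 ∨ w.2 = b.2)}

/-- Dividing by the maximum norm projects the unit circle radially onto the boundary of a square,
which an affine map takes to the rectangle. Dividing by the Euclidean norm inverts the projection.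
-/
theorem exists_circle_param {a b : ℝ × ℝ} (h1 : a.1 < b.1) (h2 : a.2 < b.2) :
    ∃ γ : Circle → ℝ × ℝ, Continuous γ ∧ Function.Injective γ ∧ range γ = rectBoundary a b := by
  set n : Circle → ℝ := fun z => max |(z : ℂ).re| |(z : ℂ).im| with hn
  have hn0 : ∀ z, 0 < n z := by
    intro z
    by_contra hcon
    have h3 : |(z : ℂ).re| ≤ 0 := (le_max_left _ _).trans (not_lt.1 hcon)
    have h4 : |(z : ℂ).im| ≤ 0 := (le_max_right _ _).trans (not_lt.1 hcon)
    have h5 : (z : ℂ) = 0 := Complex.ext (by simpa using h3) (by simpa using h4)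
    exact Circle.coe_ne_zero z h5
  have hnc : Continuous n := by
    have : Continuous fun z : Circle => (z : ℂ) := continuous_subtype_val
    fun_prop
  refine ⟨fun z => ((a.1 + b.1) / 2 + (b.1 - a.1) / 2 * ((z : ℂ).re / n z),
    (a.2 + b.2) / 2 + (b.2 - a.2) / 2 * ((z : ℂ).im / n z)), ?_, ?_, ?_⟩
  · have : Continuous fun z : Circle => (z : ℂ) := continuous_subtype_val
    have h3 : ∀ z, n z ≠ 0 := fun z => (hn0 z).ne'
    have h4 : Continuous fun z : Circle => (z : ℂ).re / n z :=
      (Complex.continuous_re.comp this).div hnc h3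
    have h5 : Continuous fun z : Circle => (z : ℂ).im / n z :=
      (Complex.continuous_im.comp this).div hnc h3
    fun_prop
  · intro z z' h
    simp only [Prod.mk.injEq, add_right_inj] at h
    have e1 := mul_left_cancel₀ (half_pos (sub_pos.2 h1)).ne' h.1
    have e2 := mul_left_cancel₀ (half_pos (sub_pos.2 h2)).ne' h.2
    have hz := hn0 z
    have hz' := hn0 z'
    have s1 := Circle.normSq_coe z
    have s2 := Circle.normSq_coe z'
    rw [Complex.normSq_apply] at s1 s2
    have f1 : (z : ℂ).re = n z / n z' * (z' : ℂ).re := by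
      rw [div_eq_div_iff hz.ne' hz'.ne'] at e1
      field_simp
      linarith
    have f2 : (z : ℂ).im = n z / n z' * (z' : ℂ).im := by
      rw [div_eq_div_iff hz.ne' hz'.ne'] at e2
      field_simp
      linarith
    have ht := div_pos hz hz'
    set t := n z / n z' with htd
    have ht1 : t = 1 := by
      rw [f1, f2] at s1
      have : t ^ 2 = 1 := by
        calc t ^ 2 = t ^ 2 * ((z' : ℂ).re * (z' : ℂ).re + (z' : ℂ).im * (z' : ℂ).im) := by
              rw [s2, mul_one]
          _ = 1 := by linarith
      nlinarith
    rw [ht1, one_mul] at f1 f2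
    exact Circle.ext (Complex.ext f1 f2)
  · have hd1 := sub_pos.2 h1
    have hd2 := sub_pos.2 h2
    apply Subset.antisymm
    · rintro _ ⟨z, rfl⟩
      have hz := hn0 z
      have hx : |(z : ℂ).re / n z| ≤ 1 := by
        rw [abs_div, abs_of_pos hz, div_le_one hz]; exact le_max_left _ _
      have hy : |(z : ℂ).im / n z| ≤ 1 := by
        rw [abs_div, abs_of_pos hz, div_le_one hz]; exact le_max_right _ _
      have hxy : |(z : ℂ).re / n z| = 1 ∨ |(z : ℂ).im / n z| = 1 := by
        rcases max_choice |(z : ℂ).re| |(z : ℂ).im| with h | h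
        · left; rw [abs_div, abs_of_pos hz, div_eq_one_iff_eq hz.ne']; exact h.symm
        · right; rw [abs_div, abs_of_pos hz, div_eq_one_iff_eq hz.ne']; exact h.symm
      rw [abs_le] at hx hy
      change ((a.1 + b.1) / 2 + (b.1 - a.1) / 2 * ((z : ℂ).re / n z),
        (a.2 + b.2) / 2 + (b.2 - a.2) / 2 * ((z : ℂ).im / n z)) ∈ rectBoundary a b
      generalize (z : ℂ).re / n z = x at hx hxy ⊢
      generalize (z : ℂ).im / n z = y at hy hxy ⊢
      refine ⟨⟨⟨?_, ?_⟩, ⟨?_, ?_⟩⟩, ?_⟩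
      · simp only; nlinarith
      · simp only; nlinarith
      · simp only; nlinarith
      · simp only; nlinarith
      · refine hxy.imp (fun h => ?_) (fun h => ?_)
        · rcases (abs_eq zero_le_one).1 h with rfl | rfl
          · right; simp only; ring
          · left; simp only; ring
        · rcases (abs_eq zero_le_one).1 h with rfl | rfl
          · right; simp only; ring
          · left; simp only; ring
    · rintro w ⟨⟨hwa, hwb⟩, hw⟩
      have ha1 := hwa.1
      have ha2 := hwa.2
      have hb1 := hwb.1
      have hb2 := hwb.2
      obtain ⟨u, hu⟩ : ∃ u, w.1 = (a.1 + b.1) / 2 + (b.1 - a.1) / 2 * u :=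
        ⟨(w.1 - (a.1 + b.1) / 2) / ((b.1 - a.1) / 2), by field_simp; ring⟩
      obtain ⟨v, hv⟩ : ∃ v, w.2 = (a.2 + b.2) / 2 + (b.2 - a.2) / 2 * v :=
        ⟨(w.2 - (a.2 + b.2) / 2) / ((b.2 - a.2) / 2), by field_simp; ring⟩
      have hu1 : |u| ≤ 1 := by
        rw [abs_le]; constructor <;> by_contra hcon <;> nlinarith
      have hv1 : |v| ≤ 1 := by
        rw [abs_le]; constructor <;> by_contra hcon <;> nlinarith
      have huv : |u| = 1 ∨ |v| = 1 := by
        refine hw.imp (fun h => (abs_eq zero_le_one).2 ?_) (fun h => (abs_eq zero_le_one).2 ?_)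
        · refine h.symm.imp (fun h => ?_) (fun h => ?_) <;>
            exact mul_left_cancel₀ (half_pos hd1).ne' (by linarith)
        · refine h.symm.imp (fun h => ?_) (fun h => ?_) <;>
            exact mul_left_cancel₀ (half_pos hd2).ne' (by linarith)
      have hmax : max |u| |v| = 1 := by
        rcases huv with h | h
        · rw [h]; exact max_eq_left hv1
        · rw [h]; exact max_eq_right hu1
      set ζ : ℂ := ⟨u, v⟩ with hζ
      have hζ0 : ζ ≠ 0 := by
        intro h
        have e1 : u = 0 := congrArg Complex.re h
        have e2 : v = 0 := congrArg Complex.im h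
        simp [e1, e2] at hmax
      have hN : 0 < ‖ζ‖ := norm_pos_iff.2 hζ0
      have hre : (ζ / (‖ζ‖ : ℂ)).re = u / ‖ζ‖ := by rw [Complex.div_ofReal_re]
      have him : (ζ / (‖ζ‖ : ℂ)).im = v / ‖ζ‖ := by rw [Complex.div_ofReal_im]
      have hnorm : ‖ζ / (‖ζ‖ : ℂ)‖ = 1 := by
        rw [norm_div, Complex.norm_real, norm_norm, div_self hN.ne']
      refine ⟨⟨ζ / (‖ζ‖ : ℂ), mem_sphere_zero_iff_norm.2 hnorm⟩, ?_⟩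
      have hnz : n ⟨ζ / (‖ζ‖ : ℂ), mem_sphere_zero_iff_norm.2 hnorm⟩ = 1 / ‖ζ‖ := by
        simp only [hn, hre, him, abs_div, abs_norm]
        rw [max_div_div_right hN.le, hmax]
      simp only [hnz, hre, him]
      refine Prod.ext ?_ ?_
      · simp only [hu]; field_simp
      · simp only [hv]; field_simp

/-! ### Loops around the contact rectangles -/

/-- The point `p` lies in the plane of one of the vertical sides of the box `c`. -/
def OnSide (k : Fin 3) (c : Point × Point) (p : Point) : Prop :=
  ∃ l, l ≠ k ∧ (p l = c.1 l ∨ p l = c.2 l)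

theorem OnSide.update {k : Fin 3} {c : Point × Point} {p : Point} (h : OnSide k c p) (t : ℝ) :
    OnSide k c (Function.update p k t) := by
  obtain ⟨l, hl, h⟩ := h
  exact ⟨l, hl, by rwa [Function.update_of_ne hl]⟩

/-- The boundary of the common rectangle of the two boxes in `x`. -/
def contactLoop (k : Fin 3) (x : (Point × Point) × (Point × Point)) : Set Point :=
  {p | p ∈ Icc x.1.1 x.1.2 ∧ p ∈ Icc x.2.1 x.2.2 ∧ (OnSide k x.1 p ∨ OnSide k x.2 p)}

/-- The part of the boundary surface off the loops of the contacts in `F`. -/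
def cutSurface (D : Finset (Point × Point)) (k : Fin 3)
    (F : Finset ((Point × Point) × (Point × Point))) : Set Point :=
  frontier (boxUnion D) \ ⋃ x ∈ F, contactLoop k x

theorem mem_cutSurface {D : Finset (Point × Point)} {k : Fin 3}
    {F : Finset ((Point × Point) × (Point × Point))} {p : Point} :
    p ∈ cutSurface D k F ↔ p ∈ frontier (boxUnion D) ∧ ∀ x ∈ F, p ∉ contactLoop k x := by
  simp only [cutSurface, mem_sdiff, mem_iUnion, exists_prop, not_exists, not_and]

section
variable {D : Finset (Point × Point)} {k : Fin 3}
  {F : Finset ((Point × Point) × (Point × Point))}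

theorem IsDecomposition.mem_frontier_of_not_oct (hD : IsDecomposition D k) {c : Point × Point}
    (hc : c ∈ D) {p : Point} (hp : p ∈ Icc c.1 c.2) {σ : Fin 3 → Bool} (hσ : ¬ oct D p σ) :
    p ∈ frontier (boxUnion D) := by
  obtain ⟨τ, hτ⟩ := exists_boxOct (hD.nondeg c hc) hp
  exact (mem_frontier_boxUnion hD.nondeg).2 ⟨⟨τ, c, hc, hτ⟩, σ, hσ⟩

/-- Consider an octant that leaves `c` through the side but stays in its height range. A box filling
it would belong to the same slab and contain `p`, hence would be `c`. -/
theorem IsDecomposition.mem_frontier_of_onSide (hD : IsDecomposition D k) {c : Point × Point}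
    (hc : c ∈ D) {p : Point} (hp : p ∈ Icc c.1 c.2) (h : OnSide k c p) :
    p ∈ frontier (boxUnion D) := by
  obtain ⟨l, hl, h⟩ := h
  have hn := hD.nondeg c hc
  obtain ⟨σ, hσk, hσl⟩ : ∃ σ : Fin 3 → Bool, cOct (c.1 k) (c.2 k) (p k) (σ k) ∧
      ¬ cOct (c.1 l) (c.2 l) (p l) (σ l) := by
    obtain ⟨s, hs⟩ := exists_cOct (hn k) ⟨hp.1 k, hp.2 k⟩
    obtain ⟨t, ht⟩ : ∃ t, ¬ cOct (c.1 l) (c.2 l) (p l) t := by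
      rcases h with h | h
      · exact ⟨false, by simp [cOct, h]⟩
      · exact ⟨true, by simp [cOct, h]⟩
    exact ⟨Function.update (fun _ => s) l t, by rwa [Function.update_of_ne hl.symm],
      by rwa [Function.update_self]⟩
  refine hD.mem_frontier_of_not_oct hc hp (σ := σ) ?_
  rintro ⟨e, he, hσ⟩
  have h1 := hσ k
  have h2 : e.1 k < c.2 k ∧ c.1 k < e.2 k := by
    cases hk : σ k
    · have := hσk.2 hk
      have := h1.2 hk
      constructor <;> linarith
    · have := hσk.1 hk
      have := h1.1 hk
      constructor <;> linarith
  obtain ⟨h3, h4⟩ := hD.slab c hc e he h2.2 h2.1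
  have := hD.eq_of_mem c hc e he h3 h4 p hp hσ.mem
  subst this
  exact hσl (hσ l)

theorem IsDecomposition.mem_frontier_of_forall_eq (hD : IsDecomposition D k) {c : Point × Point}
    (hc : c ∈ D) {p : Point} (hp : p ∈ Icc c.1 c.2) (h : p k = c.1 k ∨ p k = c.2 k)
    (hu : ∀ e ∈ D, p ∈ Icc e.1 e.2 → e = c) : p ∈ frontier (boxUnion D) := by
  obtain ⟨t, ht⟩ : ∃ t, ¬ cOct (c.1 k) (c.2 k) (p k) t := by
    rcases h with h | h
    · exact ⟨false, by simp [cOct, h]⟩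
    · exact ⟨true, by simp [cOct, h]⟩
  refine hD.mem_frontier_of_not_oct hc hp (σ := fun _ => t) ?_
  rintro ⟨e, he, hσ⟩
  obtain rfl := hu e he hσ.mem
  exact ht (hσ k)

theorem IsDecomposition.ne_of_mem_contacts (hD : IsDecomposition D k)
    {x : (Point × Point) × (Point × Point)} (hx : x ∈ contacts D k) : x.1 ≠ x.2 := by
  obtain ⟨h1, h2, h3, -⟩ := mem_contacts.1 hx
  intro h
  have := hD.nondeg _ h1 k
  rw [← h] at h3
  linarith

/-- Every point of a loop belongs to two different boxes, so surface points in a single box are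
never cut away. -/
theorem IsDecomposition.mem_cutSurface_of_forall_eq (hD : IsDecomposition D k)
    (hF : F ⊆ contacts D k) {p : Point} (hp : p ∈ frontier (boxUnion D)) {c : Point × Point}
    (hu : ∀ e ∈ D, p ∈ Icc e.1 e.2 → e = c) : p ∈ cutSurface D k F := by
  refine mem_cutSurface.2 ⟨hp, fun x hx hpx => hD.ne_of_mem_contacts (hF hx) ?_⟩
  obtain ⟨h1, h2, h3, -⟩ := mem_contacts.1 (hF hx)
  rw [hu _ h1 hpx.1, hu _ h2 hpx.2.1]

theorem IsDecomposition.mem_cutSurface_of_onSide (hD : IsDecomposition D k)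
    (hF : F ⊆ contacts D k) {c : Point × Point} (hc : c ∈ D) {p : Point} (hp : p ∈ Icc c.1 c.2)
    (h : OnSide k c p) (h1 : c.1 k < p k) (h2 : p k < c.2 k) : p ∈ cutSurface D k F :=
  hD.mem_cutSurface_of_forall_eq hF (hD.mem_frontier_of_onSide hc hp h) (c := c) fun _ he hpe =>
    (hD.eq_of_inside hc he hp hpe h1 h2).symm

/-- A point on a vertical edge of the box `c`, at mid-height. -/
noncomputable def basePoint (k : Fin 3) (c : Point × Point) : Point :=
  Function.update c.1 k ((c.1 k + c.2 k) / 2)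

theorem mem_rectBoundary_iff {i j : Fin 3} (hij : i ≠ j) (hik : i ≠ k) (hjk : j ≠ k)
    {c : Point × Point} {w : ℝ × ℝ} {z : ℝ} (h1 : c.1 k ≤ z) (h2 : z ≤ c.2 k) :
    w ∈ rectBoundary (c.1 i, c.1 j) (c.2 i, c.2 j) ↔
      tri i j w.1 w.2 z ∈ Icc c.1 c.2 ∧ OnSide k c (tri i j w.1 w.2 z) := by
  rw [tri_mem_Icc hij hik hjk]
  have : OnSide k c (tri i j w.1 w.2 z) ↔
      (w.1 = c.1 i ∨ w.1 = c.2 i) ∨ (w.2 = c.1 j ∨ w.2 = c.2 j) := by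
    constructor
    · rintro ⟨l, hl, h⟩
      rcases fin3_cases hij hik hjk l with rfl | rfl | rfl
      · rw [tri_fst] at h; exact Or.inl h
      · rw [tri_snd hij.symm] at h; exact Or.inr h
      · exact absurd rfl hl
    · rintro (h | h)
      · exact ⟨i, hik, by rwa [tri_fst]⟩
      · exact ⟨j, hjk, by rwa [tri_snd hij.symm]⟩
  rw [this]
  simp only [rectBoundary, mem_ofPred_eq, mem_Icc, Prod.le_def]
  tauto

/-- At a height strictly inside `c` the four sides form the boundary of a rectangle, which is
connected and untouched by other boxes and by loops. -/
theorem IsDecomposition.linked_ring (hD : IsDecomposition D k) (hF : F ⊆ contacts D k)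
    {c : Point × Point} (hc : c ∈ D) {p q : Point} (hp : p ∈ Icc c.1 c.2) (hq : q ∈ Icc c.1 c.2)
    (hps : OnSide k c p) (hqs : OnSide k c q) (hpq : p k = q k) (h1 : c.1 k < p k)
    (h2 : p k < c.2 k) : Linked (cutSurface D k F) p q := by
  obtain ⟨i, j, hij, hik, hjk⟩ := exists_others k
  have hn := hD.nondeg c hc
  have key := fun w : ℝ × ℝ =>
    mem_rectBoundary_iff (c := c) (w := w) hij hik hjk h1.le h2.le
  obtain ⟨γ, hγ, -, hγr⟩ := exists_circle_param (a := (c.1 i, c.1 j)) (b := (c.2 i, c.2 j))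
    (hn i) (hn j)
  have hK : IsPreconnected (rectBoundary (c.1 i, c.1 j) (c.2 i, c.2 j)) := by
    rw [← hγr]; exact isPreconnected_range hγ
  have hep : tri i j (p i) (p j) (p k) = p := tri_eta hij hik hjk p
  have heq : tri i j (q i) (q j) (p k) = q := by rw [hpq]; exact tri_eta hij hik hjk q
  refine ⟨(fun w : ℝ × ℝ => (tri i j w.1 w.2 (p k) : Point)) '' rectBoundary _ _, ?_,
    hK.image _ (continuous_tri i j (p k)).continuousOn, ⟨(p i, p j), (key _).2 ?_, hep⟩,
    ⟨(q i, q j), (key _).2 ?_, heq⟩⟩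
  · rintro _ ⟨w, hw, rfl⟩
    obtain ⟨hw1, hw2⟩ := (key w).1 hw
    have hk : (tri i j w.1 w.2 (p k) : Point) k = p k := tri_trd hik.symm hjk.symm
    exact hD.mem_cutSurface_of_onSide hF hc hw1 hw2 (h1.trans_eq hk.symm) (hk.trans_lt h2)
  · simp only [hep]; exact ⟨hp, hps⟩
  · simp only [heq]; exact ⟨hq, hqs⟩

theorem IsDecomposition.linked_of_onSide (hD : IsDecomposition D k) (hF : F ⊆ contacts D k)
    {c : Point × Point} (hc : c ∈ D) {p : Point} (hpS : p ∈ cutSurface D k F)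
    (hp : p ∈ Icc c.1 c.2) (hps : OnSide k c p) :
    Linked (cutSurface D k F) p (basePoint k c) := by
  have hn := hD.nondeg c hc k
  set z := (c.1 k + c.2 k) / 2 with hz
  have hz1 : c.1 k < z := by rw [hz]; linarith
  have hz2 : z < c.2 k := by rw [hz]; linarith
  have hpk1 := hp.1 k
  have hpk2 := hp.2 k
  have hmem : ∀ t, c.1 k ≤ t → t ≤ c.2 k → Function.update p k t ∈ Icc c.1 c.2 :=
    fun t h1 h2 => update_mem_Icc hp ⟨h1, h2⟩
  have hvert : Linked (cutSurface D k F) p (Function.update p k z) := by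
    refine ⟨(fun t => Function.update p k t) '' uIcc (p k) z, ?_,
      isPreconnected_uIcc.image _ (continuous_update_const p k).continuousOn,
      ⟨p k, left_mem_uIcc, Function.update_eq_self k p⟩, ⟨z, right_mem_uIcc, rfl⟩⟩
    rintro _ ⟨t, ht, rfl⟩
    -- Only the starting point may be at the bottom or top of `c`, and it is on the cut surface by
    -- assumption; all other points of the vertical segment are strictly between.
    by_cases htp : t = p k
    · rw [htp]; simpa using hpS
    · have h3 : c.1 k < t ∧ t < c.2 k := by
        rcases mem_uIcc.1 ht with h | h
        · exact ⟨hpk1.trans_lt (lt_of_le_of_ne h.1 (Ne.symm htp)), h.2.trans_lt hz2⟩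
        · exact ⟨hz1.trans_le h.1, (lt_of_le_of_ne h.2 htp).trans_le hpk2⟩
      exact hD.mem_cutSurface_of_onSide hF hc (hmem t h3.1.le h3.2.le) (hps.update t)
        (by simpa using h3.1) (by simpa using h3.2)
  obtain ⟨i, -, -, hik, -⟩ := exists_others k
  refine hvert.trans (hD.linked_ring hF hc (hmem z hz1.le hz2.le) ?_ (hps.update z) ?_ ?_ ?_ ?_)
  · exact update_mem_Icc (left_mem_Icc.2 fun l => (hD.nondeg c hc l).le) ⟨hz1.le, hz2.le⟩
  · exact OnSide.update ⟨i, hik, Or.inl rfl⟩ _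
  · simp [basePoint, hz]
  · simpa using hz1
  · simpa using hz2

/-- A point of a horizontal face that is in a single box can be linked to the base point. -/
theorem IsDecomposition.linked_of_obstacles (hD : IsDecomposition D k) (hF : F ⊆ contacts D k)
    {c : Point × Point} (hc : c ∈ D) {p : Point} (hp : p ∈ Icc c.1 c.2)
    (hpk : p k = c.1 k ∨ p k = c.2 k) (hu : ∀ e ∈ D, p ∈ Icc e.1 e.2 → e = c)
    {E : Finset (Point × Point)} (hED : ∀ e ∈ E, e ∈ D ∧ e ≠ c ∧ e.1 k ≤ p k ∧ p k ≤ e.2 k)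
    (hE : ∀ e ∈ D, ∀ q ∈ Icc c.1 c.2, q k = p k → q ∈ Icc e.1 e.2 → e ≠ c → e ∈ E)
    (hE' : ∀ e ∈ E, ∀ e' ∈ E, ∀ q, q k = p k → q ∈ Icc e.1 e.2 → q ∈ Icc e'.1 e'.2 → e = e') :
    Linked (cutSurface D k F) p (basePoint k c) := by
  classical
  obtain ⟨i, j, hij, hik, hjk⟩ := exists_others k
  have hn := hD.nondeg c hc
  have hk : ∀ w : ℝ × ℝ, (tri i j w.1 w.2 (p k) : Point) k = p k :=
    fun w => tri_trd hik.symm hjk.symm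
  have hep : tri i j (p i) (p j) (p k) = p := tri_eta hij hik hjk p
  -- The free part of the face is a rectangle minus the disjoint sections of the boxes touching it,
  -- so `exists_linked_boundary` leads to a vertical side of `c`.
  set R := E.image fun e => (((e.1 i, e.1 j), (e.2 i, e.2 j)) : (ℝ × ℝ) × (ℝ × ℝ)) with hR
  have hin : ∀ e : Point × Point, e.1 k ≤ p k → p k ≤ e.2 k → ∀ w : ℝ × ℝ,
      w ∈ Icc (e.1 i, e.1 j) (e.2 i, e.2 j) ↔ (tri i j w.1 w.2 (p k) : Point) ∈ Icc e.1 e.2 := by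
    intro e h1 h2 w
    rw [tri_mem_Icc hij hik hjk]
    simp only [mem_Icc, Prod.le_def]
    tauto
  have hRne : ∀ r ∈ R, r.1 ≤ r.2 := by
    intro r hr
    obtain ⟨e, he, rfl⟩ := Finset.mem_image.1 hr
    exact ⟨(hD.nondeg e (hED e he).1 i).le, (hD.nondeg e (hED e he).1 j).le⟩
  have hRd : ∀ r ∈ R, ∀ r' ∈ R, r ≠ r' → Disjoint (Icc r.1 r.2) (Icc r'.1 r'.2) := by
    intro r hr r' hr' hrr
    obtain ⟨e, he, rfl⟩ := Finset.mem_image.1 hr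
    obtain ⟨e', he', rfl⟩ := Finset.mem_image.1 hr'
    rw [Set.disjoint_left]
    intro w hw hw'
    obtain ⟨-, -, h1, h2⟩ := hED e he
    obtain ⟨-, -, h1', h2'⟩ := hED e' he'
    have := hE' e he e' he' _ (hk w) ((hin e h1 h2 w).1 hw) ((hin e' h1' h2' w).1 hw')
    exact hrr (by rw [this])
  have hck : c.1 k ≤ p k ∧ p k ≤ c.2 k := ⟨hp.1 k, hp.2 k⟩
  have hpw : (p i, p j) ∈ Icc (c.1 i, c.1 j) (c.2 i, c.2 j) \ ⋃ r ∈ R, Icc r.1 r.2 := by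
    refine ⟨⟨⟨hp.1 i, hp.1 j⟩, ⟨hp.2 i, hp.2 j⟩⟩, fun h => ?_⟩
    simp only [mem_iUnion, exists_prop] at h
    obtain ⟨r, hr, h⟩ := h
    obtain ⟨e, he, rfl⟩ := Finset.mem_image.1 hr
    obtain ⟨heD, hec, h1, h2⟩ := hED e he
    have := (hin e h1 h2 _).1 h
    simp only [hep] at this
    exact hec (hu e heD this)
  have key : ∀ w ∈ Icc (c.1 i, c.1 j) (c.2 i, c.2 j) \ ⋃ r ∈ R, Icc r.1 r.2,
      (tri i j w.1 w.2 (p k) : Point) ∈ Icc c.1 c.2 ∧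
        (tri i j w.1 w.2 (p k) : Point) ∈ cutSurface D k F := by
    rintro w ⟨hw, hwR⟩
    have h1 := (hin c hck.1 hck.2 w).1 hw
    have h2 : ∀ e ∈ D, (tri i j w.1 w.2 (p k) : Point) ∈ Icc e.1 e.2 → e = c := by
      intro e he hwe
      by_contra hec
      have h3 := hE e he _ h1 (hk w) hwe hec
      have h4 := hwe.1 k
      have h5 := hwe.2 k
      rw [hk] at h4 h5
      refine hwR (mem_iUnion₂.2 ⟨_, Finset.mem_image_of_mem _ h3, (hin e h4 h5 w).2 hwe⟩)
    exact ⟨h1, hD.mem_cutSurface_of_forall_eq hF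
      (hD.mem_frontier_of_forall_eq hc h1 (by rwa [hk]) h2) h2⟩
  obtain ⟨w, hw, hwb, hl⟩ := exists_linked_boundary hRne hRd hpw
  have hl' := hl.image (continuous_tri i j (p k)) (T := cutSurface D k F) fun w hw => (key w hw).2
  simp only [hep] at hl'
  refine hl'.trans (hD.linked_of_onSide hF hc (key w hw).2 (key w hw).1 ?_)
  rcases hwb with h | h
  · exact ⟨i, hik, Or.inr (by rw [tri_fst]; exact h)⟩
  · exact ⟨j, hjk, Or.inr (by rw [tri_snd hij.symm]; exact h)⟩

/-- The obstacles on the bottom face are the boxes with their tops at that level, those on the top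
face the boxes with their bottoms there. Boxes of either kind that share a point coincide. -/
theorem IsDecomposition.linked_of_forall_eq (hD : IsDecomposition D k) (hF : F ⊆ contacts D k)
    {c : Point × Point} (hc : c ∈ D) {p : Point} (hp : p ∈ Icc c.1 c.2)
    (hpk : p k = c.1 k ∨ p k = c.2 k) (hu : ∀ e ∈ D, p ∈ Icc e.1 e.2 → e = c) :
    Linked (cutSurface D k F) p (basePoint k c) := by
  classical
  have hn := hD.nondeg c hc k
  have hslab : ∀ e ∈ D, ∀ q ∈ Icc c.1 c.2, q ∈ Icc e.1 e.2 → e ≠ c →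
      ¬ (c.1 k < e.2 k ∧ e.1 k < c.2 k) := by
    rintro e he q hq hqe hec ⟨h1, h2⟩
    obtain ⟨h3, h4⟩ := hD.slab c hc e he h1 h2
    exact hec (hD.eq_of_mem c hc e he h3 h4 q hq hqe).symm
  rcases hpk with h | h
  · refine hD.linked_of_obstacles hF hc hp (Or.inl h) hu
      (E := D.filter fun e => e.2 k = p k) ?_ ?_ ?_
    · intro e he
      obtain ⟨he, hek⟩ := Finset.mem_filter.1 he
      have := hD.nondeg e he k
      refine ⟨he, ?_, by linarith, hek.ge⟩
      rintro rfl
      linarith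
    · intro e he q hq hqk hqe hec
      have h1 := hqe.1 k
      have h2 := hqe.2 k
      refine Finset.mem_filter.2 ⟨he, le_antisymm (not_lt.1 fun h3 => ?_) (by linarith)⟩
      exact hslab e he q hq hqe hec ⟨by linarith, by linarith⟩
    · intro e he e' he' q hqk hq hq'
      obtain ⟨he, hek⟩ := Finset.mem_filter.1 he
      obtain ⟨he', hek'⟩ := Finset.mem_filter.1 he'
      exact hD.eq_of_top he he' hq hq' (by linarith) (by linarith)
  · refine hD.linked_of_obstacles hF hc hp (Or.inr h) hu
      (E := D.filter fun e => e.1 k = p k) ?_ ?_ ?_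
    · intro e he
      obtain ⟨he, hek⟩ := Finset.mem_filter.1 he
      have := hD.nondeg e he k
      refine ⟨he, ?_, hek.le, by linarith⟩
      rintro rfl
      linarith
    · intro e he q hq hqk hqe hec
      have h1 := hqe.1 k
      have h2 := hqe.2 k
      refine Finset.mem_filter.2 ⟨he, le_antisymm (by linarith) (not_lt.1 fun h3 => ?_)⟩
      exact hslab e he q hq hqe hec ⟨by linarith, by linarith⟩
    · intro e he e' he' q hqk hq hq'
      obtain ⟨he, hek⟩ := Finset.mem_filter.1 he
      obtain ⟨he', hek'⟩ := Finset.mem_filter.1 he'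
      exact hD.eq_of_bottom he he' hq hq' (by linarith) (by linarith)

end

/-! ### Connectedness of the cut surface -/

section
variable {D : Finset (Point × Point)} {k : Fin 3}
  {F : Finset ((Point × Point) × (Point × Point))}

theorem IsDecomposition.level_of_ne (hD : IsDecomposition D k) {c e : Point × Point} (hc : c ∈ D)
    (he : e ∈ D) (hce : c ≠ e) {p : Point} (hp : p ∈ Icc c.1 c.2) (hpe : p ∈ Icc e.1 e.2) :
    (p k = c.1 k ∧ p k = e.2 k) ∨ (p k = c.2 k ∧ p k = e.1 k) := by
  have key : ∀ {c e : Point × Point}, c ∈ D → e ∈ D → c ≠ e → p ∈ Icc c.1 c.2 →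
      p ∈ Icc e.1 e.2 → p k = c.1 k ∨ p k = c.2 k := by
    intro c e hc he hce hp hpe
    rcases (hp.1 k).lt_or_eq with h1 | h1
    · rcases (hp.2 k).lt_or_eq with h2 | h2
      · exact absurd (hD.eq_of_inside hc he hp hpe h1 h2) hce
      · exact Or.inr h2
    · exact Or.inl h1.symm
  rcases key hc he hce hp hpe with h | h <;> rcases key he hc hce.symm hpe hp with h' | h'
  · exact absurd (hD.eq_of_bottom hc he hp hpe h h') hce
  · exact Or.inl ⟨h, h'⟩
  · exact Or.inr ⟨h, h'⟩
  · exact absurd (hD.eq_of_top hc he hp hpe h h') hce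

/-- Distinct boxes meet only top to bottom, and of three boxes at a point two would be on the same
side. -/
theorem IsDecomposition.eq_or_eq (hD : IsDecomposition D k) {c e f : Point × Point} (hc : c ∈ D)
    (he : e ∈ D) (hf : f ∈ D) (hce : c ≠ e) {p : Point} (hp : p ∈ Icc c.1 c.2)
    (hpe : p ∈ Icc e.1 e.2) (hpf : p ∈ Icc f.1 f.2) : f = c ∨ f = e := by
  by_contra hcon
  push Not at hcon
  have h1 := hD.level_of_ne hc he hce hp hpe
  have h2 := hD.level_of_ne hf hc hcon.1 hpf hp
  have h3 := hD.level_of_ne hf he hcon.2 hpf hpe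
  have := hD.nondeg c hc k
  have := hD.nondeg e he k
  have := hD.nondeg f hf k
  rcases h1 with ⟨a1, a2⟩ | ⟨a1, a2⟩ <;> rcases h2 with ⟨b1, b2⟩ | ⟨b1, b2⟩ <;>
    rcases h3 with ⟨d1, d2⟩ | ⟨d1, d2⟩ <;> linarith

theorem boxOct_of_strict {c : Point × Point} {p : Point}
    (h : ∀ l, l ≠ k → c.1 l < p l ∧ p l < c.2 l) {σ : Fin 3 → Bool}
    (hk : cOct (c.1 k) (c.2 k) (p k) (σ k)) : boxOct c p σ := by
  intro l
  by_cases hl : l = k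
  · subst hl; exact hk
  · exact ⟨fun _ => ⟨(h l hl).1.le, (h l hl).2⟩, fun _ => ⟨(h l hl).1, (h l hl).2.le⟩⟩

/-- A surface point lies on a vertical side of some box, or else horizontally inside all boxes that
contain it. In the latter case it is on a horizontal face of just one box: a box below and a box
above would together fill all octants. -/
theorem IsDecomposition.exists_linked (hD : IsDecomposition D k) (hF : F ⊆ contacts D k)
    {p : Point} (hp : p ∈ cutSurface D k F) :
    ∃ c ∈ D, Linked (cutSurface D k F) p (basePoint k c) := by
  have hfr := (mem_cutSurface.1 hp).1
  obtain ⟨⟨τ, c, hc, hτ⟩, σ, hσ⟩ := (mem_frontier_boxUnion hD.nondeg).1 hfr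
  have hpc := hτ.mem
  by_cases hside : ∃ e ∈ D, p ∈ Icc e.1 e.2 ∧ OnSide k e p
  · obtain ⟨e, he, hpe, hs⟩ := hside
    exact ⟨e, he, hD.linked_of_onSide hF he hp hpe hs⟩
  have hstrict : ∀ e ∈ D, p ∈ Icc e.1 e.2 → ∀ l, l ≠ k → e.1 l < p l ∧ p l < e.2 l := by
    intro e he hpe l hl
    refine ⟨lt_of_le_of_ne (hpe.1 l) fun h => ?_, lt_of_le_of_ne (hpe.2 l) fun h => ?_⟩
    · exact hside ⟨e, he, hpe, l, hl, Or.inl h.symm⟩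
    · exact hside ⟨e, he, hpe, l, hl, Or.inr h⟩
  have hnot : ∀ e ∈ D, p ∈ Icc e.1 e.2 → ¬ cOct (e.1 k) (e.2 k) (p k) (σ k) :=
    fun e he hpe h => hσ ⟨e, he, boxOct_of_strict (hstrict e he hpe) h⟩
  have hlevel : p k = c.1 k ∨ p k = c.2 k := by
    by_contra hcon
    push Not at hcon
    have h1 := lt_of_le_of_ne (hpc.1 k) (Ne.symm hcon.1)
    have h2 := lt_of_le_of_ne (hpc.2 k) hcon.2
    exact hnot c hc hpc ⟨fun _ => ⟨h1.le, h2⟩, fun _ => ⟨h1, h2.le⟩⟩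
  by_cases hu : ∀ e ∈ D, p ∈ Icc e.1 e.2 → e = c
  · exact ⟨c, hc, hD.linked_of_forall_eq hF hc hpc hlevel hu⟩
  exfalso
  push Not at hu
  obtain ⟨e, he, hpe, hec⟩ := hu
  have hn := hD.nondeg c hc k
  have hn' := hD.nondeg e he k
  have h1 := hnot c hc hpc
  have h2 := hnot e he hpe
  rcases hD.level_of_ne hc he hec.symm hpc hpe with ⟨h3, h4⟩ | ⟨h3, h4⟩ <;> cases hs : σ k <;>
    rw [hs] at h1 h2
  · exact h2 (by rw [h4]; simp [cOct, hn'])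
  · exact h1 (by rw [h3]; simp [cOct, hn])
  · exact h1 (by rw [h3]; simp [cOct, hn])
  · exact h2 (by rw [h4]; simp [cOct, hn'])

/-- The passage between the surfaces of `c` and `e` is a point `q` of their contact loop, which is
not cut. On the side where `c` does not extend beyond `e`, the point `q` lies on a side of `c` and
on a horizontal face of `e`. -/
theorem IsDecomposition.linked_of_touch_of_le (hD : IsDecomposition D k) (hF : F ⊆ contacts D k)
    {c e : Point × Point} (hc : c ∈ D) (he : e ∈ D) (hce : c ≠ e) {p : Point}
    (hp : p ∈ Icc c.1 c.2) (hpe : p ∈ Icc e.1 e.2) (h1 : (c, e) ∉ F) (h2 : (e, c) ∉ F)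
    {i : Fin 3} (hik : i ≠ k) (hi : c.2 i ≤ e.2 i) :
    Linked (cutSurface D k F) (basePoint k c) (basePoint k e) := by
  set q := Function.update p i (c.2 i) with hq
  have hqi : q i = c.2 i := by simp [hq]
  have hqc : q ∈ Icc c.1 c.2 := update_mem_Icc hp ⟨(hD.nondeg c hc i).le, le_rfl⟩
  have hqe : q ∈ Icc e.1 e.2 := update_mem_Icc hpe ⟨(hpe.1 i).trans (hp.2 i), hi⟩
  have hside : OnSide k c q := ⟨i, hik, Or.inr hqi⟩
  have hqS : q ∈ cutSurface D k F := by
    refine mem_cutSurface.2 ⟨hD.mem_frontier_of_onSide hc hqc hside, fun x hx hqx => ?_⟩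
    obtain ⟨m1, m2, -, -⟩ := mem_contacts.1 (hF hx)
    have hne := hD.ne_of_mem_contacts (hF hx)
    obtain ⟨a, b⟩ := x
    rcases hD.eq_or_eq (f := a) hc he m1 hce hqc hqe hqx.1 with rfl | rfl <;>
      rcases hD.eq_or_eq (f := b) hc he m2 hce hqc hqe hqx.2.1 with rfl | rfl
    · exact hne rfl
    · exact h1 hx
    · exact h2 hx
    · exact hne rfl
  have hlc := (hD.linked_of_onSide hF hc hqS hqc hside).symm
  rcases hi.eq_or_lt with hi | hi
  · exact hlc.trans (hD.linked_of_onSide hF he hqS hqe ⟨i, hik, Or.inr (hqi.trans hi)⟩)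
  -- If `e` extends strictly beyond `c`, step outwards from `q` on the face of `e`. Close to `q` no
  -- box other than `c` and `e` can occur, and `c` has just been left, so the new points are in `e`
  -- alone.
  have hev : ∀ᶠ s in 𝓝[≥] (c.2 i), ∀ f ∈ D, Function.update q i s ∈ Icc f.1 f.2 →
      q ∈ Icc f.1 f.2 := by
    rw [Filter.eventually_all_finset]
    intro f hf
    by_cases hqf : q ∈ Icc f.1 f.2
    · exact Filter.Eventually.of_forall fun _ _ => hqf
    have hcont : Filter.Tendsto (fun s => Function.update q i s) (𝓝[≥] (c.2 i)) (𝓝 q) := by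
      have := (continuous_update_const q i).tendsto (c.2 i)
      rw [← hqi, Function.update_eq_self, hqi] at this
      exact this.mono_left nhdsWithin_le_nhds
    filter_upwards [hcont.eventually ((isClosed_Icc (a := f.1) (b := f.2)).isOpen_compl.mem_nhds hqf)]
      with s hs hs'
    exact absurd hs' hs
  obtain ⟨u, hu, hsub⟩ := mem_nhdsGE_iff_exists_Icc_subset.1 hev
  set s₀ := min u (e.2 i) with hs₀
  have hs₀1 : c.2 i < s₀ := lt_min hu hi
  have hlevel : q k = e.1 k ∨ q k = e.2 k := by
    rcases hD.level_of_ne hc he hce hqc hqe with h | h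
    · exact Or.inr h.2
    · exact Or.inl h.2
  have key : ∀ s, c.2 i < s → s ≤ s₀ → Function.update q i s ∈ Icc e.1 e.2 ∧
      (Function.update q i s k = e.1 k ∨ Function.update q i s k = e.2 k) ∧
      ∀ f ∈ D, Function.update q i s ∈ Icc f.1 f.2 → f = e := by
    intro s hs hs'
    refine ⟨update_mem_Icc hqe ⟨?_, hs'.trans (min_le_right _ _)⟩, ?_, fun f hf hsf => ?_⟩
    · exact ((hqe.1 i).trans_eq hqi).trans hs.le
    · rwa [Function.update_of_ne hik.symm]
    · rcases hD.eq_or_eq hc he hf hce hqc hqe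
        (hsub ⟨hs.le, hs'.trans (min_le_left _ _)⟩ f hf hsf) with rfl | rfl
      · have := hsf.2 i
        rw [Function.update_self] at this
        linarith
      · rfl
  obtain ⟨k1, k2, k3⟩ := key s₀ hs₀1 le_rfl
  refine hlc.trans (Linked.trans ?_ (hD.linked_of_forall_eq hF he k1 k2 k3))
  refine ⟨(fun s => Function.update q i s) '' Icc (c.2 i) s₀, ?_,
    isPreconnected_Icc.image _ (continuous_update_const q i).continuousOn,
    ⟨c.2 i, left_mem_Icc.2 hs₀1.le, ?_⟩, ⟨s₀, right_mem_Icc.2 hs₀1.le, rfl⟩⟩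
  · rintro _ ⟨s, hs, rfl⟩
    rcases hs.1.eq_or_lt with h | h
    · rw [← h, ← hqi]; simpa using hqS
    · obtain ⟨l1, l2, l3⟩ := key s h hs.2
      exact hD.mem_cutSurface_of_forall_eq hF (hD.mem_frontier_of_forall_eq he l1 l2 l3) l3
  · simp [hq]

theorem IsDecomposition.linked_of_touch (hD : IsDecomposition D k) (hF : F ⊆ contacts D k)
    {c e : Point × Point} (hc : c ∈ D) (he : e ∈ D) (hce : c ≠ e) {p : Point}
    (hp : p ∈ Icc c.1 c.2) (hpe : p ∈ Icc e.1 e.2) (h1 : (c, e) ∉ F) (h2 : (e, c) ∉ F) :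
    Linked (cutSurface D k F) (basePoint k c) (basePoint k e) := by
  obtain ⟨i, -, -, hik, -⟩ := exists_others k
  rcases le_total (c.2 i) (e.2 i) with h | h
  · exact hD.linked_of_touch_of_le hF hc he hce hp hpe h1 h2 hik h
  · exact (hD.linked_of_touch_of_le hF he hc hce.symm hpe hp h2 h1 hik h).symm

/-- Two boxes of `D` are adjacent if they intersect. -/
def touchGraph (D : Finset (Point × Point)) : SimpleGraph {c // c ∈ D} where
  Adj c e := c ≠ e ∧ (Icc c.1.1 c.1.2 ∩ Icc e.1.1 e.1.2).Nonempty
  symm := ⟨fun c e h => ⟨h.1.symm, by rw [inter_comm]; exact h.2⟩⟩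
  loopless := ⟨fun _ h => h.1 rfl⟩

/-- Every point is linked to the base point of some box, and paths in `G` link the base points with
each other through uncut contacts. -/
theorem IsDecomposition.isPreconnected_cutSurface (hD : IsDecomposition D k)
    (hF : F ⊆ contacts D k) {G : SimpleGraph {c // c ∈ D}} (hG : G.Connected)
    (hGT : G ≤ touchGraph D) (hGF : ∀ c e, G.Adj c e → (c.1, e.1) ∉ F) :
    IsPreconnected (cutSurface D k F) := by
  obtain ⟨c₀⟩ := hG.nonempty
  have hbase : ∀ c : {c // c ∈ D}, basePoint k c.1 ∈ cutSurface D k F := by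
    intro c
    have hn := hD.nondeg c.1 c.2
    have hk := hn k
    obtain ⟨i, -, -, hik, -⟩ := exists_others k
    refine hD.mem_cutSurface_of_onSide hF c.2 (update_mem_Icc (left_mem_Icc.2 fun l => (hn l).le)
      ⟨?_, ?_⟩) (OnSide.update ⟨i, hik, Or.inl rfl⟩ _) ?_ ?_ <;>
      first | linarith | simp only [basePoint, Function.update_self]; linarith
  have hlink : ∀ c : {c // c ∈ D}, Linked (cutSurface D k F) (basePoint k c₀.1) (basePoint k c.1) := by
    intro c
    obtain ⟨w⟩ := hG.preconnected c₀ c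
    induction w with
    | nil => exact Linked.refl (hbase _)
    | cons h w ih =>
      obtain ⟨h1, p, hp, hp'⟩ := hGT h
      exact (hD.linked_of_touch hF (Subtype.prop _) (Subtype.prop _) (fun h => h1 (Subtype.ext h))
        hp hp' (hGF _ _ h) (hGF _ _ h.symm)).trans ih
  refine isPreconnected_of_linked (basePoint k c₀.1) fun p hp => ?_
  obtain ⟨c, hc, hl⟩ := hD.exists_linked hF hp
  exact (hlink ⟨c, hc⟩).trans hl.symm

/-- The boxes reachable from `a` and the other ones have closed unions covering the polyhedron. By
connectedness these unions meet, in a point common to a reachable and an unreachable box. -/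
theorem touchGraph_connected (hD : ∀ c ∈ D, ∀ i, c.1 i < c.2 i)
    (h : IsConnected (boxUnion D)) : (touchGraph D).Connected := by
  obtain ⟨p, hp⟩ := h.nonempty
  obtain ⟨c₀, hc₀, -⟩ := mem_boxUnion.1 hp
  have : Nonempty {c // c ∈ D} := ⟨⟨c₀, hc₀⟩⟩
  rw [SimpleGraph.connected_iff]
  refine ⟨fun a b => ?_, this⟩
  by_contra hab
  have hcl : ∀ T : Set {c // c ∈ D}, IsClosed (⋃ c ∈ T, Icc c.1.1 c.1.2) :=
    fun T => T.toFinite.isClosed_biUnion fun _ _ => isClosed_Icc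
  have hmem : ∀ c : {c // c ∈ D}, c.1.1 ∈ Icc c.1.1 c.1.2 :=
    fun c => left_mem_Icc.2 fun l => (hD c.1 c.2 l).le
  have hne : ∀ (T : Set {c // c ∈ D}), ∀ c ∈ T,
      (boxUnion D ∩ ⋃ c ∈ T, Icc c.1.1 c.1.2).Nonempty := fun T c hc =>
    ⟨c.1.1, mem_boxUnion.2 ⟨c.1, c.2, hmem c⟩, mem_iUnion₂.2 ⟨c, hc, hmem c⟩⟩
  have hcov : boxUnion D ⊆ (⋃ c ∈ {c | (touchGraph D).Reachable a c}, Icc c.1.1 c.1.2) ∪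
      ⋃ c ∈ {c | (touchGraph D).Reachable a c}ᶜ, Icc c.1.1 c.1.2 := by
    intro q hq
    obtain ⟨c, hc, hqc⟩ := mem_boxUnion.1 hq
    by_cases hr : (touchGraph D).Reachable a ⟨c, hc⟩
    · exact Or.inl (mem_iUnion₂.2 ⟨_, hr, hqc⟩)
    · exact Or.inr (mem_iUnion₂.2 ⟨_, hr, hqc⟩)
  obtain ⟨q, -, hq1, hq2⟩ := isPreconnected_closed_iff.1 h.isPreconnected _ _ (hcl _) (hcl _) hcov
    (hne _ a (SimpleGraph.Reachable.refl a)) (hne _ b hab)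
  obtain ⟨c, hc, hqc⟩ := mem_iUnion₂.1 hq1
  obtain ⟨e, he, hqe⟩ := mem_iUnion₂.1 hq2
  refine he (SimpleGraph.Reachable.trans hc ?_)
  by_cases hce : c = e
  · rw [hce]
  · exact SimpleGraph.Adj.reachable (G := touchGraph D) ⟨hce, q, hqc, hqe⟩

/-! ### Cutting along loops -/

/-- The overlap condition makes the contact a nondegenerate rectangle, and the loop is its boundary.
-/
theorem IsDecomposition.isSimpleClosedCurve_contactLoop (hD : IsDecomposition D k)
    {x : (Point × Point) × (Point × Point)} (hx : x ∈ contacts D k) :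
    IsSimpleClosedCurve (contactLoop k x) := by
  obtain ⟨h1, h2, h3, p, hp, hp'⟩ := mem_contacts.1 hx
  obtain ⟨c, e⟩ := x
  obtain ⟨i, j, hij, hik, hjk⟩ := exists_others k
  simp only at h1 h2 h3 hp hp'
  have hov := hD.overlap c h1 e h2 h3 p hp hp'
  have hc := hD.nondeg c h1
  have he := hD.nondeg e h2
  have hlt : ∀ l, l ≠ k → max (c.1 l) (e.1 l) < min (c.2 l) (e.2 l) := fun l hl =>
    max_lt (lt_min (hc l) (hov l hl).1) (lt_min (hov l hl).2 (he l))
  obtain ⟨γ, hγ, hγi, hγr⟩ := exists_circle_param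
    (a := (max (c.1 i) (e.1 i), max (c.1 j) (e.1 j)))
    (b := (min (c.2 i) (e.2 i), min (c.2 j) (e.2 j))) (hlt i hik) (hlt j hjk)
  refine ⟨fun t => tri i j (γ t).1 (γ t).2 (c.2 k), (continuous_tri i j (c.2 k)).comp hγ, ?_, ?_⟩
  · intro t t' htt
    apply hγi
    have e1 := congrFun htt i
    have e2 := congrFun htt j
    simp only [tri_fst, tri_snd hij.symm] at e1 e2
    exact Prod.ext e1 e2
  have key : ∀ w : ℝ × ℝ, w ∈ rectBoundary (max (c.1 i) (e.1 i), max (c.1 j) (e.1 j))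
      (min (c.2 i) (e.2 i), min (c.2 j) (e.2 j)) ↔
        (tri i j w.1 w.2 (c.2 k) : Point) ∈ contactLoop k (c, e) := by
    intro w
    have hs : ∀ f : Point × Point, OnSide k f (tri i j w.1 w.2 (c.2 k)) ↔
        (w.1 = f.1 i ∨ w.1 = f.2 i) ∨ (w.2 = f.1 j ∨ w.2 = f.2 j) := by
      intro f
      constructor
      · rintro ⟨l, hl, h⟩
        rcases fin3_cases hij hik hjk l with rfl | rfl | rfl
        · rw [tri_fst] at h; exact Or.inl h
        · rw [tri_snd hij.symm] at h; exact Or.inr h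
        · exact absurd rfl hl
      · rintro (h | h)
        · exact ⟨i, hik, by rwa [tri_fst]⟩
        · exact ⟨j, hjk, by rwa [tri_snd hij.symm]⟩
    simp only [contactLoop, mem_ofPred_eq, hs, tri_mem_Icc hij hik hjk, rectBoundary]
    simp only [mem_Icc, Prod.le_def, max_le_iff, le_min_iff]
    have m1 : ∀ {a b x : ℝ}, a ≤ x → b ≤ x → (x = max a b ↔ x = a ∨ x = b) := by
      intro a b x h h'
      constructor
      · intro hx
        rcases max_choice a b with hm | hm
        · exact Or.inl (hx.trans hm)
        · exact Or.inr (hx.trans hm)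
      · rintro (rfl | rfl)
        · exact (max_eq_left h').symm
        · exact (max_eq_right h).symm
    have m2 : ∀ {a b x : ℝ}, x ≤ a → x ≤ b → (x = min a b ↔ x = a ∨ x = b) := by
      intro a b x h h'
      constructor
      · intro hx
        rcases min_choice a b with hm | hm
        · exact Or.inl (hx.trans hm)
        · exact Or.inr (hx.trans hm)
      · rintro (rfl | rfl)
        · exact (min_eq_left h').symm
        · exact (min_eq_right h).symm
    have hk1 : c.1 k ≤ c.2 k := (hc k).le
    have hk2 : e.1 k ≤ c.2 k := h3.ge
    have hk3 : c.2 k ≤ e.2 k := h3.trans_le (he k).le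
    constructor
    · rintro ⟨⟨⟨⟨a1, a2⟩, a3, a4⟩, ⟨a5, a6⟩, a7, a8⟩, h⟩
      rw [m1 a1 a2, m2 a5 a6, m1 a3 a4, m2 a7 a8] at h
      refine ⟨⟨⟨a1, a5⟩, ⟨a3, a7⟩, hk1, le_rfl⟩, ⟨⟨a2, a6⟩, ⟨a4, a8⟩, hk2, hk3⟩, ?_⟩
      tauto
    · rintro ⟨⟨⟨a1, a5⟩, ⟨a3, a7⟩, -⟩, ⟨⟨a2, a6⟩, ⟨a4, a8⟩, -⟩, h⟩
      rw [m1 a1 a2, m2 a5 a6, m1 a3 a4, m2 a7 a8]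
      tauto
  ext q
  constructor
  · intro hq
    have hqk : q k = c.2 k := le_antisymm (hq.1.2 k) (h3.trans_le (hq.2.1.1 k))
    have hqe : tri i j (q i) (q j) (c.2 k) = q := by rw [← hqk]; exact tri_eta hij hik hjk q
    have : (q i, q j) ∈ range γ := by rw [hγr, key]; simpa only [hqe] using hq
    obtain ⟨t, ht⟩ := this
    exact ⟨t, by simp only [ht]; exact hqe⟩
  · rintro ⟨t, rfl⟩
    exact (key _).1 (hγr ▸ mem_range_self t)

theorem IsDecomposition.disjoint_contactLoop (hD : IsDecomposition D k)
    {x y : (Point × Point) × (Point × Point)} (hx : x ∈ contacts D k) (hy : y ∈ contacts D k)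
    (hxy : x ≠ y) : Disjoint (contactLoop k x) (contactLoop k y) := by
  rw [Set.disjoint_left]
  intro p hp hp'
  obtain ⟨h1, h2, h3, -⟩ := mem_contacts.1 hx
  obtain ⟨h1', h2', h3', -⟩ := mem_contacts.1 hy
  have e1 := le_antisymm (hp.1.2 k) (h3.trans_le (hp.2.1.1 k))
  have e2 := le_antisymm (hp'.1.2 k) (h3'.trans_le (hp'.2.1.1 k))
  exact hxy (Prod.ext (hD.eq_of_top h1 h1' hp.1 hp'.1 e1 e2)
    (hD.eq_of_bottom h2 h2' hp.2.1 hp'.2.1 (e1.trans h3) (e2.trans h3')))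

theorem IsDecomposition.contactLoop_subset (hD : IsDecomposition D k)
    {x : (Point × Point) × (Point × Point)} (hx : x ∈ contacts D k) :
    contactLoop k x ⊆ frontier (boxUnion D) := by
  obtain ⟨h1, h2, -, -⟩ := mem_contacts.1 hx
  rintro p ⟨hp, hp', h | h⟩
  · exact hD.mem_frontier_of_onSide h1 hp h
  · exact hD.mem_frontier_of_onSide h2 hp' h

theorem IsDecomposition.canCut (hD : IsDecomposition D k) (hF : F ⊆ contacts D k)
    {G : SimpleGraph {c // c ∈ D}} (hG : G.Connected) (hGT : G ≤ touchGraph D)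
    (hGF : ∀ c e, G.Adj c e → (c.1, e.1) ∉ F) : CanCut (frontier (boxUnion D)) F.card := by
  -- With no cuts the same argument shows that the surface is connected, so the component occurring
  -- in `CanCut` is the whole surface.
  have hfr : IsPreconnected (frontier (boxUnion D)) := by
    have := hD.isPreconnected_cutSurface (F := ∅) (Finset.empty_subset _) hG hGT (by simp)
    simpa [cutSurface] using this
  have hcut := hD.isPreconnected_cutSurface hF hG hGT hGF
  set φ := F.equivFin with hφ
  refine ⟨fun n => contactLoop k (φ.symm n).1, fun n => ?_, fun n n' hn => ?_, fun x hx => ?_⟩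
  · have := hF (φ.symm n).2
    exact ⟨hD.isSimpleClosedCurve_contactLoop this, hD.contactLoop_subset this⟩
  · refine hD.disjoint_contactLoop (hF (φ.symm n).2) (hF (φ.symm n').2) fun h => hn ?_
    exact φ.symm.injective (Subtype.ext h)
  · have h : ⋃ n, contactLoop k (φ.symm n).1 = ⋃ x ∈ F, contactLoop k x := by
      ext p
      simp only [mem_iUnion, exists_prop]
      constructor
      · rintro ⟨n, hn⟩
        exact ⟨_, (φ.symm n).2, hn⟩
      · rintro ⟨x, hx, hp⟩
        exact ⟨φ ⟨x, hx⟩, by simpa using hp⟩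
    rw [hfr.connectedComponentIn hx, h]
    exact hcut

/-- A spanning tree of the touching graph accounts for at most `D.card - 1` contacts. The loops of
all others can be cut without disconnecting the surface, so they number at most `g`. -/
theorem IsDecomposition.card_contacts_le (hD : IsDecomposition D k)
    (hconn : IsConnected (boxUnion D)) {g : ℕ} (hg : genus (boxUnion D) = g) :
    (contacts D k).card + 1 ≤ g + D.card := by
  classical
  obtain ⟨T, hT, hTree⟩ := (touchGraph_connected hD.nondeg hconn).exists_isTree_le
  obtain ⟨I, hI⟩ : ∃ I : Finset (Sym2 (Point × Point)),
      I = T.edgeFinset.image (Sym2.map Subtype.val) := ⟨_, rfl⟩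
  set A := (contacts D k).filter fun x => s(x.1, x.2) ∈ I with hA
  set F := (contacts D k).filter fun x => ¬ s(x.1, x.2) ∈ I with hF
  have hAF : A.card + F.card = (contacts D k).card := Finset.card_filter_add_card_filter_not _
  -- An unordered pair of boxes gives only one contact, because two boxes cannot each lie on top of
  -- the other.
  have hinj : InjOn (fun x => s(x.1, x.2)) (contacts D k : Set ((Point × Point) × (Point × Point))) := by
    intro x hx y hy hxy
    obtain ⟨h1, h2, h3, -⟩ := mem_contacts.1 hx
    obtain ⟨-, -, h3', -⟩ := mem_contacts.1 hy
    rcases Sym2.eq_iff.1 hxy with h | h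
    · exact Prod.ext h.1 h.2
    · rw [← h.1, ← h.2] at h3'
      have := hD.nondeg _ h1 k
      have := hD.nondeg _ h2 k
      linarith
  have hA' : A.card ≤ T.edgeFinset.card := by
    have hAI : A.card ≤ I.card := by
      apply Finset.card_le_card_of_injOn fun x => s(x.1, x.2)
      · exact fun x hx => (Finset.mem_filter.1 hx).2
      · exact hinj.mono (Finset.coe_subset.2 (Finset.filter_subset _ _))
    exact hAI.trans (hI ▸ Finset.card_image_le)
  have hTc : T.edgeFinset.card + 1 = D.card := by
    rw [hTree.card_edgeFinset, Fintype.card_coe]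
  have hcut : CanCut (frontier (boxUnion D)) F.card := by
    refine hD.canCut (Finset.filter_subset _ _) hTree.connected hT fun c e hce h => ?_
    refine (Finset.mem_filter.1 h).2 (hI ▸ Finset.mem_image.2 ⟨s(c, e), ?_, rfl⟩)
    rwa [SimpleGraph.mem_edgeFinset, SimpleGraph.mem_edgeSet]
  have hle : (F.card : ℕ∞) ≤ genus (boxUnion D) :=
    le_iSup₂ (f := fun (n : ℕ) (_ : CanCut (frontier (boxUnion D)) n) => (n : ℕ∞)) F.card hcut
  rw [hg, Nat.cast_le] at hle
  omega

end

end OrthoPoly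

/-! ### The inequality -/

theorem lemmat4 (P : Set OrthoPoly.Point) (k : Fin 3) (hP : OrthoPoly.IsTwoReflex P k)
    (m r b g : ℕ) (hm : m = (OrthoPoly.edges P).ncard)
    (hr : r = (OrthoPoly.reflexEdges P).ncard)
    (hb : b = (OrthoPoly.collars P k).ncard)
    (hg : OrthoPoly.genus P = (g : ℕ∞)) :
    (m : ℤ) ≥ 4 * (r : ℤ) - 12 * (g : ℤ) - 4 * (b : ℤ) + 12 := by
  have hconn := hP.1.1
  obtain ⟨D, hD, rfl⟩ := OrthoPoly.exists_isDecomposition hP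
  have h1 := OrthoPoly.card_ends hD.nondeg
  have h2 := hD.card_ends_ge
  have h3 := hD.card_collars
  have h4 := hD.card_contacts_le hconn hg
  -- With `C` convex and `R` reflex ends, `m ≥ C + r` and `R ≥ r` give `m - 4r ≥ C - 3R`; this is at
  -- least `12` times boxes minus contacts, minus `4b`, and boxes minus contacts is at least `1 -
  -- g`.
  omega
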